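/- **Setting.** Let $\Omega\subset\mathbb R^2\cong\mathbb C$ be a bounded simply connected domain whose boundary $\Gamma=\partial\Omega$ is of class $C^{3,\alpha}$, $0<\alpha<1$, positively oriented, with arc length $ds$. Let $g:\Gamma\to\mathbb S^1$ be of class $C^{3,\alpha}$ and $g^\perp=ig$. For $x_0\in\overline\Omega$ put $\omega_\rho(x_0)=B_\rho(x_0)\cap\Omega$, $\Gamma_\rho(x_0)=\overline{\omega_\rho(x_0)}\cap\Gamma$, $A_{r,R}(x_0)=\omega_R(x_0)\setminus\overline{\omega_r(x_0)}$ and $\Gamma^\pm_{r,R}(x_0)=\overline{A_{r,R}(x_0)}\cap\Gamma$. For $u\in H^1(\Omega;\mathbb R^2)\cap C(\overline\Omega;\mathbb R^2)$, $\varepsilon\in(0,1)$ and $s\in(0,1]$ let $$E_\varepsilon(u)=\tfrac12\int_\Omega\Big(|\nabla u|^2+\tfrac1{2\varepsilon^2}(1-|u|^2)^2\Big)dx,\qquad E^{g,s}_\varepsilon(u)=E_\varepsilon(u)+\tfrac1{2\varepsilon^s}\int_\Gamma\langle u,g^\perp\rangle^2\,ds .$$ Write $\deg(u;\partial B_r(x_0))$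 for the degree of $u/|u|$ on the circle. For $x_0\in\Gamma$ and small $r$, the boundary index $\operatorname{ind}(u;\partial B_r(x_0)\cap\Omega)$ is the degree, along the positively oriented closed curve $(\partial B_r(x_0)\cap\Omega)\cup\Gamma_r(x_0)$, of a continuous $\mathbb S^1$-valued map $w$ that equals $(u/|u|)^2$ on $\partial B_r(x_0)\cap\Omega$ and its endpoints, and that on $\Gamma_r(x_0)$ satisfies $|\arg w-2\arg g|\le\pi/3$ for continuous choices of the arguments (it does not depend on the choice of $w$; when $\langle u,g^\perp\rangle=0$ at the endpoints one may take $w=g^2$ on $\Gamma_r(x_0)$). **Theorem.** There is $r_0>0$ depending only on $\Omega$ such that the following holds. *Strong tangential case.* Let $\tfrac34<\gamma<1$ and $K\in\mathbb R$. There is a constant $C$ depending only on $\Omega$, $g$, $\gamma$ and $K$ such that, whenever $\varepsilon\in(0,1)$, $u\in H^1(\Omega;\mathbb R^2)\cap C(\overline\Omega;\mathbb R^2)$, $x_0\in\overline\Omega$ and $\varepsilon\le r<R\le r_0$ satisfy $\tfrac12\le|u|\le1$ in $A_{r,R}(x_0)$, $\langle u,g^\perp\rangle=0$ on $\Gamma^\pm_{r,R}(x_0)$,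 $$E_\varepsilon(u)\le K|\ln\varepsilon|+K,\qquad \frac1{\varepsilon^2}\int_{\omega_{\varepsilon^\gamma}(x_0)}(1-|u|^2)^2\,dx\le K,$$ one has: (i) if $B_R(x_0)\subset\Omega$ and $d=\deg(u;\partial B_r(x_0))\ne0$, then $$\int_{A_{r,R}(x_0)}|\nabla u|^2\,dx\ \ge\ 2\pi d^2\ln\frac Rr-C\,d^2;$$ (ii) if $x_0\in\Gamma$ and $D=\operatorname{ind}(u;\partial B_r(x_0)\cap\Omega)\ne0$, then $$\int_{A_{r,R}(x_0)}|\nabla u|^2\,dx\ \ge\ \pi D^2\ln\frac Rr-C\,D^2 .$$ *Weak tangential case.* Let $s\in(0,1]$, $\tfrac34s<\gamma<s$ and $K\in\mathbb R$. There is a constant $C$ depending only on $\Omega$, $g$, $s$, $\gamma$ and $K$ such that, whenever $\varepsilon\in(0,1)$, $u\in H^1(\Omega;\mathbb R^2)\cap C(\overline\Omega;\mathbb R^2)$, $x_0\in\overline\Omega$ and $r<R\le r_0$ satisfy $\tfrac12\le|u|\le1$ in $A_{r,R}(x_0)$, $|\langle u,g^\perp\rangle|\le\tfrac14$ on $\Gamma^\pm_{r,R}(x_0)$,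 $$E^{g,s}_\varepsilon(u)\le K|\ln\varepsilon|+K,\qquad \frac1{\varepsilon^2}\int_{\omega_{\varepsilon^\gamma}(x_0)}(1-|u|^2)^2\,dx+\frac1{\varepsilon^s}\int_{\Gamma_{\varepsilon^\gamma}(x_0)}\langle u,g^\perp\rangle^2\,ds\le K,$$ the lower bound in (i) holds if $B_R(x_0)\subset\Omega$, $\varepsilon\le r$ and $d=\deg(u;\partial B_r(x_0))\ne0$, and the lower bound in (ii) holds if $x_0\in\Gamma$, $\varepsilon^s\le r$ and $D=\operatorname{ind}(u;\partial B_r(x_0)\cap\Omega)\ne0$. -/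

import Mathlib

open MeasureTheory Set Metric
open scoped NNReal ContDiff

noncomputable section

namespace GLTangential

/-! ### The domain and the boundary data -/

/-- A function of one real variable of class `C^{3,α}`. -/
def IsC3Holder (α : ℝ≥0) (f : ℝ → ℂ) : Prop :=
  ContDiff ℝ 3 f ∧ ∃ M : ℝ≥0, HolderWith M α (iteratedDeriv 3 f)

/-- `Ω ⊂ ℂ ≅ ℝ²` is a bounded simply connected domain with boundary of class `C^{3,α}`, and
`c` is the positively oriented arc-length parametrization of `Γ = ∂Ω`, of period (length) `L`.
The unit tangent at `c t` is `τ = c'(t)`, the inward unit normal is `i c'(t)`, and `Ω` lies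
locally on the left-hand side of `Γ` only. -/
structure IsC3Domain (α : ℝ≥0) (Ω : Set ℂ) (L : ℝ) (c : ℝ → ℂ) : Prop where
  isOpen : IsOpen Ω
  simplyConnected : IsSimplyConnected Ω
  bounded : Bornology.IsBounded Ω
  length_pos : 0 < L
  periodic : Function.Periodic c L
  regular : IsC3Holder α c
  unit_speed : ∀ t, ‖deriv c t‖ = 1
  injOn : InjOn c (Ico 0 L)
  range_eq : range c = frontier Ω
  inside : ∀ t, ∃ δ > 0, ∀ s ∈ Ioo (0 : ℝ) δ, c t + s * (Complex.I * deriv c t) ∈ Ω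
  outside : ∀ t, ∃ δ > 0, ∀ s ∈ Ioo (0 : ℝ) δ, c t - s * (Complex.I * deriv c t) ∉ closure Ω

/-- Boundary data `g : Γ → 𝕊¹` of class `C^{3,α}` (values of `g` off `Γ` are irrelevant). -/
structure IsBoundaryData (α : ℝ≥0) (Ω : Set ℂ) (c : ℝ → ℂ) (g : ℂ → ℂ) : Prop where
  unit : ∀ x ∈ frontier Ω, ‖g x‖ = 1
  regular : IsC3Holder α (fun t => g (c t))

/-- `u_⊥ = ⟨u, g^⊥⟩`, the real scalar product with `g^⊥ = i g`. -/
def perp (g u : ℂ → ℂ) (x : ℂ) : ℝ := inner ℝ (u x) (Complex.I * g x)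

/-! ### Local sets -/

/-- `ω_ρ(x₀) = B_ρ(x₀) ∩ Ω`. -/
def omega (Ω : Set ℂ) (x₀ : ℂ) (ρ : ℝ) : Set ℂ := ball x₀ ρ ∩ Ω

/-- `Γ_ρ(x₀)`, the intersection of `Γ` with the closure of `ω_ρ(x₀)`. -/
def arcGamma (Ω : Set ℂ) (x₀ : ℂ) (ρ : ℝ) : Set ℂ := closure (omega Ω x₀ ρ) ∩ frontier Ω

/-- `A_{r,R}(x₀)`, the set `ω_R(x₀)` minus the closure of `ω_r(x₀)`. -/
def annulus (Ω : Set ℂ) (x₀ : ℂ) (r R : ℝ) : Set ℂ := omega Ω x₀ R \ closure (omega Ω x₀ r)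

/-- `Γ^±_{r,R}(x₀)`, the intersection of `Γ` with the closure of `A_{r,R}(x₀)`. -/
def annulusGamma (Ω : Set ℂ) (x₀ : ℂ) (r R : ℝ) : Set ℂ :=
  closure (annulus Ω x₀ r R) ∩ frontier Ω

/-! ### Sobolev maps and energies -/

/-- `u ∈ H¹(Ω; ℝ²)` with weak partial derivatives `∂₁u = p` and `∂₂u = q`. -/
structure IsH1 (Ω : Set ℂ) (u p q : ℂ → ℂ) : Prop where
  memLp : MemLp u 2 (volume.restrict Ω)
  memLp_fst : MemLp p 2 (volume.restrict Ω)
  memLp_snd : MemLp q 2 (volume.restrict Ω)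
  weak_fst : ∀ φ : ℂ → ℝ, ContDiff ℝ ∞ φ → HasCompactSupport φ → tsupport φ ⊆ Ω →
    ∫ x in Ω, (fderiv ℝ φ x 1) • u x = -∫ x in Ω, φ x • p x
  weak_snd : ∀ φ : ℂ → ℝ, ContDiff ℝ ∞ φ → HasCompactSupport φ → tsupport φ ⊆ Ω →
    ∫ x in Ω, (fderiv ℝ φ x Complex.I) • u x = -∫ x in Ω, φ x • q x

/-- `|∇u|² = |∂₁u|² + |∂₂u|²`. -/
def gradSq (p q : ℂ → ℂ) (x : ℂ) : ℝ := ‖p x‖ ^ 2 + ‖q x‖ ^ 2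

/-- `∫_S (1 - |u|²)² dx`. -/
def potential (S : Set ℂ) (u : ℂ → ℂ) : ℝ := ∫ x in S, (1 - ‖u x‖ ^ 2) ^ 2

/-- The Ginzburg–Landau energy `E_ε(u)`. -/
def energy (Ω : Set ℂ) (ε : ℝ) (u p q : ℂ → ℂ) : ℝ :=
  1 / 2 * ∫ x in Ω, (gradSq p q x + 1 / (2 * ε ^ 2) * (1 - ‖u x‖ ^ 2) ^ 2)

/-- `∫_{Γ ∩ S} ⟨u, g^⊥⟩² ds`, with `ds` the arc length on `Γ`. -/
def bdryPenalty (L : ℝ) (c : ℝ → ℂ) (S : Set ℂ) (g u : ℂ → ℂ) : ℝ :=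
  ∫ t in Ico 0 L ∩ c ⁻¹' S, (perp g u (c t)) ^ 2

/-- The weakly anchored energy `E_ε^{g,s}(u)`. -/
def weakEnergy (Ω : Set ℂ) (L : ℝ) (c : ℝ → ℂ) (g : ℂ → ℂ) (s ε : ℝ) (u p q : ℂ → ℂ) : ℝ :=
  energy Ω ε u p q + 1 / (2 * ε ^ s) * bdryPenalty L c (frontier Ω) g u

/-! ### Degree and boundary index -/

/-- `φ` is a continuous phase of the unit-modulus function `w` on `[a, b]`: `w = e^{iφ}`. -/
def IsPhaseOn (w : ℝ → ℂ) (φ : ℝ → ℝ) (a b : ℝ) : Prop :=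
  ContinuousOn φ (Icc a b) ∧ ∀ t ∈ Icc a b, w t = Complex.exp (φ t * Complex.I)

/-- The direction `u/|u|`. -/
def direction (u : ℂ → ℂ) (x : ℂ) : ℂ := u x / (‖u x‖ : ℂ)

/-- `d = deg(u; ∂B_r(x₀))`, the degree of `u/|u|` along the positively oriented circle. -/
def IsDegree (u : ℂ → ℂ) (x₀ : ℂ) (r : ℝ) (d : ℤ) : Prop :=
  ∃ φ : ℝ → ℝ, IsPhaseOn (fun θ => direction u (circleMap x₀ r θ)) φ 0 (2 * Real.pi) ∧
    φ (2 * Real.pi) - φ 0 = 2 * Real.pi * d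

/-- `D = ind(u; ∂B_ρ(x₀) ∩ Ω)` for `x₀ ∈ Γ`, the boundary index.

The closed curve `C_ρ = (∂B_ρ(x₀) ∩ Ω) ∪ Γ_ρ(x₀)` runs counterclockwise along the circular arc
(angles `a` to `b`), and then back along `Γ_ρ(x₀)` (parameters `t₀` to `t₁`). `D` is the degree
along `C_ρ` of the map `w` to the unit circle that equals `(u/|u|)²` on the circular arc, with
continuous phase `ψ`, and is extended continuously to `Γ_ρ(x₀)`, with continuous phase `χ`,
in such a way that `|arg w - 2γ| ≤ π/3`, where `γ` is a continuous phase of `g` along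
`Γ_ρ(x₀)`. (In the strongly tangential case `w = g²` on `Γ_ρ(x₀)`, i.e. `χ = 2γ`, is one such
extension; the degree does not depend on the extension.) -/
def IsBoundaryIndex (Ω : Set ℂ) (c : ℝ → ℂ) (g u : ℂ → ℂ) (x₀ : ℂ) (ρ : ℝ) (D : ℤ) : Prop :=
  ∃ a b t₀ t₁ : ℝ, a < b ∧ b < a + 2 * Real.pi ∧ t₀ < t₁ ∧
    sphere x₀ ρ ∩ Ω = circleMap x₀ ρ '' Ioo a b ∧
    arcGamma Ω x₀ ρ = c '' Icc t₀ t₁ ∧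
    circleMap x₀ ρ b = c t₀ ∧ circleMap x₀ ρ a = c t₁ ∧
    ∃ ψ χ γ : ℝ → ℝ,
      IsPhaseOn (fun θ => direction u (circleMap x₀ ρ θ) ^ 2) ψ a b ∧
      IsPhaseOn (fun t => g (c t)) γ t₀ t₁ ∧
      ContinuousOn χ (Icc t₀ t₁) ∧
      (∀ t ∈ Icc t₀ t₁, |χ t - 2 * γ t| ≤ Real.pi / 3) ∧
      Complex.exp (χ t₀ * Complex.I) = direction u (c t₀) ^ 2 ∧
      Complex.exp (χ t₁ * Complex.I) = direction u (c t₁) ^ 2 ∧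
      (ψ b - ψ a) + (χ t₁ - χ t₀) = 2 * Real.pi * D

end GLTangential

end

/-! ### Continuous phases -/

/-! The bound comes from the angular derivative on circles about x₀. If v is C¹ and nonvanishing,
with angular derivative w, completing a square gives |w|² ≥ 2l·Im(w/v) − l²/|v|² for every real l
(`two_mul_im_div_sub_le`). The right side is linear in the angular speed of v. Dividing by ρ² and
integrating over a sector a(ρ) ≤ θ ≤ b(ρ) therefore gives ∫ (2lΔ(ρ) − l²(b − a)) dρ/ρ, where Δ is
the phase increment along the arc. The price is the modulus defect 4l² ∫ (1 − |u|²)/|x − x₀|²,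
because 1/|u|² ≤ 1 + 4(1 − |u|²) for 1/2 ≤ |u| ≤ 1. An H¹ map is first mollified on a compact sector
(`compact_sector_lower_bound`), and then the compact sectors exhaust the closed one
(`sector_lower_bound`).

In the interior the sector is the whole circle, Δ = 2πd, and l = d yields 4πd² − 2πd² = 2πd² as
coefficient of dρ/ρ (`interior_lower_bound`). At a boundary point, Ω contains arcs of opening at
most π + O(ρ) whose endpoints lie on Γ (`exists_isBoundaryChart`). There u is almost parallel to ±g,
so its phase is close to that of g plus πm₁ or πm₂, and the definition of the index forces m₂ − m₁ =
D. Hence Δ = πD + O(ρ) + O(|⟨u, g^⊥⟩|), and l = D yields 2πD² − πD² = πD² (`boundary_lower_bound`).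
The O(ρ) errors contribute O(r₀) against dρ/ρ. Since D is an integer, |D| ≤ D², so every error is a
multiple of D².

Two quantities remain to be bounded uniformly in ε: the modulus defect (`integral_shell_defect_le`)
and, for weak anchoring, ∫ |⟨u, g^⊥⟩| dρ/ρ along both branches of Γ (`integral_inv_mul_perp_le`).
Both follow from the arithmetic-geometric mean inequality with a scale-dependent weight. Below
radius ε^γ the local bound K is used; above it the global energy bound is used, whose factor |ln ε|
is absorbed by the positive power ε^(2−2γ), respectively ε^(s−γ). -/

/-- Maps from such a space lift through the covering `Complex.exp` of the punctured plane; the phase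
is the imaginary part of a lift. -/
theorem exists_continuous_phase {A : Type*} [TopologicalSpace A] [SimplyConnectedSpace A]
    [LocallyPathConnectedSpace A] {w : A → ℂ} (hw : Continuous w) (h0 : ∀ x, w x ≠ 0) :
    ∃ φ : A → ℝ, Continuous φ ∧ ∀ x, w x = ‖w x‖ * Complex.exp (φ x * Complex.I) := by
  obtain ⟨x₀⟩ : Nonempty A := inferInstance
  obtain ⟨F, ⟨-, hF⟩, -⟩ := Complex.isCoveringMapOn_exp.existsUnique_continuousMap_lifts
    ⟨w, hw⟩ (a₀ := x₀) (e₀ := Complex.log (w x₀)) (by simp [Complex.exp_log (h0 x₀)])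
    (fun x => by simp [h0 x])
  have hF' : ∀ x, Complex.exp (F x) = w x := fun x => congrFun hF x
  refine ⟨fun x => (F x).im, by fun_prop, fun x => ?_⟩
  rw [← hF', Complex.norm_exp, Complex.ofReal_exp, ← Complex.exp_add, Complex.re_add_im]

/-- The intervals of radius π/4 about the multiples of π are separated by gaps, so a continuous
function confined to their union stays in one of them. -/
theorem exists_int_near_of_continuousOn {f : ℝ → ℝ} {r R : ℝ} (hf : ContinuousOn f (Icc r R))
    (hrR : r ≤ R)
    (h : ∀ x ∈ Icc r R, ∃ m : ℤ, |f x - Real.pi * m| ≤ Real.pi / 4) :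
    ∃ m : ℤ, ∀ x ∈ Icc r R, |f x - Real.pi * m| ≤ Real.pi / 4 := by
  have hpi := Real.pi_pos
  obtain ⟨m, hm⟩ := h r ⟨le_rfl, hrR⟩
  refine ⟨m, fun x hx => ?_⟩
  by_contra! hlt
  have hc : ContinuousOn (fun y => |f y - Real.pi * m|) (Icc r x) :=
    ((hf.mono (Icc_subset_Icc_right hx.2)).sub continuousOn_const).abs
  obtain ⟨y, hy, hy'⟩ := intermediate_value_Icc hx.1 hc
    -- A value of the distance to πm in (π/4, π/2] lies in a gap: a multiple πk within π/4 of that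
    -- point would satisfy |k − m| < 1.
    (show min |f x - Real.pi * m| (Real.pi / 2) ∈ _ from
      ⟨hm.trans (le_min hlt.le (by linarith)), min_le_left _ _⟩)
  simp only at hy'
  obtain ⟨k, hk⟩ := h y ⟨hy.1, hy.2.trans hx.2⟩
  have h1 : |f y - Real.pi * m| ≤ Real.pi / 2 := hy' ▸ min_le_right _ _
  have h2 : Real.pi / 4 < |f y - Real.pi * m| := hy' ▸ lt_min hlt (by linarith)
  have h3 : |Real.pi * ((k : ℝ) - m)| < Real.pi := by
    have := abs_sub_le (Real.pi * k) (f y) (Real.pi * m)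
    rw [abs_sub_comm (Real.pi * k) (f y)] at this
    rw [mul_sub]; linarith
  rw [abs_mul, abs_of_pos hpi] at h3
  have h4 : |((k - m : ℤ) : ℝ)| < 1 := by
    push_cast
    exact lt_of_mul_lt_mul_left (by simpa using h3) hpi.le
  have h5 : k - m = 0 := Int.abs_lt_one_iff.mp (by exact_mod_cast h4)
  have : k = m := by omega
  subst this
  linarith

theorem exists_int_of_exp_eq {x y : ℝ}
    (h : Complex.exp (x * Complex.I) = Complex.exp (y * Complex.I)) :
    ∃ m : ℤ, x = y + m * (2 * Real.pi) := by
  obtain ⟨m, hm⟩ := Complex.exp_eq_exp_iff_exists_int.mp h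
  refine ⟨m, ?_⟩
  have := congrArg Complex.im hm
  simpa using this

/-- Two phases of one map differ by a continuous function with values in 2πℤ, which is constant.
Half the difference lies in πℤ, so `exists_int_near_of_continuousOn` applies. -/
theorem phase_increment_unique {φ ψ : ℝ → ℝ} {a b : ℝ} (hab : a ≤ b)
    (hφ : ContinuousOn φ (Icc a b)) (hψ : ContinuousOn ψ (Icc a b))
    (h : ∀ t ∈ Icc a b, Complex.exp (φ t * Complex.I) = Complex.exp (ψ t * Complex.I)) :
    φ b - φ a = ψ b - ψ a := by
  have hpi := Real.pi_pos
  have key : ∀ t ∈ Icc a b, ∃ m : ℤ, (φ t - ψ t) / 2 = Real.pi * m := fun t ht => by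
    obtain ⟨m, hm⟩ := exists_int_of_exp_eq (h t ht)
    exact ⟨m, by rw [hm]; ring⟩
  obtain ⟨m, hm⟩ := exists_int_near_of_continuousOn (f := fun t => (φ t - ψ t) / 2)
    ((hφ.sub hψ).div_const 2) hab (fun t ht => by
      obtain ⟨m, hm⟩ := key t ht
      exact ⟨m, by rw [hm]; simp; positivity⟩)
  have key2 : ∀ t ∈ Icc a b, (φ t - ψ t) / 2 = Real.pi * m := fun t ht => by
    obtain ⟨k, hk⟩ := key t ht
    have h1 := hm t ht
    simp only [hk] at h1
    rw [← mul_sub, abs_mul, abs_of_pos hpi] at h1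
    have h4 : |((k - m : ℤ) : ℝ)| < 1 := by
      push_cast
      nlinarith
    have h5 : k - m = 0 := Int.abs_lt_one_iff.mp (by exact_mod_cast h4)
    have : k = m := by omega
    rw [hk, this]
  have h1 := key2 a ⟨le_rfl, hab⟩
  have h2 := key2 b ⟨hab, le_rfl⟩
  linarith

/-- A continuous logarithm of a differentiable function is differentiable. -/
theorem hasDerivAt_of_exp_eq {ℓ v : ℝ → ℂ} {v' : ℂ} {x : ℝ} (hℓ : ContinuousAt ℓ x)
    (hv : HasDerivAt v v' x) (h : ∀ᶠ y in nhds x, Complex.exp (ℓ y) = v y) :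
    HasDerivAt ℓ (v' / v x) x := by
  have hx : Complex.exp (ℓ x) = v x := h.self_of_nhds
  have hx0 : v x ≠ 0 := hx ▸ Complex.exp_ne_zero _
  have h1 : HasDerivAt (fun y => ℓ x + Complex.log (v y / v x)) (v' / v x) x := by
    have h2 : HasDerivAt (fun y => v y / v x) (v' / v x) x := hv.div_const _
    have h3 := h2.clog_real (by simp [div_self hx0])
    simpa [div_self hx0] using h3.const_add (ℓ x)
  refine h1.congr_of_eventuallyEq ?_
  have h4 : ∀ᶠ y in nhds x, ℓ y ∈ ball (ℓ x) Real.pi :=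
    hℓ.eventually_mem (ball_mem_nhds _ Real.pi_pos)
  filter_upwards [h, h4] with y hy hy'
  have h5 : |(ℓ y - ℓ x).im| < Real.pi :=
    (Complex.abs_im_le_norm _).trans_lt (by simpa [dist_eq_norm] using hy')
  rw [← hy, ← hx, ← Complex.exp_sub, Complex.log_exp (abs_lt.mp h5).1 (abs_lt.mp h5).2.le]
  ring

/-- The angle swept by a nonvanishing `C¹` curve close to a continuous curve with given phase. -/
theorem abs_integral_im_logDeriv_sub_le {v v' u : ℝ → ℂ} {φ : ℝ → ℝ} {a b κ : ℝ} (hab : a ≤ b)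
    (hv : ∀ t, HasDerivAt v (v' t) t) (hv' : Continuous v') (hu : ContinuousOn u (Icc a b))
    (hφ : ContinuousOn φ (Icc a b))
    (hphase : ∀ t ∈ Icc a b, u t = ‖u t‖ * Complex.exp (φ t * Complex.I))
    (hlow : ∀ t ∈ Icc a b, 1 / 2 ≤ ‖u t‖) (hκ : κ ≤ 1 / 8)
    (hclose : ∀ t ∈ Icc a b, ‖v t - u t‖ ≤ κ) :
    |(∫ t in a..b, (v' t / v t).im) - (φ b - φ a)| ≤ 8 * Real.pi * κ := by
  have hu0 : ∀ t ∈ Icc a b, u t ≠ 0 := fun t ht h => by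
    have := hlow t ht; rw [h] at this; norm_num at this
  have hq : ∀ t ∈ Icc a b, ‖v t / u t - 1‖ ≤ 2 * κ := fun t ht => by
    rw [div_sub_one (hu0 t ht), norm_div, div_le_iff₀ (norm_pos_iff.mpr (hu0 t ht))]
    have := hclose t ht
    have := hlow t ht
    have : 0 ≤ κ := (norm_nonneg _).trans (hclose t ht)
    nlinarith
  have hre : ∀ t ∈ Icc a b, 1 / 2 ≤ (v t / u t).re := fun t ht => by
    have h1 := (Complex.abs_re_le_norm _).trans (hq t ht)
    rw [Complex.sub_re, Complex.one_re, abs_le] at h1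
    linarith
  have hslit : ∀ t ∈ Icc a b, v t / u t ∈ Complex.slitPlane := fun t ht =>
    Or.inl (by linarith [hre t ht])
  have hv0 : ∀ t ∈ Icc a b, v t ≠ 0 := fun t ht h => by
    have := hre t ht; rw [h] at this; norm_num at this
  have hvc : Continuous v := continuous_iff_continuousAt.mpr fun t => (hv t).continuousAt
  have hqc : ContinuousOn (fun t => v t / u t) (Icc a b) := hvc.continuousOn.div hu hu0
  -- A continuous logarithm of v built from the given phase of u: the quotient v/u stays near 1, so
  -- its principal logarithm is continuous and changes the phase only by arg(v/u).
  set ℓ : ℝ → ℂ := fun t => Real.log ‖u t‖ + φ t * Complex.I + Complex.log (v t / u t) with hℓ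
  have hℓc : ContinuousOn ℓ (Icc a b) := by
    refine ContinuousOn.add (ContinuousOn.add ?_ ?_) (hqc.clog hslit)
    · exact Complex.continuous_ofReal.comp_continuousOn
        (hu.norm.log fun t ht => norm_ne_zero_iff.mpr (hu0 t ht))
    · exact (Complex.continuous_ofReal.comp_continuousOn hφ).mul continuousOn_const
  have hexp : ∀ t ∈ Icc a b, Complex.exp (ℓ t) = v t := fun t ht => by
    have h1 : (0 : ℝ) < ‖u t‖ := norm_pos_iff.mpr (hu0 t ht)
    rw [hℓ]
    simp only
    rw [Complex.exp_add, Complex.exp_add, ← Complex.ofReal_exp, Real.exp_log h1, ← hphase t ht,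
      Complex.exp_log (div_ne_zero (hv0 t ht) (hu0 t ht)), mul_div_cancel₀ _ (hu0 t ht)]
  have hder : ∀ t ∈ Ioo a b, HasDerivAt ℓ (v' t / v t) t := fun t ht =>
    hasDerivAt_of_exp_eq ((hℓc t (Ioo_subset_Icc_self ht)).continuousAt (Icc_mem_nhds ht.1 ht.2))
      (hv t) (Filter.eventually_of_mem (Icc_mem_nhds ht.1 ht.2) hexp)
  have hint : IntervalIntegrable (fun t => v' t / v t) volume a b := by
    refine ContinuousOn.intervalIntegrable ?_
    rw [uIcc_of_le hab]
    exact hv'.continuousOn.div hvc.continuousOn hv0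
  have h1 := intervalIntegral.integral_eq_sub_of_hasDerivAt_of_le hab hℓc hder hint
  have h2 : (∫ t in a..b, (v' t / v t).im) = (ℓ b - ℓ a).im := by
    rw [← h1]
    exact (Complex.imCLM.intervalIntegral_comp_comm hint)
  have harg : ∀ t ∈ Icc a b, |(v t / u t).arg| ≤ 4 * Real.pi * κ := fun t ht => by
    have hr := hre t ht
    have hn : 1 / 2 ≤ ‖v t / u t‖ := hr.trans (Complex.re_le_norm _)
    have him : |(v t / u t).im| ≤ 2 * κ := by
      have := (Complex.abs_im_le_norm _).trans (hq t ht)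
      simpa using this
    have h3 : |(v t / u t).im / ‖v t / u t‖| ≤ 4 * κ := by
      rw [abs_div, abs_norm, div_le_iff₀ (by linarith)]
      nlinarith [abs_nonneg (v t / u t).im]
    have h4 := Complex.abs_arg_le_pi_div_two_iff.mpr (show 0 ≤ (v t / u t).re by linarith)
    have h5 := Real.mul_abs_le_abs_sin h4
    rw [Complex.sin_arg] at h5
    have hpi := Real.pi_pos
    have h6 : 2 / Real.pi * |(v t / u t).arg| * Real.pi = 2 * |(v t / u t).arg| := by
      field_simp
    nlinarith [abs_nonneg (v t / u t).im]
  have ha := harg a ⟨le_rfl, hab⟩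
  have hb := harg b ⟨hab, le_rfl⟩
  have h7 : ∀ t, (ℓ t).im = φ t + (v t / u t).arg := fun t => by
    rw [hℓ]; simp [Complex.log_im]
  rw [h2, Complex.sub_im, h7, h7, abs_le]
  rw [abs_le] at ha hb
  constructor <;> linarith [ha.1, ha.2, hb.1, hb.2]

/-! ### Mollification -/

open ContinuousLinearMap in
-- Jensen's inequality for the probability density `η.normed volume`, read off from the
-- nonnegativity of the variance of ‖P(x − ·)‖.
theorem norm_sq_convolution_le (η : ContDiffBump (0 : ℂ)) {P : ℂ → ℂ} (hP : MemLp P 2 volume)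
    (x : ℂ) :
    ‖(convolution (η.normed volume) P (lsmul ℝ ℝ) volume) x‖ ^ 2 ≤
      (convolution (η.normed volume) (fun y => ‖P y‖ ^ 2) (lsmul ℝ ℝ) volume) x := by
  have hloc : LocallyIntegrable P volume := hP.locallyIntegrable (by norm_num)
  have hsq : LocallyIntegrable (fun y => ‖P y‖ ^ 2) volume :=
    (hP.integrable_norm_pow (by norm_num)).locallyIntegrable
  have i1 : Integrable (fun t => η.normed volume t • P (x - t)) volume :=
    η.hasCompactSupport_normed.convolutionExists_left (lsmul ℝ ℝ) η.continuous_normed hloc x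
  have i2 : Integrable (fun t => η.normed volume t • ‖P (x - t)‖ ^ 2) volume :=
    η.hasCompactSupport_normed.convolutionExists_left (lsmul ℝ ℝ) η.continuous_normed hsq x
  have i3 : Integrable (fun t => η.normed volume t * ‖P (x - t)‖) volume := by
    refine i1.norm.congr (Filter.Eventually.of_forall fun t => ?_)
    simp only [norm_smul, Real.norm_of_nonneg (η.nonneg_normed t)]
  have i4 : Integrable (fun t => η.normed volume t) volume := η.integrable_normed
  have e4 : ∫ t, η.normed volume t = 1 := η.integral_normed
  set N := ∫ t, η.normed volume t * ‖P (x - t)‖ with hN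
  have hle : ‖(convolution (η.normed volume) P (lsmul ℝ ℝ) volume) x‖ ≤ N := by
    rw [convolution_def]
    refine (norm_integral_le_integral_norm _).trans (le_of_eq ?_)
    refine integral_congr_ae (Filter.Eventually.of_forall fun t => ?_)
    simp only [lsmul_apply, norm_smul, Real.norm_of_nonneg (η.nonneg_normed t)]
  have hnn : 0 ≤ ∫ t, η.normed volume t * (‖P (x - t)‖ - N) ^ 2 :=
    integral_nonneg fun t => mul_nonneg (η.nonneg_normed t) (sq_nonneg _)
  have hexp : ∫ t, η.normed volume t * (‖P (x - t)‖ - N) ^ 2 =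
      (∫ t, η.normed volume t • ‖P (x - t)‖ ^ 2) - N ^ 2 := by
    have : ∀ t, η.normed volume t * (‖P (x - t)‖ - N) ^ 2 =
        η.normed volume t • ‖P (x - t)‖ ^ 2 - (2 * N) * (η.normed volume t * ‖P (x - t)‖)
          + N ^ 2 * η.normed volume t := fun t => by rw [smul_eq_mul]; ring
    simp_rw [this]
    have j := integral_add (i2.sub (i3.const_mul (2 * N))) (i4.const_mul (N ^ 2))
    simp only [Pi.sub_apply] at j
    rw [j, integral_sub i2 (i3.const_mul _), integral_const_mul, integral_const_mul, e4, ← hN]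
    ring
  have := pow_le_pow_left₀ (norm_nonneg _) hle 2
  have h2 : (convolution (η.normed volume) (fun y => ‖P y‖ ^ 2) (lsmul ℝ ℝ) volume) x =
      ∫ t, η.normed volume t • ‖P (x - t)‖ ^ 2 := rfl
  linarith

open ContinuousLinearMap in
theorem integral_norm_sq_convolution_le (η : ContDiffBump (0 : ℂ)) {P : ℂ → ℂ}
    (hP : MemLp P 2 volume) :
    Integrable (fun x => ‖(convolution (η.normed volume) P (lsmul ℝ ℝ) volume) x‖ ^ 2) volume ∧
    ∫ x, ‖(convolution (η.normed volume) P (lsmul ℝ ℝ) volume) x‖ ^ 2 ≤ ∫ x, ‖P x‖ ^ 2 := by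
  have hint : Integrable (fun y => ‖P y‖ ^ 2) volume := hP.integrable_norm_pow (by norm_num)
  have hconv : Integrable (convolution (η.normed volume) (fun y => ‖P y‖ ^ 2) (lsmul ℝ ℝ) volume)
      volume := η.integrable_normed.integrable_convolution _ hint
  have hcont : Continuous (convolution (η.normed volume) P (lsmul ℝ ℝ) volume) :=
    η.hasCompactSupport_normed.continuous_convolution_left _ η.continuous_normed
      (hP.locallyIntegrable (by norm_num))
  have hi : Integrable (fun x => ‖(convolution (η.normed volume) P (lsmul ℝ ℝ) volume) x‖ ^ 2)
      volume := by
    refine hconv.mono' (by fun_prop) (Filter.Eventually.of_forall fun x => ?_)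
    rw [Real.norm_of_nonneg (by positivity)]
    exact norm_sq_convolution_le η hP x
  refine ⟨hi, (integral_mono hi hconv (norm_sq_convolution_le η hP)).trans (le_of_eq ?_)⟩
  rw [integral_convolution _ η.integrable_normed hint, η.integral_normed]
  simp

open ContinuousLinearMap in
/-- The derivative of the mollification of a weakly differentiable function. -/
theorem fderiv_convolution_indicator_eq {Ω S : Set ℂ} {u p : ℂ → ℂ} {e : ℂ}
    (hΩ : IsOpen Ω) (hS : IsOpen S)
    (hSΩ : S ⊆ Ω) (hu : MemLp (S.indicator u) 2 volume)
    (hweak : ∀ φ : ℂ → ℝ, ContDiff ℝ ∞ φ → HasCompactSupport φ → tsupport φ ⊆ Ω →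
      ∫ x in Ω, (fderiv ℝ φ x e) • u x = -∫ x in Ω, φ x • p x)
    (η : ContDiffBump (0 : ℂ)) {x : ℂ} (hx : closedBall x η.rOut ⊆ S) :
    fderiv ℝ (convolution (η.normed volume) (S.indicator u) (lsmul ℝ ℝ) volume) x e =
      (convolution (η.normed volume) (S.indicator p) (lsmul ℝ ℝ) volume) x := by
  have hloc : LocallyIntegrable (S.indicator u) volume := hu.locallyIntegrable (by norm_num)
  have hd := η.hasCompactSupport_normed (μ := volume).hasFDerivAt_convolution_left (lsmul ℝ ℝ)
    (η.contDiff_normed (n := 1)) hloc x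
  rw [hd.fderiv]
  -- The reflected bump centred at x is an admissible test function; its derivative has the opposite
  -- sign to that of the bump, which cancels the sign in the weak formulation.
  set φ : ℂ → ℝ := fun t => η.normed volume (x - t) with hφ
  have hφs : ContDiff ℝ ∞ φ := by
    have : ContDiff ℝ ∞ (η.normed (volume : Measure ℂ)) := η.contDiff_normed
    exact this.comp (contDiff_const.sub contDiff_id)
  have hφt : tsupport φ ⊆ closedBall x η.rOut := by
    refine closure_minimal (fun t ht => ?_) isClosed_closedBall
    have : x - t ∈ Function.support (η.normed (volume : Measure ℂ)) := ht
    rw [η.support_normed_eq] at this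
    rw [mem_closedBall, dist_comm, dist_eq_norm]
    exact (mem_ball_zero_iff.mp this).le
  have hφc : HasCompactSupport φ :=
    (isCompact_closedBall x η.rOut).of_isClosed_subset (isClosed_tsupport _) hφt
  have hφd : ∀ t, fderiv ℝ φ t e = -fderiv ℝ (η.normed (volume : Measure ℂ)) (x - t) e := fun t => by
    have h1 : HasFDerivAt (η.normed (volume : Measure ℂ))
        (fderiv ℝ (η.normed (volume : Measure ℂ)) (x - t)) (x - t) :=
      ((η.contDiff_normed (n := 1)).differentiable one_ne_zero _).hasFDerivAt
    have h2 : HasFDerivAt (fun t : ℂ => x - t) (-ContinuousLinearMap.id ℝ ℂ) t :=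
      (hasFDerivAt_id t).const_sub x
    have h3 : HasFDerivAt φ _ t := h1.comp t h2
    rw [h3.fderiv]
    simp
  have hw := hweak φ hφs hφc (hφt.trans (hx.trans hSΩ))
  have hz : ∀ t ∉ S, φ t = 0 ∧ fderiv ℝ φ t e = 0 := fun t ht => by
    have hts : t ∉ tsupport φ := fun h => ht (hx (hφt h))
    refine ⟨image_eq_zero_of_notMem_tsupport hts, ?_⟩
    have : t ∉ Function.support (fderiv ℝ φ) := fun h => hts (support_fderiv_subset ℝ h)
    rw [Function.notMem_support.mp this]
    rfl
  have r : ∀ f : ℂ → ℝ, (∀ t ∉ S, f t = 0) → ∀ h : ℂ → ℂ,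
      ∫ t in Ω, f t • h t = ∫ t, f t • S.indicator h t := fun f hf h => by
    rw [setIntegral_eq_of_subset_of_forall_sdiff_eq_zero hΩ.measurableSet hSΩ
      (fun t ht => by simp [hf t ht.2]), ← integral_indicator hS.measurableSet]
    refine integral_congr_ae (Filter.Eventually.of_forall fun t => ?_)
    by_cases ht : t ∈ S <;> simp [ht]
  rw [r _ (fun t ht => (hz t ht).2) u, r _ (fun t ht => (hz t ht).1) p] at hw
  have hci : ConvolutionExistsAt (fderiv ℝ (η.normed (volume : Measure ℂ))) (S.indicator u) x
      ((lsmul ℝ ℝ).precompL ℂ) volume :=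
    (η.hasCompactSupport_normed.fderiv ℝ).convolutionExists_left _
      ((η.contDiff_normed (n := 1)).continuous_fderiv one_ne_zero) hloc x
  rw [convolution_eq_swap, integral_apply hci.integrable_swap, convolution_eq_swap]
  simp only [lsmul_apply, precompL_apply]
  rw [← neg_inj, ← hw, ← integral_neg]
  refine integral_congr_ae (Filter.Eventually.of_forall fun t => ?_)
  simp [hφd]

open ContinuousLinearMap in
-- Mollification of u restricted to S, at a scale below the distance from K to the complement of S
-- and below the modulus of continuity of u. Convolution does not increase L² norms, so the energy
-- bound holds with no error term and no convergence of gradients is needed.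
theorem GLTangential.IsH1.exists_smooth_approx {Ω S K : Set ℂ} {u p q : ℂ → ℂ}
    (hu : GLTangential.IsH1 Ω u p q) (hΩ : IsOpen Ω) (hS : IsOpen S) (hSΩ : S ⊆ Ω)
    (hK : IsCompact K) (hKS : K ⊆ S) (huc : ContinuousOn u S) {κ : ℝ} (hκ : 0 < κ) :
    ∃ v : ℂ → ℂ, ContDiff ℝ 1 v ∧ (∀ x ∈ K, ‖v x - u x‖ ≤ κ) ∧
      ∫ x in K, (‖fderiv ℝ v x 1‖ ^ 2 + ‖fderiv ℝ v x Complex.I‖ ^ 2) ≤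
        ∫ x in S, GLTangential.gradSq p q x := by
  obtain ⟨δ₁, hδ₁, hthick⟩ := hK.exists_cthickening_subset_open hS hKS
  have hK1 : IsCompact (cthickening δ₁ K) := hK.cthickening
  obtain ⟨δ₂, hδ₂, hunif⟩ := Metric.uniformContinuousOn_iff.mp
    (hK1.uniformContinuousOn_of_continuous (huc.mono hthick)) κ hκ
  have hδ : 0 < min δ₁ δ₂ := lt_min hδ₁ hδ₂
  let η : ContDiffBump (0 : ℂ) := ⟨min δ₁ δ₂ / 2, min δ₁ δ₂, by linarith, by linarith⟩
  have hmem : ∀ f : ℂ → ℂ, MemLp f 2 (volume.restrict Ω) → MemLp (S.indicator f) 2 volume :=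
    fun f hf => (memLp_indicator_iff_restrict hS.measurableSet).mpr
      (hf.mono_measure (Measure.restrict_mono hSΩ le_rfl))
  have hball : ∀ x ∈ K, closedBall x η.rOut ⊆ cthickening δ₁ K := fun x hx =>
    (closedBall_subset_closedBall (min_le_left _ _)).trans (closedBall_subset_cthickening hx _)
  have hum := hmem u hu.memLp
  refine ⟨convolution (η.normed volume) (S.indicator u) (lsmul ℝ ℝ) volume, ?_, ?_, ?_⟩
  · exact η.hasCompactSupport_normed.contDiff_convolution_left _ η.contDiff_normed
      (hum.locallyIntegrable (by norm_num))
  · intro x hx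
    have hxS := hKS hx
    have h1 := η.dist_normed_convolution_le (x₀ := x) (ε := κ) (g := S.indicator u)
      hum.aestronglyMeasurable (fun y hy => by
        have hy1 : y ∈ cthickening δ₁ K := hball x hx (ball_subset_closedBall hy)
        rw [indicator_of_mem (hthick hy1), indicator_of_mem hxS]
        exact (hunif y hy1 x (hball x hx (mem_closedBall_self η.rOut_pos.le))
          ((mem_ball.mp hy).trans_le (min_le_right _ _))).le)
    rwa [indicator_of_mem hxS, dist_eq_norm] at h1
  · have hp := integral_norm_sq_convolution_le η (hmem p hu.memLp_fst)
    have hq := integral_norm_sq_convolution_le η (hmem q hu.memLp_snd)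
    have hind : ∀ f : ℂ → ℂ, MemLp f 2 (volume.restrict Ω) →
        ∫ x, ‖S.indicator f x‖ ^ 2 = ∫ x in S, ‖f x‖ ^ 2 := fun f _ => by
      rw [← integral_indicator hS.measurableSet]
      refine integral_congr_ae (Filter.Eventually.of_forall fun t => ?_)
      by_cases ht : t ∈ S <;> simp [ht]
    have hsq : ∀ f : ℂ → ℂ, MemLp f 2 (volume.restrict Ω) →
        Integrable (fun x => ‖f x‖ ^ 2) (volume.restrict S) := fun f hf =>
      (hf.mono_measure (Measure.restrict_mono hSΩ le_rfl)).integrable_norm_pow (by norm_num)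
    rw [setIntegral_congr_fun hK.measurableSet (g := fun x =>
      ‖(convolution (η.normed volume) (S.indicator p) (lsmul ℝ ℝ) volume) x‖ ^ 2 +
      ‖(convolution (η.normed volume) (S.indicator q) (lsmul ℝ ℝ) volume) x‖ ^ 2) (fun x hx => by
        have h1 := fderiv_convolution_indicator_eq hΩ hS hSΩ hum hu.weak_fst η
          ((hball x hx).trans hthick)
        have h2 := fderiv_convolution_indicator_eq hΩ hS hSΩ hum hu.weak_snd η
          ((hball x hx).trans hthick)
        simp only [h1, h2])]
    calc _ ≤ ∫ x, (‖(convolution (η.normed volume) (S.indicator p) (lsmul ℝ ℝ) volume) x‖ ^ 2 +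
          ‖(convolution (η.normed volume) (S.indicator q) (lsmul ℝ ℝ) volume) x‖ ^ 2) :=
        setIntegral_le_integral (hp.1.add hq.1)
          (Filter.Eventually.of_forall fun x => by simp only [Pi.zero_apply]; positivity)
      _ ≤ _ := by
        rw [integral_add hp.1 hq.1]
        unfold GLTangential.gradSq
        rw [integral_add (hsq p hu.memLp_fst) (hsq q hu.memLp_snd),
          ← hind p hu.memLp_fst, ← hind q hu.memLp_snd]
        exact add_le_add hp.2 hq.2

/-! ### Polar coordinates -/

/-- Polar coordinates about `x₀`, with angles measured from the direction `e^{iβ}`. -/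
noncomputable def polarPoint (x₀ : ℂ) (β : ℝ) (p : ℝ × ℝ) : ℂ := circleMap x₀ p.1 (p.2 + β)

theorem polarPoint_sub (x₀ : ℂ) (β : ℝ) (p : ℝ × ℝ) :
    polarPoint x₀ β p - x₀ = circleMap 0 p.1 (p.2 + β) := by simp [polarPoint, circleMap]

theorem norm_polarPoint_sub (x₀ : ℂ) (β : ℝ) {p : ℝ × ℝ} (hp : 0 ≤ p.1) :
    ‖polarPoint x₀ β p - x₀‖ = p.1 := by
  rw [polarPoint_sub, norm_circleMap_zero, abs_of_nonneg hp]

theorem continuous_polarPoint (x₀ : ℂ) (β : ℝ) : Continuous (polarPoint x₀ β) := by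
  unfold polarPoint circleMap
  fun_prop

/-- The closed sector `r ≤ ρ ≤ R`, `a ρ ≤ θ ≤ b ρ` in polar coordinates. -/
def polarRegion (r R : ℝ) (a b : ℝ → ℝ) : Set (ℝ × ℝ) :=
  {p | p.1 ∈ Icc r R ∧ p.2 ∈ Icc (a p.1) (b p.1)}

theorem isCompact_polarRegion {r R : ℝ} {a b : ℝ → ℝ} (ha : Continuous a) (hb : Continuous b) :
    IsCompact (polarRegion r R a b) := by
  obtain ⟨A, hA⟩ := (isCompact_Icc.image_of_continuousOn
    (ha.continuousOn (s := Icc r R))).bddBelow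
  obtain ⟨B, hB⟩ := (isCompact_Icc.image_of_continuousOn
    (hb.continuousOn (s := Icc r R))).bddAbove
  refine (isCompact_Icc (a := ((r, A) : ℝ × ℝ)) (b := (R, B))).of_isClosed_subset ?_ ?_
  · exact ((isClosed_le continuous_const continuous_fst).inter
      (isClosed_le continuous_fst continuous_const)).inter
      ((isClosed_le (ha.comp continuous_fst) continuous_snd).inter
      (isClosed_le continuous_snd (hb.comp continuous_fst)))
  · rintro p ⟨h1, h2⟩
    exact ⟨⟨h1.1, (hA (mem_image_of_mem a h1)).trans h2.1⟩,
      ⟨h1.2, h2.2.trans (hB (mem_image_of_mem b h1))⟩⟩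

/-- Ordinary polar coordinates followed by the measure-preserving map z ↦ x₀ + e^{iβ}z. The
reference angle β can be chosen to keep the branch cut off the sector. -/
theorem setIntegral_image_polarPoint (x₀ : ℂ) (β : ℝ) {D : Set (ℝ × ℝ)} (hD : MeasurableSet D)
    (hsub : D ⊆ Ioi 0 ×ˢ Ioo (-Real.pi) Real.pi) (F : ℂ → ℝ) :
    ∫ x in polarPoint x₀ β '' D, F x = ∫ p in D, p.1 * F (polarPoint x₀ β p) := by
  set ψ : ℂ → ℂ := fun z => x₀ + rotation (Circle.exp β) z with hψ
  have hmp : MeasurePreserving ψ volume volume :=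
    (measurePreserving_add_left volume x₀).comp (rotation (Circle.exp β)).measurePreserving
  have hemb : MeasurableEmbedding ψ :=
    (measurableEmbedding_addLeft x₀).comp
      (rotation (Circle.exp β)).toHomeomorph.measurableEmbedding
  have hP : ∀ p, polarPoint x₀ β p = ψ (Complex.polarCoord.symm p) := fun p => by
    simp only [polarPoint, circleMap, hψ, Complex.polarCoord_symm_apply, rotation_apply,
      Circle.coe_exp]
    have : (Real.cos p.2 : ℂ) + Real.sin p.2 * Complex.I = Complex.exp (p.2 * Complex.I) := by
      rw [Complex.exp_mul_I]; push_cast; rfl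
    rw [this]
    push_cast
    rw [add_mul, Complex.exp_add]
    ring
  have himg : polarPoint x₀ β '' D = ψ '' (Complex.polarCoord.symm '' D) := by
    rw [image_image]; exact image_congr fun p _ => hP p
  have hmeas : MeasurableSet (Complex.polarCoord.symm '' D) := by
    have : Complex.polarCoord.symm '' D = Complex.slitPlane ∩ (fun z => (‖z‖, z.arg)) ⁻¹' D := by
      have h := Complex.polarCoord.symm_image_eq_source_inter_preimage (s := D) hsub
      rw [h, Complex.polarCoord_source]
      congr 1
      ext z; simp [Complex.polarCoord_apply]
    rw [this]
    exact Complex.isOpen_slitPlane.measurableSet.inter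
      ((measurable_norm.prodMk Complex.measurable_arg) hD)
  rw [himg, hmp.setIntegral_image_emb hemb, ← integral_indicator hmeas,
    ← Complex.integral_comp_polarCoord_symm,
    setIntegral_eq_of_subset_of_forall_sdiff_eq_zero
      polarCoord.open_target.measurableSet hsub ?_]
  · refine setIntegral_congr_fun hD fun p hp => ?_
    rw [indicator_of_mem (mem_image_of_mem _ hp), hP, smul_eq_mul]
  · rintro p ⟨hp, hpD⟩
    rw [indicator_of_notMem, smul_zero]
    rintro ⟨p', hp', h⟩
    exact hpD (Complex.polarCoord.symm.injOn (hsub hp') hp h ▸ hp')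

theorem setIntegral_polarRegion {r R : ℝ} {a b : ℝ → ℝ} (hrR : r ≤ R) (ha : Continuous a)
    (hb : Continuous b) (hab : ∀ ρ ∈ Icc r R, a ρ ≤ b ρ) {G : ℝ × ℝ → ℝ}
    (hG : IntegrableOn G (polarRegion r R a b)) :
    IntervalIntegrable (fun ρ => ∫ θ in a ρ..b ρ, G (ρ, θ)) volume r R ∧
    ∫ p in polarRegion r R a b, G p = ∫ ρ in r..R, ∫ θ in a ρ..b ρ, G (ρ, θ) := by
  have hm : MeasurableSet (polarRegion r R a b) :=
    (isCompact_polarRegion ha hb).isClosed.measurableSet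
  have hi : Integrable ((polarRegion r R a b).indicator G) (volume.prod volume) := by
    rw [← Measure.volume_eq_prod]; exact hG.integrable_indicator hm
  -- The single radius r is split off from [r, R]; being null, it is dropped below, leaving the
  -- half-open interval used by interval integrals.
  have hinner : ∀ ρ, ∫ θ, (polarRegion r R a b).indicator G (ρ, θ) =
      (Ioc r R).indicator (fun ρ => ∫ θ in a ρ..b ρ, G (ρ, θ)) ρ +
      ({r} : Set ℝ).indicator (fun ρ => ∫ θ in a ρ..b ρ, G (ρ, θ)) ρ := fun ρ => by
    have e : (Ioc r R).indicator (fun ρ => ∫ θ in a ρ..b ρ, G (ρ, θ)) ρ +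
      ({r} : Set ℝ).indicator (fun ρ => ∫ θ in a ρ..b ρ, G (ρ, θ)) ρ =
      (Icc r R).indicator (fun ρ => ∫ θ in a ρ..b ρ, G (ρ, θ)) ρ := by
      by_cases h1 : ρ = r
      · subst h1; simp [hrR]
      · by_cases h2 : ρ ∈ Ioc r R
        · simp [h2, h1, Ioc_subset_Icc_self h2]
        · have : ρ ∉ Icc r R := fun h => h2 ⟨lt_of_le_of_ne h.1 (Ne.symm h1), h.2⟩
          simp [h2, h1, this]
    rw [e]
    by_cases h : ρ ∈ Icc r R
    · rw [indicator_of_mem h, intervalIntegral.integral_of_le (hab ρ h),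
        ← integral_Icc_eq_integral_Ioc, ← integral_indicator measurableSet_Icc]
      congr 1; ext θ
      by_cases hθ : θ ∈ Icc (a ρ) (b ρ)
      · rw [indicator_of_mem hθ, indicator_of_mem (show (ρ, θ) ∈ polarRegion r R a b from ⟨h, hθ⟩)]
      · rw [indicator_of_notMem hθ, indicator_of_notMem (fun h' => hθ h'.2)]
    · rw [indicator_of_notMem h]
      refine integral_eq_zero_of_ae (Filter.Eventually.of_forall fun θ => ?_)
      exact indicator_of_notMem (fun h' => h h'.1) _
  have hae : (fun ρ => ∫ θ, (polarRegion r R a b).indicator G (ρ, θ)) =ᵐ[volume]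
      (Ioc r R).indicator (fun ρ => ∫ θ in a ρ..b ρ, G (ρ, θ)) := by
    have : ∀ᵐ ρ : ℝ, ρ ≠ r := by simp [ae_iff]
    filter_upwards [this] with ρ hρ
    rw [hinner, indicator_of_notMem (show ρ ∉ ({r} : Set ℝ) from hρ), add_zero]
  constructor
  · rw [intervalIntegrable_iff_integrableOn_Ioc_of_le hrR,
      ← integrable_indicator_iff measurableSet_Ioc]
    exact hi.integral_prod_left.congr hae
  · rw [← integral_indicator hm, Measure.volume_eq_prod, integral_prod _ hi, integral_congr_ae hae,
      integral_indicator measurableSet_Ioc, intervalIntegral.integral_of_le hrR]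

/-! ### Lower bounds on sectors -/

/-- Cauchy–Schwarz in the two coordinates. For w = i(x − x₀) it bounds the squared angular
derivative by ρ²|∇v|². -/
theorem norm_sq_apply_le (A : ℂ →L[ℝ] ℂ) (w : ℂ) :
    ‖A w‖ ^ 2 ≤ ‖w‖ ^ 2 * (‖A 1‖ ^ 2 + ‖A Complex.I‖ ^ 2) := by
  have h : A w = w.re • A 1 + w.im • A Complex.I := by
    rw [← map_smul, ← map_smul, ← map_add]
    congr 1
    simp only [Complex.real_smul, mul_one]
    exact (Complex.re_add_im w).symm
  have h1 : ‖A w‖ ≤ |w.re| * ‖A 1‖ + |w.im| * ‖A Complex.I‖ := by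
    rw [h]
    refine (norm_add_le _ _).trans (le_of_eq ?_)
    rw [norm_smul, norm_smul, Real.norm_eq_abs, Real.norm_eq_abs]
  have h2 := pow_le_pow_left₀ (norm_nonneg _) h1 2
  have h3 : ‖w‖ ^ 2 = |w.re| ^ 2 + |w.im| ^ 2 := by
    rw [sq_abs, sq_abs, Complex.sq_norm, Complex.normSq_apply]; ring
  rw [h3]
  nlinarith [sq_nonneg (|w.re| * ‖A Complex.I‖ - |w.im| * ‖A 1‖)]

/-- With z = w/v, the difference of the two sides is (Im z·|v| − l/|v|)² + (Re z·|v|)². Keeping l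
free makes the bound linear in the angular speed Im z, whose integral along an arc is a phase
increment. -/
theorem two_mul_im_div_sub_le (l : ℝ) {v w : ℂ} (hv : v ≠ 0) :
    2 * l * (w / v).im - l ^ 2 / ‖v‖ ^ 2 ≤ ‖w‖ ^ 2 := by
  set z := w / v with hz
  have hw : w = z * v := by rw [hz, div_mul_cancel₀ _ hv]
  have hn : 0 < ‖v‖ := norm_pos_iff.mpr hv
  have h1 : ‖w‖ ^ 2 = (z.re ^ 2 + z.im ^ 2) * ‖v‖ ^ 2 := by
    rw [hw, norm_mul, mul_pow, Complex.sq_norm z, Complex.normSq_apply]; ring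
  rw [h1, sub_le_iff_le_add]
  have h2 : 0 ≤ (z.im * ‖v‖ - l / ‖v‖) ^ 2 + (z.re * ‖v‖) ^ 2 := by positivity
  have h3 : z.im * ‖v‖ * (l / ‖v‖) = l * z.im := by field_simp
  have h4 : (l / ‖v‖) ^ 2 = l ^ 2 / ‖v‖ ^ 2 := div_pow _ _ _
  nlinarith

theorem inv_sq_le_of_close {x y κ : ℝ} (hx : 1 / 2 ≤ x) (hx1 : x ≤ 1) (hκ : κ ≤ 1 / 8)
    (hxy : |y - x| ≤ κ) : 1 / y ^ 2 ≤ 1 + 4 * (1 - x ^ 2) + 48 * κ := by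
  have h0 : 0 ≤ κ := (abs_nonneg _).trans hxy
  rw [abs_le] at hxy
  have hy : x - κ ≤ y := by linarith
  have hy4 : 1 / 4 < y := by linarith
  have h1 : 1 / x ^ 2 ≤ 1 + 4 * (1 - x ^ 2) := by
    rw [div_le_iff₀ (by positivity)]
    nlinarith [mul_nonneg (sub_nonneg.mpr hx1) (sub_nonneg.mpr hx)]
  have h2 : 1 / y ^ 2 - 1 / x ^ 2 ≤ 48 * κ := by
    have hxp : 0 < x := by linarith
    have hyp : 0 < y := by linarith
    have e : 1 / y ^ 2 - 1 / x ^ 2 = (x - y) * (1 / x * (1 / y) ^ 2 + (1 / x) ^ 2 * (1 / y)) := by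
      field_simp; ring
    have hix : 1 / x ≤ 2 := by rw [div_le_iff₀ hxp]; linarith
    have hiy : 1 / y ≤ 4 := by rw [div_le_iff₀ hyp]; linarith
    have hix0 : 0 < 1 / x := by positivity
    have hiy0 : 0 < 1 / y := by positivity
    -- From 1/x ≤ 2 and 1/y ≤ 4: 2·4² + 2²·4 = 48.
    have hb : 1 / x * (1 / y) ^ 2 + (1 / x) ^ 2 * (1 / y) ≤ 48 := by
      have : 1 / x * (1 / y) ^ 2 ≤ 2 * 4 ^ 2 := by gcongr
      have : (1 / x) ^ 2 * (1 / y) ≤ 2 ^ 2 * 4 := by gcongr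
      linarith
    rw [e]
    have hb0 : 0 ≤ 1 / x * (1 / y) ^ 2 + (1 / x) ^ 2 * (1 / y) := by positivity
    calc _ ≤ κ * (1 / x * (1 / y) ^ 2 + (1 / x) ^ 2 * (1 / y)) :=
          mul_le_mul_of_nonneg_right (by linarith) hb0
      _ ≤ κ * 48 := mul_le_mul_of_nonneg_left hb h0
      _ = _ := by ring
  linarith

/-- The square completion is applied to a smooth κ-approximation v of u on the compact sector and
integrated in polar coordinates. The angle swept by v differs from the phase increment of u by O(κ),
and κ tends to 0 at the end. -/
theorem GLTangential.IsH1.compact_sector_lower_bound {Ω S : Set ℂ} {u p q : ℂ → ℂ}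
    (hu : GLTangential.IsH1 Ω u p q) (hΩ : IsOpen Ω) (hS : IsOpen S) (hSΩ : S ⊆ Ω)
    (huc : ContinuousOn u S) (hbound : ∀ x ∈ S, 1 / 2 ≤ ‖u x‖ ∧ ‖u x‖ ≤ 1)
    {x₀ : ℂ} {β r R : ℝ} {a b : ℝ → ℝ} (hr : 0 < r) (hrR : r ≤ R) (ha : Continuous a)
    (hb : Continuous b)
    (hab : ∀ ρ ∈ Icc r R, -Real.pi < a ρ ∧ a ρ ≤ b ρ ∧ b ρ < Real.pi)
    (hDS : ∀ p ∈ polarRegion r R a b, polarPoint x₀ β p ∈ S)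
    {φ : ℝ × ℝ → ℝ} (hφ : Continuous φ)
    (hphase : ∀ p ∈ polarRegion r R a b, u (polarPoint x₀ β p) =
      ‖u (polarPoint x₀ β p)‖ * Complex.exp (φ p * Complex.I))
    (hpot : IntegrableOn (fun x => (1 - ‖u x‖ ^ 2) / ‖x - x₀‖ ^ 2) S) (l : ℝ) :
    (∫ ρ in r..R, ρ⁻¹ * (2 * l * (φ (ρ, b ρ) - φ (ρ, a ρ)) - l ^ 2 * (b ρ - a ρ))) -
      4 * l ^ 2 * (∫ x in S, (1 - ‖u x‖ ^ 2) / ‖x - x₀‖ ^ 2) ≤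
      ∫ x in S, GLTangential.gradSq p q x := by
  set D := polarRegion r R a b with hD
  have hDc : IsCompact D := isCompact_polarRegion ha hb
  set K := polarPoint x₀ β '' D with hKdef
  have hK : IsCompact K := hDc.image (continuous_polarPoint x₀ β)
  have hKS : K ⊆ S := by rintro _ ⟨p, hp, rfl⟩; exact hDS p hp
  have hD0 : ∀ p ∈ D, 0 < p.1 := fun p hp => hr.trans_le hp.1.1
  have hsub : D ⊆ Ioi 0 ×ˢ Ioo (-Real.pi) Real.pi := fun p hp =>
    ⟨hD0 p hp, (hab p.1 hp.1).1.trans_le hp.2.1, hp.2.2.trans_lt (hab p.1 hp.1).2.2⟩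
  have hKn : ∀ x ∈ K, 0 < ‖x - x₀‖ := by
    rintro _ ⟨p, hp, rfl⟩
    rw [norm_polarPoint_sub _ _ (hD0 p hp).le]; exact hD0 p hp
  have hinv : ContinuousOn (fun ρ : ℝ => ρ⁻¹) (Icc r R) :=
    continuousOn_inv₀.mono fun ρ hρ => (hr.trans_le hρ.1).ne'
  have hii : ∀ {f : ℝ → ℝ}, ContinuousOn f (Icc r R) → IntervalIntegrable f volume r R :=
    fun hf => (by rwa [uIcc_of_le hrR] : ContinuousOn _ (uIcc r R)).intervalIntegrable
  -- Collects everything linear in κ: the error 8πκ in the swept angle on each circle, and the 48κ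
  -- in the comparison of 1/|v|² with |u|.
  set M : ℝ := 2 * |l| * (8 * Real.pi) * (∫ ρ in r..R, ρ⁻¹) +
    l ^ 2 * 48 * ∫ ρ in r..R, ρ⁻¹ * (b ρ - a ρ) with hM
  suffices h : ∀ κ : ℝ, 0 < κ → κ ≤ 1 / 8 →
      (∫ ρ in r..R, ρ⁻¹ * (2 * l * (φ (ρ, b ρ) - φ (ρ, a ρ)) - l ^ 2 * (b ρ - a ρ))) -
      4 * l ^ 2 * (∫ x in S, (1 - ‖u x‖ ^ 2) / ‖x - x₀‖ ^ 2) - M * κ ≤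
      ∫ x in S, GLTangential.gradSq p q x by
    have ht : Filter.Tendsto (fun κ : ℝ =>
      (∫ ρ in r..R, ρ⁻¹ * (2 * l * (φ (ρ, b ρ) - φ (ρ, a ρ)) - l ^ 2 * (b ρ - a ρ))) -
      4 * l ^ 2 * (∫ x in S, (1 - ‖u x‖ ^ 2) / ‖x - x₀‖ ^ 2) - M * κ) (nhdsWithin 0 (Ioi 0))
      (nhds ((∫ ρ in r..R, ρ⁻¹ * (2 * l * (φ (ρ, b ρ) - φ (ρ, a ρ)) - l ^ 2 * (b ρ - a ρ))) -
      4 * l ^ 2 * (∫ x in S, (1 - ‖u x‖ ^ 2) / ‖x - x₀‖ ^ 2))) := by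
      refine Filter.Tendsto.mono_left ?_ nhdsWithin_le_nhds
      exact (by fun_prop : Continuous fun κ : ℝ =>
        (∫ ρ in r..R, ρ⁻¹ * (2 * l * (φ (ρ, b ρ) - φ (ρ, a ρ)) - l ^ 2 * (b ρ - a ρ))) -
        4 * l ^ 2 * (∫ x in S, (1 - ‖u x‖ ^ 2) / ‖x - x₀‖ ^ 2) - M * κ).tendsto' 0 _ (by simp)
    refine le_of_tendsto ht ?_
    filter_upwards [Ioc_mem_nhdsGT (show (0 : ℝ) < 1 / 8 by norm_num)] with κ hκ
    exact h κ hκ.1 hκ.2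
  intro κ hκ hκ8
  obtain ⟨v, hv, hclose, hen⟩ := hu.exists_smooth_approx hΩ hS hSΩ hK hKS huc hκ
  have hv0 : ∀ x ∈ K, v x ≠ 0 := fun x hx h => by
    have h1 := hclose x hx
    have h2 := (hbound x (hKS hx)).1
    rw [h, zero_sub, norm_neg] at h1
    linarith
  have hvd : Continuous (fderiv ℝ v) := hv.continuous_fderiv one_ne_zero
  set W : ℂ → ℂ := fun x => fderiv ℝ v x ((x - x₀) * Complex.I) with hW
  have hWc : Continuous W := hvd.clm_apply (by fun_prop)
  set J : ℂ → ℝ := fun x => (W x / v x).im with hJ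
  have hJc : ContinuousOn J K := Complex.continuous_im.comp_continuousOn
    (hWc.continuousOn.div hv.continuous.continuousOn hv0)
  have hnc : ContinuousOn (fun x : ℂ => ‖x - x₀‖ ^ 2) K := by fun_prop
  -- The pointwise lower bound for |∇v|² without the modulus defect. The defect is nonnegative and
  -- is integrated over all of S separately.
  set H : ℂ → ℝ := fun x => (2 * l * J x - l ^ 2 * (1 + 48 * κ)) / ‖x - x₀‖ ^ 2 with hH
  have hHc : ContinuousOn H K :=
    ((continuousOn_const.mul hJc).sub continuousOn_const).div hnc
      fun x hx => (pow_pos (hKn x hx) 2).ne'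
  have hHi : IntegrableOn H K := hHc.integrableOn_compact hK
  have hpotK := hpot.mono_set hKS
  have step1 : (∫ x in K, H x) - 4 * l ^ 2 * (∫ x in S, (1 - ‖u x‖ ^ 2) / ‖x - x₀‖ ^ 2) ≤
      ∫ x in S, GLTangential.gradSq p q x := by
    have h1 : (∫ x in K, (1 - ‖u x‖ ^ 2) / ‖x - x₀‖ ^ 2) ≤
        ∫ x in S, (1 - ‖u x‖ ^ 2) / ‖x - x₀‖ ^ 2 := by
      refine setIntegral_mono_set hpot ?_ (Filter.Eventually.of_forall hKS)
      refine (ae_restrict_iff' hS.measurableSet).mpr (Filter.Eventually.of_forall fun x hx => ?_)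
      have := (hbound x hx).2
      have : 0 ≤ 1 - ‖u x‖ ^ 2 := by nlinarith [norm_nonneg (u x)]
      simp only [Pi.zero_apply]
      positivity
    have h2 : (∫ x in K, (H x - 4 * l ^ 2 * ((1 - ‖u x‖ ^ 2) / ‖x - x₀‖ ^ 2))) ≤
        ∫ x in K, (‖fderiv ℝ v x 1‖ ^ 2 + ‖fderiv ℝ v x Complex.I‖ ^ 2) := by
      refine setIntegral_mono_on (hHi.sub (hpotK.const_mul _)) ?_ hK.measurableSet fun x hx => ?_
      · exact ContinuousOn.integrableOn_compact hK (by fun_prop)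
      have hn := hKn x hx
      have g1 := norm_sq_apply_le (fderiv ℝ v x) ((x - x₀) * Complex.I)
      rw [norm_mul, Complex.norm_I, mul_one] at g1
      have g2 := two_mul_im_div_sub_le l (w := W x) (hv0 x hx)
      have g3 := inv_sq_le_of_close (hbound x (hKS hx)).1 (hbound x (hKS hx)).2 hκ8
        ((abs_norm_sub_norm_le (v x) (u x)).trans (hclose x hx))
      have g4 : l ^ 2 / ‖v x‖ ^ 2 ≤ l ^ 2 * (1 + 4 * (1 - ‖u x‖ ^ 2) + 48 * κ) := by
        rw [div_eq_mul_one_div]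
        exact mul_le_mul_of_nonneg_left g3 (sq_nonneg _)
      rw [← mul_div_assoc, ← sub_div, div_le_iff₀ (by positivity)]
      simp only [hJ]
      change ‖W x‖ ^ 2 ≤ _ at g1
      linarith
    rw [integral_sub hHi (hpotK.const_mul _), integral_const_mul] at h2
    have h3 := mul_le_mul_of_nonneg_left h1 (show 0 ≤ 4 * l ^ 2 by positivity)
    linarith
  set G : ℝ × ℝ → ℝ := fun p => p.1 * H (polarPoint x₀ β p) with hG
  have hGi : IntegrableOn G D := by
    refine ContinuousOn.integrableOn_compact hDc ?_
    exact continuous_fst.continuousOn.mul (hHc.comp (continuous_polarPoint x₀ β).continuousOn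
      fun p hp => mem_image_of_mem _ hp)
  obtain ⟨hGint, hGeq⟩ := setIntegral_polarRegion hrR ha hb (fun ρ hρ => (hab ρ hρ).2.1) hGi
  have step2 : ∫ x in K, H x = ∫ ρ in r..R, ∫ θ in a ρ..b ρ, G (ρ, θ) := by
    rw [← hGeq, hKdef, setIntegral_image_polarPoint x₀ β hDc.isClosed.measurableSet hsub]
  have step3 : (∫ ρ in r..R, (ρ⁻¹ * (2 * l * (φ (ρ, b ρ) - φ (ρ, a ρ)) - l ^ 2 * (b ρ - a ρ)) -
      κ * (2 * |l| * (8 * Real.pi) * ρ⁻¹ + l ^ 2 * 48 * (ρ⁻¹ * (b ρ - a ρ))))) ≤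
      ∫ ρ in r..R, ∫ θ in a ρ..b ρ, G (ρ, θ) := by
    refine intervalIntegral.integral_mono_on hrR (hii ?_) hGint fun ρ hρ => ?_
    · refine ContinuousOn.sub (hinv.mul (Continuous.continuousOn (by fun_prop)))
        (continuousOn_const.mul ((continuousOn_const.mul hinv).add
        (continuousOn_const.mul (hinv.mul (Continuous.continuousOn (by fun_prop))))))
    have hρ0 : 0 < ρ := hr.trans_le hρ.1
    have hmem : ∀ θ ∈ Icc (a ρ) (b ρ), (ρ, θ) ∈ D := fun θ hθ => ⟨hρ, hθ⟩
    have hle := (hab ρ hρ).2.1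
    have hder : ∀ θ, HasDerivAt (fun θ => v (polarPoint x₀ β (ρ, θ)))
        (W (polarPoint x₀ β (ρ, θ))) θ := fun θ => by
      have h1 : HasDerivAt (fun θ => polarPoint x₀ β (ρ, θ))
          ((polarPoint x₀ β (ρ, θ) - x₀) * Complex.I) θ := by
        rw [polarPoint_sub]
        exact (hasDerivAt_circleMap x₀ ρ (θ + β)).comp_add_const θ β
      exact ((hv.differentiable one_ne_zero _).hasFDerivAt).comp_hasDerivAt θ h1
    have hpc : Continuous fun θ : ℝ => polarPoint x₀ β (ρ, θ) :=
      (continuous_polarPoint x₀ β).comp (by fun_prop)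
    have hsw := abs_integral_im_logDeriv_sub_le hle hder (hWc.comp hpc)
      (u := fun θ => u (polarPoint x₀ β (ρ, θ))) (φ := fun θ => φ (ρ, θ)) (κ := κ)
      (huc.comp hpc.continuousOn fun θ hθ => hDS _ (hmem θ hθ))
      (Continuous.continuousOn (by fun_prop)) (fun θ hθ => hphase _ (hmem θ hθ))
      (fun θ hθ => (hbound _ (hDS _ (hmem θ hθ))).1) hκ8
      (fun θ hθ => hclose _ (mem_image_of_mem _ (hmem θ hθ)))
    have hGθ : ∀ θ, G (ρ, θ) = ρ⁻¹ * (2 * l * (W (polarPoint x₀ β (ρ, θ)) /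
        v (polarPoint x₀ β (ρ, θ))).im - l ^ 2 * (1 + 48 * κ)) := fun θ => by
      simp only [hG, hH, hJ]
      rw [norm_polarPoint_sub x₀ β (p := (ρ, θ)) hρ0.le]
      field_simp
    have hJi : IntervalIntegrable (fun θ => (W (polarPoint x₀ β (ρ, θ)) /
        v (polarPoint x₀ β (ρ, θ))).im) volume (a ρ) (b ρ) := by
      refine ContinuousOn.intervalIntegrable ?_
      rw [uIcc_of_le hle]
      exact hJc.comp hpc.continuousOn fun θ hθ => mem_image_of_mem _ (hmem θ hθ)
    simp_rw [hGθ]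
    rw [intervalIntegral.integral_const_mul,
      intervalIntegral.integral_sub (hJi.const_mul _) intervalIntegrable_const,
      intervalIntegral.integral_const_mul, intervalIntegral.integral_const, smul_eq_mul]
    set I₀ := ∫ θ in a ρ..b ρ, (W (polarPoint x₀ β (ρ, θ)) / v (polarPoint x₀ β (ρ, θ))).im
    have h5 : 2 * l * ((φ (ρ, b ρ) - φ (ρ, a ρ)) - I₀) ≤ 2 * |l| * (8 * Real.pi * κ) := by
      refine (le_abs_self _).trans ?_
      rw [abs_mul, abs_mul, abs_two, abs_sub_comm]
      gcongr
    have h6 : 0 < ρ⁻¹ := inv_pos.mpr hρ0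
    have h7 := mul_le_mul_of_nonneg_left h5 h6.le
    linarith
  have i1 : IntervalIntegrable (fun ρ => ρ⁻¹ * (2 * l * (φ (ρ, b ρ) - φ (ρ, a ρ)) -
      l ^ 2 * (b ρ - a ρ))) volume r R :=
    hii (hinv.mul (Continuous.continuousOn (by fun_prop)))
  have i2 : IntervalIntegrable (fun ρ => 2 * |l| * (8 * Real.pi) * ρ⁻¹) volume r R :=
    hii (continuousOn_const.mul hinv)
  have i3 : IntervalIntegrable (fun ρ => l ^ 2 * 48 * (ρ⁻¹ * (b ρ - a ρ))) volume r R :=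
    hii (continuousOn_const.mul (hinv.mul (Continuous.continuousOn (by fun_prop))))
  rw [intervalIntegral.integral_sub i1 ((i2.add i3).const_mul κ),
    intervalIntegral.integral_const_mul, intervalIntegral.integral_add i2 i3,
    intervalIntegral.integral_const_mul, intervalIntegral.integral_const_mul, ← hM] at step3
  linarith

/-- The part of `Ω` at distance between `r` and `R` from `x₀`. -/
def shell (Ω : Set ℂ) (x₀ : ℂ) (r R : ℝ) : Set ℂ := Ω ∩ {x | r < ‖x - x₀‖ ∧ ‖x - x₀‖ < R}

theorem isOpen_shell {Ω : Set ℂ} (hΩ : IsOpen Ω) (x₀ : ℂ) (r R : ℝ) :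
    IsOpen (shell Ω x₀ r R) := by
  have hc : Continuous fun x : ℂ => ‖x - x₀‖ := by fun_prop
  exact hΩ.inter (isOpen_Ioo.preimage hc)

theorem shell_subset_annulus (Ω : Set ℂ) (x₀ : ℂ) (r R : ℝ) :
    shell Ω x₀ r R ⊆ GLTangential.annulus Ω x₀ r R := by
  rintro x ⟨hx, h1, h2⟩
  refine ⟨⟨by rwa [mem_ball, dist_eq_norm], hx⟩, fun h => ?_⟩
  have : x ∈ closedBall x₀ r := closure_ball_subset_closedBall (closure_mono inter_subset_left h)
  rw [mem_closedBall, dist_eq_norm] at this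
  linarith

/-- A point of the closed sector is reached by moving the radius towards (r + R)/2 and the relative
angular position s towards 1/2; for small positive t this path lies in the open sector. -/
theorem polarPoint_mem_closure_shell {Ω : Set ℂ} {x₀ : ℂ} {β r R : ℝ} {a b : ℝ → ℝ} (hr : 0 < r)
    (hrR : r < R) (ha : Continuous a) (hb : Continuous b) (hab : ∀ ρ ∈ Icc r R, a ρ < b ρ)
    (harc : ∀ ρ ∈ Ioo r R, ∀ θ ∈ Ioo (a ρ) (b ρ), polarPoint x₀ β (ρ, θ) ∈ Ω) {p : ℝ × ℝ}
    (hp : p ∈ polarRegion r R a b) : polarPoint x₀ β p ∈ closure (shell Ω x₀ r R) := by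
  obtain ⟨ρ, θ⟩ := p
  obtain ⟨hρ, hθ⟩ := hp
  simp only at hρ hθ
  have hba : 0 < b ρ - a ρ := sub_pos.mpr (hab ρ hρ)
  set s := (θ - a ρ) / (b ρ - a ρ) with hs
  have hs0 : 0 ≤ s := div_nonneg (sub_nonneg.mpr hθ.1) hba.le
  have hs1 : s ≤ 1 := by rw [hs, div_le_one hba]; linarith [hθ.2]
  set f : ℝ → ℝ := fun t => ρ + t * ((r + R) / 2 - ρ) with hf
  set h : ℝ → ℝ := fun t => a (f t) + (s + t * (1 / 2 - s)) * (b (f t) - a (f t)) with hh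
  have hfc : Continuous f := by fun_prop
  have hhc : Continuous h := by fun_prop
  have hlim : Filter.Tendsto (fun t => polarPoint x₀ β (f t, h t)) (nhdsWithin 0 (Ioi 0))
      (nhds (polarPoint x₀ β (ρ, θ))) := by
    refine Filter.Tendsto.mono_left ?_ nhdsWithin_le_nhds
    refine ((continuous_polarPoint x₀ β).comp (hfc.prodMk hhc)).tendsto' 0 _ ?_
    have e1 : f 0 = ρ := by simp [hf]
    have e2 : h 0 = θ := by
      simp only [hh, e1, zero_mul, add_zero, hs, div_mul_cancel₀ _ hba.ne']; ring
    simp [Function.comp, e1, e2]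
  refine mem_closure_of_tendsto hlim ?_
  filter_upwards [Ioo_mem_nhdsGT (show (0 : ℝ) < 1 by norm_num)] with t ht
  have hft : f t ∈ Ioo r R := by
    simp only [hf, mem_Ioo]
    constructor
    · nlinarith [ht.1, ht.2, hρ.1, mul_nonneg (sub_nonneg.mpr ht.2.le) (sub_nonneg.mpr hρ.1)]
    · nlinarith [ht.1, ht.2, hρ.2, mul_nonneg (sub_nonneg.mpr ht.2.le) (sub_nonneg.mpr hρ.2)]
  have hba' := sub_pos.mpr (hab (f t) (Ioo_subset_Icc_self hft))
  have hst : 0 < s + t * (1 / 2 - s) := by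
    nlinarith [ht.1, mul_nonneg (sub_nonneg.mpr ht.2.le) hs0]
  have hst1 : s + t * (1 / 2 - s) < 1 := by
    nlinarith [ht.1, mul_nonneg (sub_nonneg.mpr ht.2.le) (sub_nonneg.mpr hs1)]
  refine ⟨harc _ hft _ ⟨?_, ?_⟩, ?_⟩
  · simp only [hh]; nlinarith
  · simp only [hh]; nlinarith
  · have := norm_polarPoint_sub x₀ β (p := (f t, h t)) (hr.trans hft.1).le
    rw [mem_ofPred_eq, this]
    exact hft

theorem half_le_norm_on_closure {Ω S : Set ℂ} {u : ℂ → ℂ} (huc : ContinuousOn u (closure Ω))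
    (hSΩ : S ⊆ Ω) (hS : ∀ x ∈ S, 1 / 2 ≤ ‖u x‖) : ∀ x ∈ closure S, 1 / 2 ≤ ‖u x‖ := by
  have hcl : IsClosed (closure Ω ∩ (fun x => ‖u x‖) ⁻¹' Ici (1 / 2)) :=
    huc.norm.preimage_isClosed_of_isClosed isClosed_closure isClosed_Ici
  intro x hx
  have hsub : S ⊆ closure Ω ∩ (fun x => ‖u x‖) ⁻¹' Ici (1 / 2) := fun y hy =>
    ⟨subset_closure (hSΩ hy), hS y hy⟩
  exact (closure_minimal hsub hcl hx).2

/-- Removes a margin η in radius and angle, so that the compact case applies, and lets η tend to 0.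
The endpoints may then lie on Γ, and the sector may be a full circle, whose two sides the phase
treats as distinct. -/
theorem GLTangential.IsH1.sector_lower_bound {Ω : Set ℂ} {u p q : ℂ → ℂ}
    (hu : GLTangential.IsH1 Ω u p q) (hΩ : IsOpen Ω) (huc : ContinuousOn u (closure Ω))
    {x₀ : ℂ} {β r R : ℝ} {a b : ℝ → ℝ} (hr : 0 < r) (hrR : r < R)
    (hbound : ∀ x ∈ shell Ω x₀ r R, 1 / 2 ≤ ‖u x‖ ∧ ‖u x‖ ≤ 1)
    (ha : Continuous a) (hb : Continuous b)
    (hab : ∀ ρ ∈ Icc r R, -Real.pi ≤ a ρ ∧ a ρ < b ρ ∧ b ρ ≤ Real.pi)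
    (harc : ∀ ρ ∈ Ioo r R, ∀ θ ∈ Ioo (a ρ) (b ρ), polarPoint x₀ β (ρ, θ) ∈ Ω)
    (hpot : IntegrableOn (fun x => (1 - ‖u x‖ ^ 2) / ‖x - x₀‖ ^ 2) (shell Ω x₀ r R)) :
    ∃ φ : ℝ × ℝ → ℝ, Continuous φ ∧
      (∀ p ∈ polarRegion r R a b, u (polarPoint x₀ β p) =
        ‖u (polarPoint x₀ β p)‖ * Complex.exp (φ p * Complex.I)) ∧
      ∀ l : ℝ,
        (∫ ρ in r..R, ρ⁻¹ * (2 * l * (φ (ρ, b ρ) - φ (ρ, a ρ)) - l ^ 2 * (b ρ - a ρ))) -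
        4 * l ^ 2 * (∫ x in shell Ω x₀ r R, (1 - ‖u x‖ ^ 2) / ‖x - x₀‖ ^ 2) ≤
        ∫ x in shell Ω x₀ r R, GLTangential.gradSq p q x := by
  have hpi := Real.pi_pos
  have hSΩ : shell Ω x₀ r R ⊆ Ω := inter_subset_left
  have hcl : ∀ p ∈ polarRegion r R a b, polarPoint x₀ β p ∈ closure (shell Ω x₀ r R) :=
    fun p hp => polarPoint_mem_closure_shell hr hrR ha hb (fun ρ hρ => (hab ρ hρ).2.1) harc hp
  have hlow := half_le_norm_on_closure huc hSΩ fun x hx => (hbound x hx).1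
  -- A retraction of the whole (ρ, θ)-plane onto the sector. Composed with it, u is continuous and
  -- nonvanishing on a simply connected space, hence has a global continuous phase.
  set cl : ℝ × ℝ → ℝ × ℝ := fun p =>
    (max r (min p.1 R), max (a (max r (min p.1 R))) (min p.2 (b (max r (min p.1 R))))) with hcldef
  have hclc : Continuous cl := by fun_prop
  have hclm : ∀ p, cl p ∈ polarRegion r R a b := fun p => by
    have h1 : max r (min p.1 R) ∈ Icc r R := ⟨le_max_left _ _, max_le hrR.le (min_le_right _ _)⟩
    exact ⟨h1, le_max_left _ _, max_le (hab _ h1).2.1.le (min_le_right _ _)⟩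
  have hclid : ∀ p ∈ polarRegion r R a b, cl p = p := fun p hp => by
    have h1 : max r (min p.1 R) = p.1 := by rw [min_eq_left hp.1.2, max_eq_right hp.1.1]
    simp only [hcldef, h1]
    rw [min_eq_left hp.2.2, max_eq_right hp.2.1]
  set w : ℝ × ℝ → ℂ := fun p => u (polarPoint x₀ β (cl p)) with hw
  have hwc : Continuous w := huc.comp_continuous ((continuous_polarPoint x₀ β).comp hclc)
    fun p => closure_mono hSΩ (hcl _ (hclm p))
  obtain ⟨φ, hφ, hφw⟩ := exists_continuous_phase hwc fun p h => by
    have := hlow _ (hcl _ (hclm p))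
    rw [show u (polarPoint x₀ β (cl p)) = 0 from h] at this
    norm_num at this
  have hphase : ∀ p ∈ polarRegion r R a b, u (polarPoint x₀ β p) =
      ‖u (polarPoint x₀ β p)‖ * Complex.exp (φ p * Complex.I) := fun p hp => by
    have := hφw p
    simpa only [hw, hclid p hp] using this
  refine ⟨φ, hφ, hphase, fun l => ?_⟩
  set E := ∫ x in shell Ω x₀ r R, (1 - ‖u x‖ ^ 2) / ‖x - x₀‖ ^ 2
  -- Writing `max ρ r` for ρ makes the integrand continuous for all (η, ρ), so that its integral
  -- depends continuously on η at 0.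
  set f : ℝ → ℝ → ℝ := fun η ρ => (max ρ r)⁻¹ * (2 * l * (φ (ρ, b ρ - η) - φ (ρ, a ρ + η)) -
    l ^ 2 * (b ρ - η - (a ρ + η))) with hf
  have hfc : Continuous (Function.uncurry f) := by
    refine Continuous.mul (Continuous.inv₀ (by fun_prop) fun x => ?_) (by fun_prop)
    exact (hr.trans_le (le_max_right _ _)).ne'
  have hfi : ∀ η s t, IntervalIntegrable (f η) volume s t := fun η s t =>
    (hfc.comp (Continuous.prodMk_right η)).intervalIntegrable s t
  have hFc : Continuous fun η => (∫ ρ in r..R - η, f η ρ) - ∫ ρ in r..r + η, f η ρ :=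
    (intervalIntegral.continuous_parametric_intervalIntegral_of_continuous hfc (by fun_prop)).sub
      (intervalIntegral.continuous_parametric_intervalIntegral_of_continuous hfc (by fun_prop))
  have hF : ∀ η, (∫ ρ in r..R - η, f η ρ) - ∫ ρ in r..r + η, f η ρ =
      ∫ ρ in r + η..R - η, f η ρ := fun η =>
    intervalIntegral.integral_interval_sub_left (hfi _ _ _) (hfi _ _ _)
  simp_rw [hF] at hFc
  obtain ⟨m, hm0, hm⟩ : ∃ m > 0, ∀ ρ ∈ Icc r R, m ≤ b ρ - a ρ := by
    obtain ⟨ρ₀, hρ₀, hmin⟩ := isCompact_Icc.exists_isMinOn (nonempty_Icc.mpr hrR.le)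
      ((hb.sub ha).continuousOn (s := Icc r R))
    exact ⟨_, sub_pos.mpr (hab ρ₀ hρ₀).2.1, fun ρ hρ => hmin hρ⟩
  have hlim : Filter.Tendsto (fun η => (∫ ρ in r + η..R - η, f η ρ) - 4 * l ^ 2 * E)
      (nhdsWithin 0 (Ioi 0)) (nhds
      ((∫ ρ in r..R, ρ⁻¹ * (2 * l * (φ (ρ, b ρ) - φ (ρ, a ρ)) - l ^ 2 * (b ρ - a ρ))) -
        4 * l ^ 2 * E)) := by
    refine Filter.Tendsto.mono_left ?_ nhdsWithin_le_nhds
    refine (hFc.sub continuous_const).tendsto' 0 _ ?_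
    have h0 : ∫ ρ in r + 0..R - 0, f 0 ρ = ∫ ρ in r..R,
        ρ⁻¹ * (2 * l * (φ (ρ, b ρ) - φ (ρ, a ρ)) - l ^ 2 * (b ρ - a ρ)) := by
      rw [add_zero, sub_zero]
      refine intervalIntegral.integral_congr fun ρ hρ => ?_
      rw [uIcc_of_le hrR.le] at hρ
      simp only [hf, max_eq_left hρ.1, sub_zero, add_zero]
    exact congrArg (fun y => y - 4 * l ^ 2 * E) h0
  refine le_of_tendsto hlim ?_
  filter_upwards [Ioo_mem_nhdsGT (show (0 : ℝ) < min (m / 2) ((R - r) / 2) from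
    lt_min (by linarith) (by linarith))] with η hη
  have hη0 : 0 < η := hη.1
  have hη1 : η < m / 2 := hη.2.trans_le (min_le_left _ _)
  have hη2 : η < (R - r) / 2 := hη.2.trans_le (min_le_right _ _)
  have hsub : Icc (r + η) (R - η) ⊆ Ioo r R := fun ρ hρ =>
    ⟨by linarith [hρ.1], by linarith [hρ.2]⟩
  have hregion : polarRegion (r + η) (R - η) (fun ρ => a ρ + η) (fun ρ => b ρ - η) ⊆
      polarRegion r R a b := fun p hp =>
    ⟨Ioo_subset_Icc_self (hsub hp.1), by linarith [hp.2.1], by linarith [hp.2.2]⟩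
  have key := hu.compact_sector_lower_bound hΩ (isOpen_shell hΩ x₀ r R) hSΩ
    (huc.mono (hSΩ.trans subset_closure)) hbound (x₀ := x₀) (β := β) (r := r + η) (R := R - η)
    (a := fun ρ => a ρ + η) (b := fun ρ => b ρ - η) (by linarith) (by linarith) (by fun_prop)
    (by fun_prop) (fun ρ hρ => by
      have h1 := Ioo_subset_Icc_self (hsub hρ)
      have := hm ρ h1
      have := hab ρ h1
      exact ⟨by linarith, by linarith, by linarith⟩)
    (fun p hp => by
      have hp1 := hsub hp.1
      refine ⟨harc p.1 hp1 p.2 ⟨by linarith [hp.2.1], by linarith [hp.2.2]⟩, ?_⟩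
      rw [mem_ofPred_eq, norm_polarPoint_sub x₀ β (hr.trans hp1.1).le]
      exact hp1)
    hφ (fun p hp => hphase p (hregion hp)) hpot l
  refine le_trans (le_of_eq ?_) key
  congr 1
  refine intervalIntegral.integral_congr fun ρ hρ => ?_
  rw [uIcc_of_le (by linarith)] at hρ
  simp only [hf, max_eq_left (hsub hρ).1.le]

/-! ### Potential terms -/

/-- Radial integration of 2πy⁻³. The value π/s² is what makes c² ∫ |x − x₀|⁻⁴ bounded when the
weight c is at most s. -/
theorem integral_norm_pow_neg_four {s : ℝ} (hs : 0 < s) (x₀ : ℂ) :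
    IntegrableOn (fun x : ℂ => (‖x - x₀‖ ^ 4)⁻¹) {x | s < ‖x - x₀‖} ∧
    ∫ x in {x : ℂ | s < ‖x - x₀‖}, (‖x - x₀‖ ^ 4)⁻¹ = Real.pi / s ^ 2 := by
  set f : ℝ → ℝ := (Ioi s).indicator fun y => (y ^ 4)⁻¹ with hf
  have hpt : ∀ y ∈ Ioi s, y ^ (2 - 1) • (y ^ 4)⁻¹ = y ^ (-3 : ℝ) := fun y hy => by
    have hy0 : 0 < y := hs.trans hy
    rw [Real.rpow_neg hy0.le, smul_eq_mul, pow_one]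
    rw [show (3 : ℝ) = ((3 : ℕ) : ℝ) by norm_num, Real.rpow_natCast]
    field_simp
  have hfeq : (fun y : ℝ => y ^ (2 - 1) • f y) =
      (Ioi s).indicator (fun y => y ^ (-3 : ℝ)) := by
    ext y
    by_cases hy : y ∈ Ioi s
    · simp only [hf, indicator_of_mem hy]; exact hpt y hy
    · simp [hf, indicator_of_notMem hy]
  have hi : IntegrableOn (fun y : ℝ => y ^ (2 - 1) • f y) (Ioi 0) := by
    rw [hfeq]
    exact ((integrableOn_Ioi_rpow_of_lt (by norm_num) hs).integrable_indicator
      measurableSet_Ioi).integrableOn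
  have hm : MeasurableSet {x : ℂ | s < ‖x - x₀‖} :=
    measurableSet_lt measurable_const (by fun_prop)
  have hind : (fun x : ℂ => f ‖x - x₀‖) =
      {x : ℂ | s < ‖x - x₀‖}.indicator fun x => (‖x - x₀‖ ^ 4)⁻¹ := by
    ext x
    by_cases hx : s < ‖x - x₀‖
    · rw [indicator_of_mem (show x ∈ {x : ℂ | s < ‖x - x₀‖} from hx), hf,
        indicator_of_mem (show ‖x - x₀‖ ∈ Ioi s from hx)]
    · rw [indicator_of_notMem (show x ∉ {x : ℂ | s < ‖x - x₀‖} from hx), hf,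
        indicator_of_notMem (show ‖x - x₀‖ ∉ Ioi s from hx)]
  have h1 : Integrable (fun x : ℂ => f ‖x‖) := by
    rw [integrable_fun_norm_addHaar volume, Complex.finrank_real_complex]
    exact hi
  constructor
  · rw [← integrable_indicator_iff hm, ← hind]
    exact h1.comp_sub_right x₀
  · rw [← integral_indicator hm, ← hind, integral_sub_right_eq_self (fun x => f ‖x‖) x₀,
      integral_fun_norm_addHaar volume, Complex.finrank_real_complex, hfeq,
      setIntegral_indicator measurableSet_Ioi, Ioi_inter_Ioi, max_eq_right hs.le,
      integral_Ioi_rpow_of_lt (by norm_num) hs, Measure.real, Complex.volume_ball]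
    have : s ^ (-3 + 1 : ℝ) = (s ^ 2)⁻¹ := by
      rw [show (-3 + 1 : ℝ) = -((2 : ℕ) : ℝ) by norm_num, Real.rpow_neg hs.le, Real.rpow_natCast]
    rw [this]
    simp
    field_simp
    norm_num

/-- This absorbs the logarithm of the energy bounds: every positive power of ε controls |ln ε|
uniformly. -/
theorem rpow_mul_abs_log_le {ε t : ℝ} (hε : ε ∈ Ioo (0 : ℝ) 1) (ht : 0 < t) :
    ε ^ t * |Real.log ε| ≤ 1 / t := by
  have h := (Real.abs_log_mul_self_rpow_lt ε t hε.1 hε.2.le ht).le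
  rwa [abs_mul, abs_of_pos (Real.rpow_pos_of_pos hε.1 t), mul_comm] at h

theorem integrableOn_of_continuousOn_closure {Ω : Set ℂ} (hΩ : Bornology.IsBounded Ω)
    {f : ℂ → ℝ} (hf : ContinuousOn f (closure Ω)) : IntegrableOn f Ω :=
  (hf.integrableOn_compact hΩ.isCompact_closure).mono_set subset_closure

theorem integrableOn_shell_div {Ω : Set ℂ} (hΩo : IsOpen Ω) (hΩ : Bornology.IsBounded Ω)
    {u : ℂ → ℂ} (huc : ContinuousOn u (closure Ω)) {x₀ : ℂ} {r R : ℝ} (hr : 0 < r) :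
    IntegrableOn (fun x => (1 - ‖u x‖ ^ 2) / ‖x - x₀‖ ^ 2) (shell Ω x₀ r R) := by
  have hc : ContinuousOn (fun x => (1 - ‖u x‖ ^ 2) / (max r ‖x - x₀‖) ^ 2) (closure Ω) := by
    refine ContinuousOn.div (by fun_prop) (by fun_prop) fun x _ => ?_
    exact (pow_pos (hr.trans_le (le_max_left _ _)) 2).ne'
  refine ((integrableOn_of_continuousOn_closure hΩ hc).mono_set
    (inter_subset_left (t := {x | r < ‖x - x₀‖ ∧ ‖x - x₀‖ < R}))).congr_fun (fun x hx => ?_)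
    (isOpen_shell hΩo x₀ r R).measurableSet
  simp only [max_eq_right hx.2.1.le]

/-- The potential bounds make the weighted defect of modulus on shells uniformly small. -/
theorem integral_shell_defect_le {Ω : Set ℂ} (hΩo : IsOpen Ω) (hΩ : Bornology.IsBounded Ω)
    {u : ℂ → ℂ} (huc : ContinuousOn u (closure Ω)) {x₀ : ℂ} {ε r R γ K : ℝ}
    (hε : ε ∈ Ioo (0 : ℝ) 1) (hεr : ε ≤ r) (hγ : γ < 1)
    (hE : GLTangential.potential Ω u ≤ 4 * ε ^ 2 * (K * |Real.log ε| + K))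
    (hloc : 1 / ε ^ 2 * GLTangential.potential (GLTangential.omega Ω x₀ (ε ^ γ)) u ≤ K) :
    ∫ x in shell Ω x₀ r R, (1 - ‖u x‖ ^ 2) / ‖x - x₀‖ ^ 2 ≤
      K / 2 + 2 * K * (1 / (2 - 2 * γ) + 1) + Real.pi := by
  have hpi := Real.pi_pos
  obtain ⟨hε0, hε1⟩ := hε
  have hr : 0 < r := hε0.trans_le hεr
  set k := ε ^ γ with hk
  have hk0 : 0 < k := Real.rpow_pos_of_pos hε0 γ
  have hK : 0 ≤ K := by
    refine le_trans (mul_nonneg (by positivity) ?_) hloc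
    exact integral_nonneg fun x => sq_nonneg _
  set S := shell Ω x₀ r R
  have hSm : MeasurableSet S := (isOpen_shell hΩo x₀ r R).measurableSet
  have hSΩ : S ⊆ Ω := inter_subset_left
  set W : ℂ → ℝ := fun x => (1 - ‖u x‖ ^ 2) ^ 2 with hW
  have hWi : IntegrableOn W Ω :=
    integrableOn_of_continuousOn_closure hΩ (((continuousOn_const).sub (huc.norm.pow 2)).pow 2)
  set om := GLTangential.omega Ω x₀ k with hom
  have homm : MeasurableSet om := (isOpen_ball.inter hΩo).measurableSet
  have homΩ : om ⊆ Ω := inter_subset_right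
  obtain ⟨hi1, he1⟩ := integral_norm_pow_neg_four hr x₀
  obtain ⟨hi2, he2⟩ := integral_norm_pow_neg_four hk0 x₀
  set T1 : Set ℂ := {x | r < ‖x - x₀‖}
  set T2 : Set ℂ := {x | k < ‖x - x₀‖}
  have hT1 : MeasurableSet T1 := measurableSet_lt measurable_const (by fun_prop)
  have hT2 : MeasurableSet T2 := measurableSet_lt measurable_const (by fun_prop)
  set V : ℂ → ℝ := fun x => (‖x - x₀‖ ^ 4)⁻¹ with hV
  have hV0 : ∀ x, 0 ≤ V x := fun x => by simp only [hV]; positivity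
  have hW0 : ∀ x, 0 ≤ W x := fun x => sq_nonneg _
  have j1 : IntegrableOn (om.indicator W) S :=
    ((hWi.mono_set homΩ).integrable_indicator homm).integrableOn
  have j2 : IntegrableOn W S := hWi.mono_set hSΩ
  have j3 : IntegrableOn (T1.indicator V) S := (hi1.integrable_indicator hT1).integrableOn
  have j4 : IntegrableOn (T2.indicator V) S := (hi2.integrable_indicator hT2).integrableOn
  -- The arithmetic-geometric mean inequality with weight ε inside the ball of radius k = ε^γ and
  -- weight k outside it. All four nonnegative terms are kept, so the integral need not be split.
  -- The null sphere of radius k is discarded because it belongs to neither region.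
  have hae : ∀ᵐ x ∂(volume.restrict S), (1 - ‖u x‖ ^ 2) / ‖x - x₀‖ ^ 2 ≤
      1 / 2 * (1 / ε ^ 2 * om.indicator W x + 1 / k ^ 2 * W x +
      (ε ^ 2 * T1.indicator V x + k ^ 2 * T2.indicator V x)) := by
    have hne : ∀ᵐ x : ℂ, x ∉ sphere x₀ k :=
      measure_eq_zero_iff_ae_notMem.mp (Measure.addHaar_sphere volume x₀ k)
    filter_upwards [ae_restrict_of_ae hne, ae_restrict_mem hSm] with x hxk hx
    have hrx : r < ‖x - x₀‖ := hx.2.1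
    have hx0 : 0 < ‖x - x₀‖ := hr.trans hrx
    have hT1x : T1.indicator V x = V x := indicator_of_mem (show x ∈ T1 from hrx) _
    have amgm : ∀ c : ℝ, 0 < c → (1 - ‖u x‖ ^ 2) / ‖x - x₀‖ ^ 2 ≤
        1 / 2 * (1 / c ^ 2 * W x + c ^ 2 * V x) := fun c hc => by
      have h1 := sq_nonneg (1 / c * (1 - ‖u x‖ ^ 2) - c * (‖x - x₀‖ ^ 2)⁻¹)
      have h2 : 1 / c * (1 - ‖u x‖ ^ 2) * (c * (‖x - x₀‖ ^ 2)⁻¹) =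
          (1 - ‖u x‖ ^ 2) / ‖x - x₀‖ ^ 2 := by field_simp
      have h3 : (c * (‖x - x₀‖ ^ 2)⁻¹) ^ 2 = c ^ 2 * V x := by
        simp only [hV]; rw [mul_pow, inv_pow, ← pow_mul]
      have h4 : (1 / c * (1 - ‖u x‖ ^ 2)) ^ 2 = 1 / c ^ 2 * W x := by
        simp only [hW]; rw [mul_pow, one_div_pow]
      nlinarith
    have n1 : 0 ≤ 1 / ε ^ 2 * om.indicator W x :=
      mul_nonneg (by positivity) (indicator_nonneg (fun y _ => hW0 y) x)
    have n2 : 0 ≤ 1 / k ^ 2 * W x := mul_nonneg (by positivity) (hW0 x)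
    have n3 : 0 ≤ ε ^ 2 * T1.indicator V x :=
      mul_nonneg (by positivity) (indicator_nonneg (fun y _ => hV0 y) x)
    have n4 : 0 ≤ k ^ 2 * T2.indicator V x :=
      mul_nonneg (by positivity) (indicator_nonneg (fun y _ => hV0 y) x)
    rcases lt_or_ge ‖x - x₀‖ k with h | h
    · have hxo : x ∈ om := ⟨by rwa [mem_ball, dist_eq_norm], hSΩ hx⟩
      have := amgm ε hε0
      rw [← hT1x, ← indicator_of_mem hxo W] at this
      linarith
    · have hxT : x ∈ T2 := lt_of_le_of_ne h fun he => hxk (by rw [mem_sphere, dist_eq_norm, he])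
      have := amgm k hk0
      rw [← indicator_of_mem hxT V] at this
      linarith
  have hmono := integral_mono_ae (integrableOn_shell_div hΩo hΩ huc hr)
    ((((j1.const_mul (1 / ε ^ 2)).add (j2.const_mul (1 / k ^ 2))).add
      ((j3.const_mul (ε ^ 2)).add (j4.const_mul (k ^ 2)))).const_mul (1 / 2)) hae
  refine hmono.trans ?_
  simp only [Pi.add_apply]
  have e := integral_add ((j1.const_mul (1 / ε ^ 2)).add (j2.const_mul (1 / k ^ 2)))
      ((j3.const_mul (ε ^ 2)).add (j4.const_mul (k ^ 2)))
  simp only [Pi.add_apply] at e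
  rw [integral_const_mul, e, integral_add (j1.const_mul _) (j2.const_mul _),
    integral_add (j3.const_mul _) (j4.const_mul _), integral_const_mul, integral_const_mul,
    integral_const_mul, integral_const_mul]
  have b1 : ∫ x in S, om.indicator W x ≤ GLTangential.potential om u := by
    refine (setIntegral_le_integral ((hWi.mono_set homΩ).integrable_indicator homm)
      (Filter.Eventually.of_forall fun x => indicator_nonneg (fun y _ => hW0 y) x)).trans ?_
    rw [integral_indicator homm]
    rfl
  have b2 : ∫ x in S, W x ≤ GLTangential.potential Ω u :=
    setIntegral_mono_set hWi (Filter.Eventually.of_forall hW0) (Filter.Eventually.of_forall hSΩ)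
  have b3 : ∫ x in S, T1.indicator V x ≤ Real.pi / r ^ 2 := by
    refine (setIntegral_le_integral (hi1.integrable_indicator hT1)
      (Filter.Eventually.of_forall fun x => indicator_nonneg (fun y _ => hV0 y) x)).trans ?_
    rw [integral_indicator hT1, he1]
  have b4 : ∫ x in S, T2.indicator V x ≤ Real.pi / k ^ 2 := by
    refine (setIntegral_le_integral (hi2.integrable_indicator hT2)
      (Filter.Eventually.of_forall fun x => indicator_nonneg (fun y _ => hV0 y) x)).trans ?_
    rw [integral_indicator hT2, he2]
  have c1 : 1 / ε ^ 2 * ∫ x in S, om.indicator W x ≤ K :=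
    (mul_le_mul_of_nonneg_left b1 (by positivity)).trans hloc
  have c3 : ε ^ 2 * ∫ x in S, T1.indicator V x ≤ Real.pi := by
    refine (mul_le_mul_of_nonneg_left b3 (by positivity)).trans ?_
    rw [mul_div_assoc', div_le_iff₀ (by positivity)]
    have : ε ^ 2 ≤ r ^ 2 := by gcongr
    nlinarith
  have c4 : k ^ 2 * ∫ x in S, T2.indicator V x ≤ Real.pi := by
    refine (mul_le_mul_of_nonneg_left b4 (by positivity)).trans (le_of_eq ?_)
    field_simp
  -- The global potential bound is O(ε²(|ln ε| + 1)), and dividing by k² = ε^(2γ) leaves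
  -- ε^(2−2γ)(|ln ε| + 1), bounded since γ < 1.
  have c2 : 1 / k ^ 2 * ∫ x in S, W x ≤ 4 * K * (1 / (2 - 2 * γ) + 1) := by
    refine (mul_le_mul_of_nonneg_left (b2.trans hE) (by positivity)).trans ?_
    have hpow : 1 / k ^ 2 * ε ^ 2 = ε ^ (2 - 2 * γ) := by
      rw [Real.rpow_sub hε0, hk, ← Real.rpow_natCast (ε ^ γ) 2, ← Real.rpow_mul hε0.le]
      rw [show (ε : ℝ) ^ (2 : ℝ) = ε ^ 2 by exact_mod_cast Real.rpow_natCast ε 2]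
      rw [show γ * ((2 : ℕ) : ℝ) = 2 * γ by push_cast; ring]
      ring
    have hl := rpow_mul_abs_log_le ⟨hε0, hε1⟩ (show 0 < 2 - 2 * γ by linarith)
    have h1 : ε ^ (2 - 2 * γ) ≤ 1 := Real.rpow_le_one hε0.le hε1.le (by linarith)
    calc 1 / k ^ 2 * (4 * ε ^ 2 * (K * |Real.log ε| + K))
        = 4 * K * (ε ^ (2 - 2 * γ) * |Real.log ε| + ε ^ (2 - 2 * γ)) := by rw [← hpow]; ring
      _ ≤ _ := by gcongr
  linarith

/-! ### Interior lower bound -/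

theorem direction_eq_exp {u : ℂ → ℂ} {x : ℂ} {y : ℝ} (h0 : 1 / 2 ≤ ‖u x‖)
    (h : u x = ‖u x‖ * Complex.exp (y * Complex.I)) :
    GLTangential.direction u x = Complex.exp (y * Complex.I) := by
  have : (‖u x‖ : ℂ) ≠ 0 := by
    rw [Ne, Complex.ofReal_eq_zero]; linarith
  unfold GLTangential.direction
  rw [div_eq_iff this]
  exact h.trans (mul_comm _ _)

theorem GLTangential.IsH1.integrableOn_gradSq {Ω : Set ℂ} {u p q : ℂ → ℂ}
    (hu : GLTangential.IsH1 Ω u p q) : IntegrableOn (GLTangential.gradSq p q) Ω :=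
  (hu.memLp_fst.integrable_norm_pow (by norm_num)).add
    (hu.memLp_snd.integrable_norm_pow (by norm_num))

theorem GLTangential.gradSq_nonneg (p q : ℂ → ℂ) (x : ℂ) : 0 ≤ GLTangential.gradSq p q x := by
  unfold GLTangential.gradSq; positivity

theorem GLTangential.IsH1.setIntegral_shell_le {Ω : Set ℂ} {u p q : ℂ → ℂ}
    (hu : GLTangential.IsH1 Ω u p q) (x₀ : ℂ) (r R : ℝ) :
    ∫ x in shell Ω x₀ r R, GLTangential.gradSq p q x ≤
      ∫ x in GLTangential.annulus Ω x₀ r R, GLTangential.gradSq p q x :=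
  setIntegral_mono_set (hu.integrableOn_gradSq.mono_set fun _ hx => hx.1.2)
    (Filter.Eventually.of_forall fun x => GLTangential.gradSq_nonneg p q x)
    (Filter.Eventually.of_forall (shell_subset_annulus Ω x₀ r R))

/-- On each circle the phase increment is an integer multiple of 2π, it is constant in ρ by
continuity, and at ρ = r it is 2πd. The sector bound is then used with l = d. -/
theorem GLTangential.IsH1.interior_lower_bound {Ω : Set ℂ} {u p q : ℂ → ℂ}
    (hu : GLTangential.IsH1 Ω u p q) (hΩ : IsOpen Ω) (hΩb : Bornology.IsBounded Ω)
    (huc : ContinuousOn u (closure Ω)) {x₀ : ℂ} {r R C : ℝ} (hr : 0 < r) (hrR : r < R)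
    (hball : ball x₀ R ⊆ Ω)
    (hbound : ∀ x ∈ GLTangential.annulus Ω x₀ r R, 1 / 2 ≤ ‖u x‖ ∧ ‖u x‖ ≤ 1)
    (hC : ∫ x in shell Ω x₀ r R, (1 - ‖u x‖ ^ 2) / ‖x - x₀‖ ^ 2 ≤ C) {d : ℤ}
    (hd : GLTangential.IsDegree u x₀ r d) :
    2 * Real.pi * (d : ℝ) ^ 2 * Real.log (R / r) - 4 * C * (d : ℝ) ^ 2 ≤
      ∫ x in GLTangential.annulus Ω x₀ r R, GLTangential.gradSq p q x := by
  have hpi := Real.pi_pos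
  have hbound' : ∀ x ∈ shell Ω x₀ r R, 1 / 2 ≤ ‖u x‖ ∧ ‖u x‖ ≤ 1 := fun x hx =>
    hbound x (shell_subset_annulus Ω x₀ r R hx)
  have harc : ∀ ρ ∈ Ioo r R, ∀ θ ∈ Ioo (-Real.pi) Real.pi,
      polarPoint x₀ Real.pi (ρ, θ) ∈ Ω := fun ρ hρ θ _ => hball (by
    rw [mem_ball, dist_eq_norm, norm_polarPoint_sub x₀ _ (p := (ρ, θ)) (hr.trans hρ.1).le]
    exact hρ.2)
  obtain ⟨φ, hφ, hphase, hineq⟩ := hu.sector_lower_bound hΩ huc hr hrR hbound'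
    -- With reference angle π the actual angle θ + π runs over [0, 2π], the interval used in
    -- `IsDegree`.
    (β := Real.pi) (a := fun _ => -Real.pi) (b := fun _ => Real.pi) continuous_const
    continuous_const (fun ρ _ => ⟨le_rfl, by linarith, le_rfl⟩) harc
    (integrableOn_shell_div hΩ hΩb huc hr)
  have hlow : ∀ p ∈ polarRegion r R (fun _ => -Real.pi) (fun _ => Real.pi),
      1 / 2 ≤ ‖u (polarPoint x₀ Real.pi p)‖ := fun p hp =>
    half_le_norm_on_closure huc inter_subset_left (fun x hx => (hbound' x hx).1) _
      (polarPoint_mem_closure_shell hr hrR continuous_const continuous_const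
        (fun ρ _ => by linarith) harc hp)
  have hdir : ∀ ρ ∈ Icc r R, ∀ θ ∈ Icc (-Real.pi) Real.pi,
      GLTangential.direction u (polarPoint x₀ Real.pi (ρ, θ)) =
        Complex.exp (φ (ρ, θ) * Complex.I) := fun ρ hρ θ hθ =>
    direction_eq_exp (hlow _ ⟨hρ, hθ⟩) (hphase _ ⟨hρ, hθ⟩)
  have hmem1 : Real.pi ∈ Icc (-Real.pi) Real.pi := ⟨by linarith, le_rfl⟩
  have hmem2 : -Real.pi ∈ Icc (-Real.pi) Real.pi := ⟨le_rfl, by linarith⟩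
  have hint : ∀ ρ ∈ Icc r R, ∃ m : ℤ, (φ (ρ, Real.pi) - φ (ρ, -Real.pi)) / 2 = Real.pi * m := by
    intro ρ hρ
    have h1 := hdir ρ hρ _ hmem1
    have h2 := hdir ρ hρ _ hmem2
    have e : polarPoint x₀ Real.pi (ρ, Real.pi) = polarPoint x₀ Real.pi (ρ, -Real.pi) := by
      unfold polarPoint
      have := periodic_circleMap x₀ ρ (-Real.pi + Real.pi)
      rw [← this]
      congr 1
      ring
    rw [e, h2] at h1
    obtain ⟨m, hm⟩ := exists_int_of_exp_eq h1
    exact ⟨-m, by rw [hm]; push_cast; ring⟩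
  obtain ⟨m, hm⟩ := exists_int_near_of_continuousOn
    (f := fun ρ => (φ (ρ, Real.pi) - φ (ρ, -Real.pi)) / 2)
    (Continuous.continuousOn (by fun_prop)) hrR.le (fun ρ hρ => by
      obtain ⟨m, hm⟩ := hint ρ hρ
      exact ⟨m, by rw [hm]; simp; positivity⟩)
  have hconst : ∀ ρ ∈ Icc r R, φ (ρ, Real.pi) - φ (ρ, -Real.pi) = 2 * Real.pi * m := by
    intro ρ hρ
    obtain ⟨k, hk⟩ := hint ρ hρ
    have h1 := hm ρ hρ
    simp only [hk] at h1
    rw [← mul_sub, abs_mul, abs_of_pos hpi] at h1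
    have h4 : |((k - m : ℤ) : ℝ)| < 1 := by push_cast; nlinarith
    have h5 : k - m = 0 := Int.abs_lt_one_iff.mp (by exact_mod_cast h4)
    have : k = m := by omega
    subst this
    linarith
  obtain ⟨φ', ⟨hφ'c, hφ'⟩, hφ'd⟩ := hd
  have hr' : r ∈ Icc r R := ⟨le_rfl, hrR.le⟩
  have hinc := phase_increment_unique (φ := φ') (ψ := fun θ => φ (r, θ - Real.pi))
    (a := 0) (b := 2 * Real.pi) (by linarith) hφ'c (Continuous.continuousOn (by fun_prop))
    (fun θ hθ => by
      rw [← hφ' θ hθ, ← hdir r hr' (θ - Real.pi) ⟨by linarith [hθ.1], by linarith [hθ.2]⟩]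
      simp [polarPoint])
  have hmd : m = d := by
    have h1 := hconst r hr'
    simp only [zero_sub] at hinc
    rw [show 2 * Real.pi - Real.pi = Real.pi by ring, hφ'd, h1] at hinc
    have : (m : ℝ) = d := by
      have h2 : (2 * Real.pi) * ((m : ℝ) - d) = 0 := by linarith
      rcases mul_eq_zero.mp h2 with h | h <;> linarith
    exact_mod_cast this
  subst hmd
  have key := hineq m
  have hI : (∫ ρ in r..R, ρ⁻¹ * (2 * (m : ℝ) * (φ (ρ, Real.pi) - φ (ρ, -Real.pi)) -
      (m : ℝ) ^ 2 * (Real.pi - -Real.pi))) = 2 * Real.pi * (m : ℝ) ^ 2 * Real.log (R / r) := by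
    rw [← integral_inv_of_pos hr (hr.trans hrR), ← intervalIntegral.integral_const_mul]
    refine intervalIntegral.integral_congr fun ρ hρ => ?_
    rw [uIcc_of_le hrR.le] at hρ
    simp only [hconst ρ hρ]
    ring
  rw [hI] at key
  have h2 := mul_le_mul_of_nonneg_left hC (show 0 ≤ 4 * (m : ℝ) ^ 2 by positivity)
  have h3 := hu.setIntegral_shell_le x₀ r R
  linarith

/-! ### Curves parametrized by the distance to a point -/

/-- `T` inverts the distance function `f` on `[0, δ]`, for values up to `r₀`. -/
structure IsRadialInverse (f T : ℝ → ℝ) (r₀ δ : ℝ) : Prop where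
  continuousOn : ContinuousOn T (Icc 0 r₀)
  mem : ∀ ρ ∈ Icc 0 r₀, T ρ ∈ Icc 0 δ
  right_inv : ∀ ρ ∈ Icc 0 r₀, f (T ρ) = ρ
  le_two_mul : ∀ ρ ∈ Icc 0 r₀, T ρ ≤ 2 * ρ
  left_inv : ∀ t ∈ Icc 0 δ, f t ≤ r₀ → T (f t) = t
  mono : MonotoneOn T (Icc 0 r₀)
  integral_le : ∀ r R : ℝ, 0 < r → r ≤ R → R ≤ r₀ → ∀ g : ℝ → ℝ, (∀ x, 0 ≤ g x) →
    IntegrableOn (fun t => g (f t)) (Icc (T r) (T R)) →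
    ∫ ρ in Icc r R, g ρ ≤ ∫ t in Icc (T r) (T R), g (f t)

/-! ### Curves with almost constant unit tangent -/

section NearlyStraight

variable {y y' : ℝ → ℂ} {M δ : ℝ}

theorem norm_sub_self_le_of_deriv (hy0 : y 0 = 0) (hy : ∀ t, HasDerivAt y (y' t) t)
    (hM : 0 ≤ M) (hclose : ∀ t ∈ Icc 0 δ, ‖y' t - 1‖ ≤ M * t) {t : ℝ} (ht : t ∈ Icc 0 δ) :
    ‖y t - t‖ ≤ M * t ^ 2 := by
  have h := (convex_Icc 0 t).norm_image_sub_le_of_norm_hasDerivWithin_le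
    (f := fun s => y s - s) (f' := fun s => y' s - 1) (C := M * t) (x := 0) (y := t)
    (fun s _ => ((hy s).sub (Complex.ofRealCLM.hasDerivAt (x := s))).hasDerivWithinAt)
    (fun s hs => (hclose s ⟨hs.1, hs.2.trans ht.2⟩).trans
      (mul_le_mul_of_nonneg_left hs.2 hM)) ⟨le_rfl, ht.1⟩ ⟨ht.1, le_rfl⟩
  simp only [hy0, Complex.ofReal_zero, sub_zero, Real.norm_eq_abs, abs_of_nonneg ht.1] at h
  linarith [h, show M * t * t = M * t ^ 2 by ring]

theorem bounds_of_deriv (hy0 : y 0 = 0) (hy : ∀ t, HasDerivAt y (y' t) t)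
    (hM : 0 ≤ M) (hMδ : M * δ ≤ 1 / 8)
    (hclose : ∀ t ∈ Icc 0 δ, ‖y' t - 1‖ ≤ M * t) {t : ℝ} (ht : t ∈ Icc 0 δ) :
    7 / 8 * t ≤ (y t).re ∧ ‖y t‖ ≤ 9 / 8 * t ∧ |(y t).im| ≤ M * t ^ 2 := by
  have h := norm_sub_self_le_of_deriv hy0 hy hM hclose ht
  have h1 : M * t ^ 2 ≤ t / 8 := by
    have : M * t ≤ 1 / 8 := (mul_le_mul_of_nonneg_left ht.2 hM).trans hMδ
    nlinarith [ht.1]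
  refine ⟨?_, ?_, ?_⟩
  · have := (Complex.abs_re_le_norm _).trans h
    rw [Complex.sub_re, Complex.ofReal_re, abs_le] at this
    linarith
  · have := norm_sub_norm_le (y t) (t : ℂ)
    rw [Complex.norm_real, Real.norm_of_nonneg ht.1] at this
    linarith
  · have := (Complex.abs_im_le_norm _).trans h
    simpa using this

theorem abs_arg_le_of_deriv (hy0 : y 0 = 0) (hy : ∀ t, HasDerivAt y (y' t) t)
    (hM : 0 ≤ M) (hMδ : M * δ ≤ 1 / 8)
    (hclose : ∀ t ∈ Icc 0 δ, ‖y' t - 1‖ ≤ M * t) {t : ℝ} (ht : t ∈ Icc 0 δ) (ht0 : 0 < t) :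
    |(y t).arg| ≤ 2 * M * t := by
  obtain ⟨h1, -, h3⟩ := bounds_of_deriv hy0 hy hM hMδ hclose ht
  have hn : 7 / 8 * t ≤ ‖y t‖ := h1.trans (Complex.re_le_norm _)
  have h4 := Complex.abs_arg_le_pi_div_two_iff.mpr (show 0 ≤ (y t).re by nlinarith)
  have h5 := Real.mul_abs_le_abs_sin h4
  rw [Complex.sin_arg, abs_div, abs_norm] at h5
  have h6 : |(y t).im| / ‖y t‖ ≤ 8 / 7 * M * t := by
    rw [div_le_iff₀ (by linarith [show 0 < 7 / 8 * t by positivity])]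
    have := mul_le_mul_of_nonneg_left hn (show 0 ≤ 8 / 7 * M * t by positivity)
    nlinarith
  have hpi := Real.pi_pos
  have hpi4 := Real.pi_lt_d2
  have h7 : |(y t).arg| = Real.pi / 2 * (2 / Real.pi * |(y t).arg|) := by field_simp
  have h8 : 0 ≤ M * t := by positivity
  calc |(y t).arg| = Real.pi / 2 * (2 / Real.pi * |(y t).arg|) := h7
    _ ≤ Real.pi / 2 * (8 / 7 * M * t) := mul_le_mul_of_nonneg_left (h5.trans h6) (by positivity)
    -- The constant 2 suffices because (π/2)·(8/7) < 2.
    _ ≤ 2 * M * t := by nlinarith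

theorem hasDerivAt_norm_of_deriv (hy : ∀ t, HasDerivAt y (y' t) t) {t : ℝ} (h0 : y t ≠ 0) :
    HasDerivAt (fun t => ‖y t‖) (inner ℝ (y t) (y' t) / ‖y t‖) t := by
  have h1 := ((hy t).norm_sq).sqrt (pow_ne_zero 2 (norm_ne_zero_iff.mpr h0))
  simp only [Real.sqrt_sq (norm_nonneg _)] at h1
  convert! h1 using 1
  field_simp

/-- The derivative of |y| is at least 1/2 for t > 0, since y is close to t and y' to 1; so |y| is
injective, reaches δ/2 ≥ r₀, and has a 2-Lipschitz inverse. It is at most 1 because y has unit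
speed, which gives the inequality between integrals in ρ and in t by change of variables. -/
theorem exists_isRadialInverse (hy0 : y 0 = 0) (hy : ∀ t, HasDerivAt y (y' t) t)
    (hunit : ∀ t, ‖y' t‖ = 1) (hM : 0 ≤ M) (hδ : 0 < δ) (hMδ : M * δ ≤ 1 / 8)
    (hclose : ∀ t ∈ Icc 0 δ, ‖y' t - 1‖ ≤ M * t) {r₀ : ℝ} (hr₀ : r₀ ≤ δ / 2) :
    ∃ T : ℝ → ℝ, IsRadialInverse (fun t => ‖y t‖) T r₀ δ := by
  set f : ℝ → ℝ := fun t => ‖y t‖ with hf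
  have hyc : Continuous y := continuous_iff_continuousAt.mpr fun t => (hy t).continuousAt
  have hfc : Continuous f := hyc.norm
  have hne : ∀ t ∈ Icc 0 δ, 0 < t → y t ≠ 0 := fun t ht ht0 h => by
    have := (bounds_of_deriv hy0 hy hM hMδ hclose ht).1
    rw [h] at this
    simp only [Complex.zero_re] at this
    linarith
  have hder : ∀ t ∈ Icc 0 δ, 0 < t → HasDerivAt f (inner ℝ (y t) (y' t) / ‖y t‖) t :=
    fun t ht ht0 => hasDerivAt_norm_of_deriv hy (hne t ht ht0)
  have hlow : ∀ t ∈ Icc 0 δ, 0 < t → 1 / 2 ≤ inner ℝ (y t) (y' t) / ‖y t‖ := fun t ht ht0 => by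
    obtain ⟨h1, h2, h3⟩ := bounds_of_deriv hy0 hy hM hMδ hclose ht
    have hc := hclose t ht
    have hMt : M * t ≤ 1 / 8 := (mul_le_mul_of_nonneg_left ht.2 hM).trans hMδ
    rw [le_div_iff₀ (norm_pos_iff.mpr (hne t ht ht0))]
    have e : inner ℝ (y t) (y' t) = (y t).re + inner ℝ (y t) (y' t - 1) := by
      rw [inner_sub_right]; simp [Complex.inner]
    have h4 := abs_real_inner_le_norm (y t) (y' t - 1)
    have h5 : ‖y t‖ * ‖y' t - 1‖ ≤ 9 / 8 * t * (1 / 8) := by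
      gcongr; exact hc.trans hMt
    have h6 := (abs_le.mp (h4.trans h5)).1
    rw [e]
    linarith
  have hupp : ∀ t, |inner ℝ (y t) (y' t) / ‖y t‖| ≤ 1 := fun t => by
    rw [abs_div, abs_norm]
    refine div_le_one_of_le₀ ?_ (norm_nonneg _)
    simpa [hunit] using abs_real_inner_le_norm (y t) (y' t)
  have hexp : ∀ s ∈ Icc 0 δ, ∀ t ∈ Icc 0 δ, s ≤ t → 1 / 2 * (t - s) ≤ f t - f s :=
    (convex_Icc 0 δ).mul_sub_le_image_sub_of_le_deriv hfc.continuousOn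
      (fun t ht => by
        rw [interior_Icc] at ht
        exact (hder t (Ioo_subset_Icc_self ht) ht.1).differentiableAt.differentiableWithinAt)
      (fun t ht => by
        rw [interior_Icc] at ht
        rw [(hder t (Ioo_subset_Icc_self ht) ht.1).deriv]
        exact hlow t (Ioo_subset_Icc_self ht) ht.1)
  have hf0 : f 0 = 0 := by simp [hf, hy0]
  have h0m : (0 : ℝ) ∈ Icc 0 δ := ⟨le_rfl, hδ.le⟩
  have hfδ : δ / 2 ≤ f δ := by
    have := hexp 0 h0m δ ⟨hδ.le, le_rfl⟩ hδ.le
    linarith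
  have hinj : ∀ s ∈ Icc 0 δ, ∀ t ∈ Icc 0 δ, |t - s| ≤ 2 * |f t - f s| := fun s hs t ht => by
    rcases le_total s t with h | h
    · have := hexp s hs t ht h
      rw [abs_of_nonneg (sub_nonneg.mpr h)]
      linarith [le_abs_self (f t - f s)]
    · have := hexp t ht s hs h
      rw [abs_of_nonpos (sub_nonpos.mpr h)]
      linarith [neg_abs_le (f t - f s)]
  have hex : ∀ ρ, ∃ t, ρ ∈ Icc 0 r₀ → t ∈ Icc 0 δ ∧ f t = ρ := fun ρ => by
    by_cases h : ρ ∈ Icc 0 r₀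
    · obtain ⟨t, ht, hft⟩ := intermediate_value_Icc hδ.le hfc.continuousOn
        (show ρ ∈ Icc (f 0) (f δ) from ⟨by rw [hf0]; exact h.1, (h.2.trans hr₀).trans hfδ⟩)
      exact ⟨t, fun _ => ⟨ht, hft⟩⟩
    · exact ⟨0, fun h' => absurd h' h⟩
  choose T hT using hex
  have hleft : ∀ t ∈ Icc 0 δ, f t ≤ r₀ → T (f t) = t := fun t ht htr => by
    obtain ⟨h1, h2⟩ := hT (f t) ⟨norm_nonneg _, htr⟩
    have := hinj t ht _ h1
    rw [h2, sub_self, abs_zero, mul_zero] at this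
    linarith [abs_nonpos_iff.mp this]
  have hmono : MonotoneOn T (Icc 0 r₀) := fun ρ hρ σ hσ h => by
    by_contra! hlt
    have h1 := hexp _ (hT σ hσ).1 _ (hT ρ hρ).1 hlt.le
    rw [(hT σ hσ).2, (hT ρ hρ).2] at h1
    linarith
  refine ⟨T, ?_, fun ρ hρ => (hT ρ hρ).1, fun ρ hρ => (hT ρ hρ).2, ?_, hleft, hmono, ?_⟩
  · refine LipschitzOnWith.continuousOn (K := 2) (LipschitzOnWith.of_dist_le_mul fun ρ hρ σ hσ => ?_)
    have := hinj _ (hT σ hσ).1 _ (hT ρ hρ).1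
    rw [(hT σ hσ).2, (hT ρ hρ).2] at this
    simpa [Real.dist_eq] using this
  · intro ρ hρ
    have := hexp 0 h0m _ (hT ρ hρ).1 (hT ρ hρ).1.1
    rw [(hT ρ hρ).2, hf0] at this
    linarith
  · intro r R hr hrR hR g hg hint
    have hr' : r ∈ Icc 0 r₀ := ⟨hr.le, hrR.trans hR⟩
    have hR' : R ∈ Icc 0 r₀ := ⟨hr.le.trans hrR, hR⟩
    have hTr : 0 < T r := by
      refine lt_of_le_of_ne (hT r hr').1.1 fun h => ?_
      have := (hT r hr').2
      rw [← h, hf0] at this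
      linarith
    have hsub : ∀ t ∈ Icc (T r) (T R), t ∈ Icc 0 δ ∧ 0 < t := fun t ht =>
      ⟨⟨(hT r hr').1.1.trans ht.1, ht.2.trans (hT R hR').1.2⟩, hTr.trans_le ht.1⟩
    have himg : f '' Icc (T r) (T R) = Icc r R := by
      ext ρ
      constructor
      · rintro ⟨t, ht, rfl⟩
        have h1 := hexp _ (hT r hr').1 t (hsub t ht).1 ht.1
        have h2 := hexp t (hsub t ht).1 _ (hT R hR').1 ht.2
        rw [(hT r hr').2] at h1
        rw [(hT R hR').2] at h2
        exact ⟨by linarith [ht.1], by linarith [ht.2]⟩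
      · intro hρ
        have hρ' : ρ ∈ Icc 0 r₀ := ⟨hr.le.trans hρ.1, hρ.2.trans hR⟩
        exact ⟨T ρ, ⟨hmono hr' hρ' hρ.1, hmono hρ' hR' hρ.2⟩, (hT ρ hρ').2⟩
    have hinjOn : InjOn f (Icc (T r) (T R)) := fun s hs t ht hst => by
      have := hinj s (hsub s hs).1 t (hsub t ht).1
      rw [hst, sub_self, abs_zero, mul_zero] at this
      linarith [abs_nonpos_iff.mp this]
    rw [← himg, integral_image_eq_integral_abs_deriv_smul measurableSet_Icc
      (fun t ht => (hder t (hsub t ht).1 (hsub t ht).2).hasDerivWithinAt) hinjOn]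
    refine integral_mono_of_nonneg (Filter.Eventually.of_forall fun t => ?_) hint
      (Filter.Eventually.of_forall fun t => ?_)
    · exact mul_nonneg (abs_nonneg _) (hg _)
    · exact mul_le_of_le_one_left (hg _) (hupp t)

end NearlyStraight

/-! ### Geometry near the boundary -/

theorem exists_lipschitz_of_periodic {f : ℝ → ℂ} {L : ℝ} (hL : 0 < L) (hf : ContDiff ℝ 1 f)
    (hp : Function.Periodic f L) : ∃ M : ℝ, 0 < M ∧ (∀ t, ‖deriv f t‖ ≤ M) ∧
      ∀ s t, ‖f t - f s‖ ≤ M * |t - s| := by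
  have hd : Continuous (deriv f) := hf.continuous_deriv le_rfl
  have hdp : Function.Periodic (deriv f) L := fun t => by
    have : (fun x => f (x + L)) = f := funext hp
    rw [← deriv_comp_add_const, this]
  obtain ⟨M, hM⟩ := (isCompact_Icc (a := 0) (b := L)).exists_bound_of_continuousOn hd.continuousOn
  have hb : ∀ x, ‖deriv f x‖ ≤ max M 1 := fun x => by
    obtain ⟨z, hz, hz'⟩ := hdp.exists_mem_Ico₀ hL x
    rw [hz']
    exact (hM z (Ico_subset_Icc_self hz)).trans (le_max_left _ _)
  refine ⟨max M 1, by positivity, hb, fun s t => ?_⟩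
  have := (convex_univ (𝕜 := ℝ) (E := ℝ)).norm_image_sub_le_of_norm_deriv_le (f := f)
    (C := max M 1) (x := s) (y := t) (fun x _ => hf.differentiable one_ne_zero x)
    (fun x _ => hb x) (mem_univ s) (mem_univ t)
  simpa using this

/-- Off its frontier the space splits into two disjoint open sets, the interior of s and the
complement of its closure. -/
theorem subset_of_isPreconnected_of_disjoint_frontier {X : Type*} [TopologicalSpace X]
    {s t : Set X} (ht : IsPreconnected t) (hne : (t ∩ s).Nonempty) (hd : ∀ x ∈ t, x ∉ frontier s) :
    t ⊆ s := by
  refine (ht.subset_left_of_subset_union isOpen_interior isClosed_closure.isOpen_compl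
    (disjoint_compl_right.mono_left (interior_subset.trans subset_closure)) (fun x hx => ?_) ?_).trans
    interior_subset
  · by_contra h
    rw [mem_union, not_or, mem_compl_iff, not_not] at h
    exact hd x hx ⟨h.2, h.1⟩
  · obtain ⟨x, hxt, hxs⟩ := hne
    refine ⟨x, hxt, ?_⟩
    by_contra h
    exact hd x hxt ⟨subset_closure hxs, h⟩

namespace GLTangential.IsC3Domain

variable {α : ℝ≥0} {Ω : Set ℂ} {L : ℝ} {c : ℝ → ℂ}

theorem eq_add_of_curve_eq (h : IsC3Domain α Ω L c) {s t : ℝ} (hst : c s = c t) :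
    ∃ k : ℤ, s = t + k * L := by
  have key : ∀ x, c (toIcoMod h.length_pos 0 x) = c x := fun x => by
    rw [← self_sub_toIcoDiv_zsmul, h.periodic.sub_zsmul_eq]
  have h1 := h.injOn (toIcoMod_mem_Ico' h.length_pos s) (toIcoMod_mem_Ico' h.length_pos t)
    (by rw [key, key, hst])
  rw [← self_sub_toIcoDiv_zsmul, ← self_sub_toIcoDiv_zsmul, zsmul_eq_mul, zsmul_eq_mul] at h1
  exact ⟨toIcoDiv h.length_pos 0 s - toIcoDiv h.length_pos 0 t, by push_cast; linarith⟩

theorem continuous_curve (h : IsC3Domain α Ω L c) : Continuous c := h.regular.1.continuous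

theorem curve_add_int_mul (h : IsC3Domain α Ω L c) (t : ℝ) (k : ℤ) : c (t + k * L) = c t :=
  h.periodic.int_mul k t

/-- Compactness and injectivity of c modulo its period: points whose parameters differ by at least δ
modulo L stay a positive distance apart. Small discs about a point of Γ therefore see a single piece
of Γ. -/
theorem exists_separation (h : IsC3Domain α Ω L c) {δ : ℝ} (hδ : 0 < δ) :
    ∃ r₁ > 0, ∀ τ t, ‖c t - c τ‖ < r₁ → ∃ k : ℤ, |t - τ - k * L| < δ := by
  have hL := h.length_pos
  set F : ℝ × ℝ → ℝ := fun p => ‖c (p.1 + p.2) - c p.1‖ with hF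
  have hc := h.continuous_curve
  have hFc : Continuous F := by fun_prop
  -- Base parameter and offset. The set is empty when 2δ > L, which is why that case is treated
  -- separately in the minimization.
  set Q : Set (ℝ × ℝ) := Icc 0 L ×ˢ Icc δ (L - δ) with hQ
  have hQc : IsCompact Q := isCompact_Icc.prod isCompact_Icc
  have hpos : ∀ p ∈ Q, 0 < F p := fun p hp => by
    refine norm_pos_iff.mpr (sub_ne_zero.mpr fun he => ?_)
    obtain ⟨k, hk⟩ := h.eq_add_of_curve_eq he
    have h1 := hp.2.1
    have h2 := hp.2.2
    have h3 : p.2 = k * L := by linarith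
    have h4 : (0 : ℝ) < k := by
      by_contra! hk0
      nlinarith
    have h5 : (k : ℝ) < 1 := by
      by_contra! hk1
      nlinarith
    have h6 : (0 : ℤ) < k := by exact_mod_cast h4
    have h7 : k < (1 : ℤ) := by exact_mod_cast h5
    omega
  obtain ⟨r₁, hr₁, hmin⟩ : ∃ r₁ > 0, ∀ p ∈ Q, r₁ ≤ F p := by
    rcases Q.eq_empty_or_nonempty with he | hne
    · exact ⟨1, one_pos, fun p hp => by rw [he] at hp; exact hp.elim⟩
    · obtain ⟨p, hp, hpm⟩ := hQc.exists_isMinOn hne hFc.continuousOn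
      exact ⟨F p, hpos p hp, fun q hq => hpm hq⟩
  refine ⟨r₁, hr₁, fun τ t hlt => ?_⟩
  set m := toIcoDiv hL 0 τ
  set n := toIcoDiv hL 0 (t - τ)
  have h1 : τ - m • L ∈ Ico 0 L := toIcoMod_mem_Ico' hL τ
  have h2 : t - τ - n • L ∈ Ico 0 L := toIcoMod_mem_Ico' hL (t - τ)
  rw [zsmul_eq_mul] at h1 h2
  by_cases hs : t - τ - n * L < δ
  · exact ⟨n, by rw [abs_of_nonneg h2.1]; exact hs⟩
  by_cases hs' : L - δ < t - τ - n * L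
  · refine ⟨n + 1, ?_⟩
    push_cast
    rw [abs_lt]
    constructor <;> linarith [h2.2]
  · exfalso
    have h3 := hmin (τ - m * L, t - τ - n * L) ⟨⟨h1.1, h1.2.le⟩, not_lt.mp hs, not_lt.mp hs'⟩
    have e1 : c (τ - m * L) = c τ := h.periodic.sub_int_mul_eq m
    have e2 : c (τ - m * L + (t - τ - n * L)) = c t := by
      rw [show τ - m * L + (t - τ - n * L) = t - ((m + n : ℤ) : ℝ) * L by push_cast; ring]
      exact h.periodic.sub_int_mul_eq (m + n)
    simp only [hF, e1, e2] at h3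
    linarith

end GLTangential.IsC3Domain

theorem exists_int_of_circleMap_eq {x₀ : ℂ} {ρ θ θ' : ℝ} (hρ : 0 < ρ)
    (h : circleMap x₀ ρ θ = circleMap x₀ ρ θ') : ∃ m : ℤ, θ = θ' + m * (2 * Real.pi) := by
  unfold circleMap at h
  exact exists_int_of_exp_eq
    (mul_left_cancel₀ (Complex.ofReal_ne_zero.mpr hρ.ne') (add_left_cancel h))

theorem not_int_mul_two_pi {x : ℝ} (h0 : 0 < x) (h1 : x < 2 * Real.pi) (m : ℤ) :
    x ≠ m * (2 * Real.pi) := by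
  rintro rfl
  have hpi := Real.two_pi_pos
  have h2 : (0 : ℝ) < m := pos_of_mul_pos_left h0 hpi.le
  have h3 : (m : ℝ) < 1 := by
    by_contra! h
    nlinarith
  have h4 : (0 : ℤ) < m := by exact_mod_cast h2
  have h5 : m < (1 : ℤ) := by exact_mod_cast h3
  omega

/-- Polar description of `Ω` near the boundary point `c τ`: the circle of radius `ρ ≤ r₀` about
`c τ` meets `Γ` at `c (τ + T₁ ρ)` and `c (τ - T₂ ρ)`, and `Ω` contains the arc from the first to
the second. -/
structure IsBoundaryChart (Ω : Set ℂ) (c : ℝ → ℂ) (τ β r₀ δ M : ℝ) (T₁ T₂ a b : ℝ → ℝ) :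
    Prop where
  radial₁ : IsRadialInverse (fun t => ‖c (τ + t) - c τ‖) T₁ r₀ δ
  radial₂ : IsRadialInverse (fun t => ‖c (τ - t) - c τ‖) T₂ r₀ δ
  continuousOn_left : ContinuousOn a (Ioc 0 r₀)
  continuousOn_right : ContinuousOn b (Ioc 0 r₀)
  curve_left : ∀ ρ ∈ Ioc 0 r₀, c (τ + T₁ ρ) = polarPoint (c τ) β (ρ, a ρ)
  curve_right : ∀ ρ ∈ Ioc 0 r₀, c (τ - T₂ ρ) = polarPoint (c τ) β (ρ, b ρ)
  abs_left_le : ∀ ρ ∈ Ioc 0 r₀, |a ρ + Real.pi / 2| ≤ 4 * M * ρ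
  abs_right_le : ∀ ρ ∈ Ioc 0 r₀, |b ρ - Real.pi / 2| ≤ 4 * M * ρ
  arc_subset : ∀ ρ ∈ Ioc 0 r₀, ∀ θ ∈ Ioo (a ρ) (b ρ), polarPoint (c τ) β (ρ, θ) ∈ Ω

namespace GLTangential.IsC3Domain

variable {α : ℝ≥0} {Ω : Set ℂ} {L : ℝ} {c : ℝ → ℂ}

/-- Divided by the tangent at c τ, the two branches of Γ are nearly straight, so each small circle
crosses each of them once, and by separation it meets no other part of Γ. The open arc between the
crossings then avoids Γ, and connectedness together with the inward normal places it in Ω. The radii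
and the bound M are uniform in τ. -/
theorem exists_isBoundaryChart (h : IsC3Domain α Ω L c) : ∃ r₀ δ M : ℝ, 0 < r₀ ∧ 0 < δ ∧ 0 < M ∧
    4 * δ < L ∧ r₀ ≤ δ / 2 ∧ M * δ ≤ 1 / 8 ∧
    (∀ τ t, ‖c t - c τ‖ ≤ r₀ → ∃ k : ℤ, |t - τ - k * L| < δ) ∧
    ∀ τ, ∃ β : ℝ, ∃ T₁ T₂ a b : ℝ → ℝ, IsBoundaryChart Ω c τ β r₀ δ M T₁ T₂ a b := by
  have hL := h.length_pos
  have hpi := Real.pi_pos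
  have hpi3 := Real.pi_gt_three
  have hcd : Differentiable ℝ c := h.regular.1.differentiable (by norm_num)
  have hc1 : ContDiff ℝ 1 (deriv c) := by
    have : ContDiff ℝ (1 + 1) c := h.regular.1.of_le (by norm_num)
    exact (contDiff_succ_iff_deriv.mp this).2.2
  have hcp : Function.Periodic (deriv c) L := fun t => by
    have : (fun x => c (x + L)) = c := funext h.periodic
    rw [← deriv_comp_add_const, this]
  obtain ⟨M, hM, -, hlip⟩ := exists_lipschitz_of_periodic hL hc1 hcp
  -- The first bound keeps the tangent nearly constant; the second gives 4δ < L.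
  set δ := min (1 / (8 * M)) (L / 5) with hδdef
  have hδ : 0 < δ := lt_min (by positivity) (by positivity)
  have hMδ : M * δ ≤ 1 / 8 := by
    have := mul_le_mul_of_nonneg_left (min_le_left (1 / (8 * M)) (L / 5)) hM.le
    refine this.trans (le_of_eq ?_)
    field_simp
  obtain ⟨r₁, hr₁, hsep⟩ := h.exists_separation hδ
  set r₀ := min (δ / 2) (r₁ / 2) with hr₀def
  have hr₀ : 0 < r₀ := lt_min (by positivity) (by positivity)
  have hr₀δ : r₀ ≤ δ / 2 := min_le_left _ _
  have hr₀1 : r₀ < r₁ := (min_le_right _ _).trans_lt (by linarith)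
  have hsep' : ∀ τ t, ‖c t - c τ‖ ≤ r₀ → ∃ k : ℤ, |t - τ - k * L| < δ := fun τ t ht =>
    hsep τ t (ht.trans_lt hr₀1)
  refine ⟨r₀, δ, M, hr₀, hδ, hM, ?_, hr₀δ, hMδ, hsep', fun τ => ?_⟩
  · have := min_le_right (1 / (8 * M)) (L / 5)
    linarith
  set v := deriv c τ with hv
  have hv1 : ‖v‖ = 1 := h.unit_speed τ
  have hv0 : v ≠ 0 := norm_ne_zero_iff.mp (by rw [hv1]; exact one_ne_zero)
  have hvexp : v = Complex.exp (v.arg * Complex.I) := by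
    have := Complex.norm_mul_exp_arg_mul_I v
    rw [hv1, Complex.ofReal_one, one_mul] at this
    exact this.symm
  set y₁ : ℝ → ℂ := fun t => (c (τ + t) - c τ) / v with hy₁
  -- The backward branch, with a sign so that its tangent at 0 is also 1.
  set y₂ : ℝ → ℂ := fun t => -((c (τ - t) - c τ) / v) with hy₂
  have hd₁ : ∀ t, HasDerivAt y₁ (deriv c (τ + t) / v) t := fun t => by
    have h1 := (hcd (τ + t)).hasDerivAt.comp_const_add τ t
    exact (h1.sub_const _).div_const _
  have hd₂ : ∀ t, HasDerivAt y₂ (deriv c (τ - t) / v) t := fun t => by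
    have h1 := (hcd (τ - t)).hasDerivAt.comp_const_sub τ t
    convert! ((h1.sub_const _).div_const v).neg using 1
    ring
  have hu₁ : ∀ t, ‖deriv c (τ + t) / v‖ = 1 := fun t => by
    rw [norm_div, h.unit_speed, hv1, div_one]
  have hu₂ : ∀ t, ‖deriv c (τ - t) / v‖ = 1 := fun t => by
    rw [norm_div, h.unit_speed, hv1, div_one]
  have hc₁ : ∀ t ∈ Icc 0 δ, ‖deriv c (τ + t) / v - 1‖ ≤ M * t := fun t ht => by
    rw [div_sub_one hv0, norm_div, hv1, div_one]
    have := hlip τ (τ + t)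
    rwa [add_sub_cancel_left, abs_of_nonneg ht.1] at this
  have hc₂ : ∀ t ∈ Icc 0 δ, ‖deriv c (τ - t) / v - 1‖ ≤ M * t := fun t ht => by
    rw [div_sub_one hv0, norm_div, hv1, div_one]
    have := hlip τ (τ - t)
    rwa [sub_sub_cancel_left, abs_neg, abs_of_nonneg ht.1] at this
  have h0₁ : y₁ 0 = 0 := by simp [hy₁]
  have h0₂ : y₂ 0 = 0 := by simp [hy₂]
  obtain ⟨T₁, hT₁⟩ := exists_isRadialInverse h0₁ hd₁ hu₁ hM.le hδ hMδ hc₁ hr₀δ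
  obtain ⟨T₂, hT₂⟩ := exists_isRadialInverse h0₂ hd₂ hu₂ hM.le hδ hMδ hc₂ hr₀δ
  have hIoc : ∀ {ρ}, ρ ∈ Ioc 0 r₀ → ρ ∈ Icc 0 r₀ := fun hρ => Ioc_subset_Icc_self hρ
  have hpos : ∀ {y : ℝ → ℂ} {T : ℝ → ℝ}, y 0 = 0 → IsRadialInverse (fun t => ‖y t‖) T r₀ δ →
      ∀ ρ ∈ Ioc 0 r₀, 0 < T ρ := fun {y T} h0 hT ρ hρ => by
    refine lt_of_le_of_ne (hT.mem ρ (hIoc hρ)).1 fun he => ?_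
    have := hT.right_inv ρ (hIoc hρ)
    simp only [← he, h0, norm_zero] at this
    exact hρ.1.ne this
  have harg : ∀ {y y' : ℝ → ℂ} {T : ℝ → ℝ}, y 0 = 0 → (∀ t, HasDerivAt y (y' t) t) →
      (∀ t ∈ Icc 0 δ, ‖y' t - 1‖ ≤ M * t) → IsRadialInverse (fun t => ‖y t‖) T r₀ δ →
      (∀ ρ ∈ Ioc 0 r₀, |(y (T ρ)).arg| ≤ 4 * M * ρ) ∧
      ContinuousOn (fun ρ => (y (T ρ)).arg) (Ioc 0 r₀) := fun {y y' T} h0 hd hc hT => by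
    have hre : ∀ ρ ∈ Ioc 0 r₀, 0 < (y (T ρ)).re := fun ρ hρ => by
      have := (bounds_of_deriv h0 hd hM.le hMδ hc (hT.mem ρ (hIoc hρ))).1
      linarith [hpos h0 hT ρ hρ]
    refine ⟨fun ρ hρ => ?_, fun ρ hρ => ?_⟩
    · have h1 := abs_arg_le_of_deriv h0 hd hM.le hMδ hc (hT.mem ρ (hIoc hρ)) (hpos h0 hT ρ hρ)
      have h2 := hT.le_two_mul ρ (hIoc hρ)
      nlinarith
    · have h1 : ContinuousWithinAt T (Ioc 0 r₀) ρ :=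
        (hT.continuousOn.mono Ioc_subset_Icc_self) ρ hρ
      have h2 : ContinuousAt (fun t => (y t).arg) (T ρ) :=
        (Complex.continuousAt_arg (Or.inl (hre ρ hρ))).comp (hd _).continuousAt
      exact h2.comp_continuousWithinAt h1
  obtain ⟨ha, hac⟩ := harg h0₁ hd₁ hc₁ hT₁
  obtain ⟨hb, hbc⟩ := harg h0₂ hd₂ hc₂ hT₂
  -- The reference angle of the inward normal iv: θ = 0 points into Ω and the branches of Γ leave
  -- near θ = ∓π/2.
  set β := v.arg + Real.pi / 2 with hβ
  set a : ℝ → ℝ := fun ρ => -(Real.pi / 2) + (y₁ (T₁ ρ)).arg with hadef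
  set b : ℝ → ℝ := fun ρ => Real.pi / 2 + (y₂ (T₂ ρ)).arg with hbdef
  have hpolar : ∀ {z : ℂ} {ρ : ℝ}, ‖z‖ = ρ → v * z = circleMap 0 ρ (z.arg + v.arg) := by
    intro z ρ hz
    rw [circleMap, zero_add, Complex.ofReal_add, add_mul, Complex.exp_add, ← hvexp,
      ← mul_assoc, ← hz, Complex.norm_mul_exp_arg_mul_I, mul_comm]
  have hleft : ∀ ρ ∈ Ioc 0 r₀, c (τ + T₁ ρ) = polarPoint (c τ) β (ρ, a ρ) := fun ρ hρ => by
    have h1 := hpolar (hT₁.right_inv ρ (hIoc hρ))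
    have h3 := polarPoint_sub (c τ) β (ρ, a ρ)
    simp only at h3
    have h2 : v * y₁ (T₁ ρ) = c (τ + T₁ ρ) - c τ := by
      simp only [hy₁]; rw [mul_div_cancel₀ _ hv0]
    rw [h2] at h1
    rw [show (y₁ (T₁ ρ)).arg + v.arg = a ρ + β by simp only [hadef, hβ]; ring] at h1
    linear_combination h1 - h3
  have hright : ∀ ρ ∈ Ioc 0 r₀, c (τ - T₂ ρ) = polarPoint (c τ) β (ρ, b ρ) := fun ρ hρ => by
    have h1 := hpolar (hT₂.right_inv ρ (hIoc hρ))
    have h2 : v * y₂ (T₂ ρ) = -(c (τ - T₂ ρ) - c τ) := by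
      simp only [hy₂]; rw [mul_neg, mul_div_cancel₀ _ hv0]
    have h3 : circleMap 0 ρ (b ρ + β) = -circleMap 0 ρ ((y₂ (T₂ ρ)).arg + v.arg) := by
      rw [show b ρ + β = (y₂ (T₂ ρ)).arg + v.arg + Real.pi by simp only [hbdef, hβ]; ring]
      simp only [circleMap, zero_add]
      rw [Complex.ofReal_add, add_mul, Complex.exp_add, Complex.exp_pi_mul_I]
      ring
    have h4 := polarPoint_sub (c τ) β (ρ, b ρ)
    simp only at h4
    rw [h3, ← h1, h2] at h4
    linear_combination -h4
  have hMρ : ∀ ρ ∈ Ioc 0 r₀, 4 * M * ρ ≤ 1 / 4 := fun ρ hρ => by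
    have : M * ρ ≤ M * (δ / 2) := mul_le_mul_of_nonneg_left (hρ.2.trans hr₀δ) hM.le
    linarith
  have hab : ∀ ρ ∈ Ioc 0 r₀, a ρ < 0 ∧ 0 < b ρ ∧ b ρ - a ρ < 2 * Real.pi := fun ρ hρ => by
    have h1 := abs_le.mp ((ha ρ hρ).trans (hMρ ρ hρ))
    have h2 := abs_le.mp ((hb ρ hρ).trans (hMρ ρ hρ))
    simp only [hadef, hbdef]
    exact ⟨by linarith, by linarith, by linarith⟩
  -- A point of Γ on the open arc has a parameter within δ of τ modulo L, so the radial inverse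
  -- makes it one of the two endpoints of the arc. Its angle differs from theirs by an amount
  -- strictly between 0 and 2π, a contradiction.
  have hoff : ∀ ρ ∈ Ioc 0 r₀, ∀ θ ∈ Ioo (a ρ) (b ρ),
      polarPoint (c τ) β (ρ, θ) ∉ frontier Ω := fun ρ hρ θ hθ hfr => by
    rw [← h.range_eq] at hfr
    obtain ⟨t, ht⟩ := hfr
    have hnorm : ‖c t - c τ‖ = ρ := by
      rw [ht]; exact norm_polarPoint_sub (c τ) β (p := (ρ, θ)) hρ.1.le
    obtain ⟨k, hk⟩ := hsep' τ t (hnorm.le.trans hρ.2)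
    set s := t - τ - k * L with hs
    have hcs : c (τ + s) = c t := by
      rw [hs, show τ + (t - τ - k * L) = t - k * L by ring]
      exact h.periodic.sub_int_mul_eq k
    obtain ⟨-, -, hba⟩ := hab ρ hρ
    rcases le_total 0 s with hs0 | hs0
    · have h1 := hT₁.left_inv s ⟨hs0, (abs_lt.mp hk).2.le⟩
      have h2 : ‖y₁ s‖ = ρ := by simp only [hy₁]; rw [hcs, norm_div, hv1, div_one, hnorm]
      simp only [h2] at h1
      have h3 := hleft ρ hρ
      rw [h1 hρ.2, hcs, ht] at h3
      obtain ⟨m, hm⟩ := exists_int_of_circleMap_eq hρ.1 h3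
      exact not_int_mul_two_pi (x := θ - a ρ) (by linarith [hθ.1]) (by linarith [hθ.2]) m
        (by linarith)
    · have h1 := hT₂.left_inv (-s) ⟨by linarith, by linarith [(abs_lt.mp hk).1]⟩
      have h2 : ‖y₂ (-s)‖ = ρ := by
        simp only [hy₂]
        rw [sub_neg_eq_add, hcs, norm_neg, norm_div, hv1, div_one, hnorm]
      simp only [h2] at h1
      have h3 := hright ρ hρ
      rw [h1 hρ.2, sub_neg_eq_add, hcs, ht] at h3
      obtain ⟨m, hm⟩ := exists_int_of_circleMap_eq hρ.1 h3.symm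
      exact not_int_mul_two_pi (x := b ρ - θ) (by linarith [hθ.2]) (by linarith [hθ.1]) m
        (by linarith)
  have hseg : ∀ ρ ∈ Ioc 0 r₀, polarPoint (c τ) β (ρ, 0) ∈ Ω := by
    have hc : Continuous fun ρ : ℝ => polarPoint (c τ) β (ρ, 0) :=
      (continuous_polarPoint _ _).comp (by fun_prop)
    have h1 : IsPreconnected ((fun ρ : ℝ => polarPoint (c τ) β (ρ, 0)) '' Ioc 0 r₀) :=
      isPreconnected_Ioc.image _ hc.continuousOn
    obtain ⟨η, hη, hin⟩ := h.inside τ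
    set s := min (η / 2) r₀ with hs
    have hs0 : 0 < s := lt_min (by positivity) hr₀
    have h2 : polarPoint (c τ) β (s, 0) ∈ Ω := by
      have := hin s ⟨hs0, (min_le_left _ _).trans_lt (by linarith)⟩
      convert! this using 1
      simp only [polarPoint, circleMap, zero_add]
      rw [hβ, Complex.ofReal_add, add_mul, Complex.exp_add, ← hvexp]
      rw [show ((Real.pi / 2 : ℝ) : ℂ) * Complex.I = Real.pi / 2 * Complex.I by push_cast; ring,
        Complex.exp_pi_div_two_mul_I]
      ring
    have h3 := subset_of_isPreconnected_of_disjoint_frontier (s := Ω) h1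
      ⟨_, mem_image_of_mem _ ⟨hs0, min_le_right _ _⟩, h2⟩ (by
        rintro _ ⟨ρ, hρ, rfl⟩
        exact hoff ρ hρ 0 ⟨(hab ρ hρ).1, (hab ρ hρ).2.1⟩)
    exact fun ρ hρ => h3 (mem_image_of_mem _ hρ)
  have hn₁ : (fun t => ‖c (τ + t) - c τ‖) = fun t => ‖y₁ t‖ := by
    ext t; simp only [hy₁]; rw [norm_div, hv1, div_one]
  have hn₂ : (fun t => ‖c (τ - t) - c τ‖) = fun t => ‖y₂ t‖ := by
    ext t; simp only [hy₂]; rw [norm_neg, norm_div, hv1, div_one]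
  refine ⟨β, T₁, T₂, a, b, ?_⟩
  refine
    { radial₁ := hn₁ ▸ hT₁
      radial₂ := hn₂ ▸ hT₂
      continuousOn_left := continuousOn_const.add hac
      continuousOn_right := continuousOn_const.add hbc
      curve_left := hleft
      curve_right := hright
      abs_left_le := fun ρ hρ => by
        simp only [hadef]; rw [neg_add_cancel_comm]; exact ha ρ hρ
      abs_right_le := fun ρ hρ => by
        simp only [hbdef]; rw [add_sub_cancel_left]; exact hb ρ hρ
      arc_subset := fun ρ hρ => ?_ }
  have hc : Continuous fun θ : ℝ => polarPoint (c τ) β (ρ, θ) :=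
    (continuous_polarPoint _ _).comp (by fun_prop)
  have h1 : IsPreconnected ((fun θ : ℝ => polarPoint (c τ) β (ρ, θ)) '' Ioo (a ρ) (b ρ)) :=
    isPreconnected_Ioo.image _ hc.continuousOn
  have h3 := subset_of_isPreconnected_of_disjoint_frontier (s := Ω) h1
    ⟨_, mem_image_of_mem _ ⟨(hab ρ hρ).1, (hab ρ hρ).2.1⟩, hseg ρ hρ⟩ (by
      rintro _ ⟨θ, hθ, rfl⟩
      exact hoff ρ hρ θ hθ)
  exact fun θ hθ => h3 (mem_image_of_mem _ hθ)

end GLTangential.IsC3Domain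

/-! ### Boundary lower bound -/

theorem abs_phase_sub_le {w : ℝ → ℂ} {γ : ℝ → ℝ} {N : ℝ} (hw : ContDiff ℝ 1 w)
    (hγ : Continuous γ) (hγe : ∀ t, w t = Complex.exp (γ t * Complex.I))
    (hN : ∀ t, ‖deriv w t‖ ≤ N) (s t : ℝ) : |γ t - γ s| ≤ N * |t - s| := by
  have hc : Continuous fun t => (γ t : ℂ) * Complex.I := by fun_prop
  have hd : ∀ x, HasDerivAt (fun t => (γ t : ℂ) * Complex.I) (deriv w x / w x) x := fun x =>
    hasDerivAt_of_exp_eq hc.continuousAt (hw.differentiable one_ne_zero x).hasDerivAt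
      (Filter.Eventually.of_forall fun y => (hγe y).symm)
  have hb : ∀ x, ‖deriv w x / w x‖ ≤ N := fun x => by
    rw [norm_div, hγe x, Complex.norm_exp_ofReal_mul_I, div_one]; exact hN x
  have := (convex_univ (𝕜 := ℝ) (E := ℝ)).norm_image_sub_le_of_norm_hasDerivWithin_le
    (f := fun t => (γ t : ℂ) * Complex.I) (f' := fun x => deriv w x / w x)
    (C := N) (x := s) (y := t) (fun x _ => (hd x).hasDerivWithinAt)
    (fun x _ => hb x) (mem_univ s) (mem_univ t)
  rw [← sub_mul, norm_mul, Complex.norm_I, mul_one, ← Complex.ofReal_sub, Complex.norm_real] at this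
  exact this

theorem GLTangential.IsBoundaryData.exists_lipschitz_phase {α : ℝ≥0} {Ω : Set ℂ} {L : ℝ}
    {c : ℝ → ℂ} {g : ℂ → ℂ} (hg : GLTangential.IsBoundaryData α Ω c g)
    (h : GLTangential.IsC3Domain α Ω L c) :
    ∃ (γ : ℝ → ℝ) (N : ℝ), 0 < N ∧ Continuous γ ∧
      (∀ t, g (c t) = Complex.exp (γ t * Complex.I)) ∧ ∀ s t, |γ t - γ s| ≤ N * |t - s| := by
  have hg1 : ∀ t, ‖g (c t)‖ = 1 := fun t => hg.unit _ (h.range_eq ▸ mem_range_self t)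
  have hgs : ContDiff ℝ 1 fun t => g (c t) := hg.regular.1.of_le (by norm_num)
  obtain ⟨N, hN, hNd, -⟩ := exists_lipschitz_of_periodic h.length_pos hgs (fun t => by
    simp only [h.periodic t])
  obtain ⟨γ, hγ, hγe⟩ := exists_continuous_phase hgs.continuous fun t he => by
    have := hg1 t
    rw [he, norm_zero] at this
    exact zero_ne_one this
  have hγe' : ∀ t, g (c t) = Complex.exp (γ t * Complex.I) := fun t => by
    rw [hγe t, hg1, Complex.ofReal_one, one_mul]
  exact ⟨γ, N, hN, hγ, hγe', abs_phase_sub_le hgs hγ hγe' hNd⟩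

/-- Turns the anchoring condition into a condition on the phase of u relative to that of g. -/
theorem perp_eq_norm_mul_sin {g u : ℂ → ℂ} {x : ℂ} {θ η : ℝ}
    (hu : u x = ‖u x‖ * Complex.exp (θ * Complex.I)) (hg : g x = Complex.exp (η * Complex.I)) :
    GLTangential.perp g u x = ‖u x‖ * Real.sin (θ - η) := by
  have h1 : (u x).re = ‖u x‖ * Real.cos θ := by
    conv_lhs => rw [hu]
    rw [Complex.re_ofReal_mul, Complex.exp_ofReal_mul_I_re]
  have h2 : (u x).im = ‖u x‖ * Real.sin θ := by
    conv_lhs => rw [hu]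
    rw [Complex.im_ofReal_mul, Complex.exp_ofReal_mul_I_im]
  unfold GLTangential.perp
  rw [Complex.inner, hg, Real.sin_sub]
  simp only [Complex.mul_re, Complex.mul_im, Complex.conj_re, Complex.conj_im, Complex.I_re,
    Complex.I_im, Complex.exp_ofReal_mul_I_re, Complex.exp_ofReal_mul_I_im, h1, h2]
  ring

theorem abs_sin_sub_pi_mul (x : ℝ) (m : ℤ) : |Real.sin (x - Real.pi * m)| = |Real.sin x| := by
  rw [mul_comm, Real.sin_sub_int_mul_pi, abs_mul]
  simp

/-- Jordan's inequality at the multiple πm. The factor 2P arises from |u| ≥ 1/2 when P bounds |⟨u,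
g^⊥⟩|. -/
theorem abs_le_of_abs_le_pi_div_two {x P : ℝ} (m : ℤ)
    (hm : |x - Real.pi * m| ≤ Real.pi / 2) (hP : |Real.sin x| ≤ 2 * P) :
    |x - Real.pi * m| ≤ Real.pi * P := by
  have hpi := Real.pi_pos
  have h := Real.mul_abs_le_abs_sin hm
  rw [abs_sin_sub_pi_mul] at h
  have h1 : |x - Real.pi * m| = Real.pi / 2 * (2 / Real.pi * |x - Real.pi * m|) := by field_simp
  rw [h1]
  calc _ ≤ Real.pi / 2 * (2 * P) := mul_le_mul_of_nonneg_left (h.trans hP) (by positivity)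
    _ = _ := by ring

theorem exists_int_abs_sub_pi_mul_le (x : ℝ) : ∃ m : ℤ, |x - Real.pi * m| ≤ Real.pi / 2 := by
  have hpi := Real.pi_pos
  refine ⟨round (x / Real.pi), ?_⟩
  have h := abs_sub_round (x / Real.pi)
  have h1 : x - Real.pi * round (x / Real.pi) = Real.pi * (x / Real.pi - round (x / Real.pi)) := by
    field_simp
  rw [h1, abs_mul, abs_of_pos hpi]
  nlinarith

/-- The tolerance π/3 of the index and twice the deviation π/4 add up to less than a full turn. -/
theorem eq_zero_of_phase_gap {x y : ℝ} {k : ℤ} (hx : |x| ≤ Real.pi / 3) (hy : |y| ≤ Real.pi / 4)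
    (h : x = 2 * y + 2 * Real.pi * k) : k = 0 := by
  have hpi := Real.pi_pos
  rw [abs_le] at hx hy
  have h1 : |(k : ℝ)| < 1 := by
    rw [abs_lt]
    constructor <;> nlinarith [hx.1, hx.2, hy.1, hy.2]
  exact Int.abs_lt_one_iff.mp (by exact_mod_cast h1)

/-- The boundary index at radius `r` in terms of a boundary chart at `c τ`. -/
def IsChartIndex (c : ℝ → ℂ) (g u : ℂ → ℂ) (x₀ : ℂ) (r : ℝ) (t₀ t₁ : ℝ) (D : ℤ) : Prop :=
  ∃ a b : ℝ, a < b ∧ b < a + 2 * Real.pi ∧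
    circleMap x₀ r b = c t₀ ∧ circleMap x₀ r a = c t₁ ∧
    ∃ ψ χ γ : ℝ → ℝ,
      GLTangential.IsPhaseOn (fun θ => GLTangential.direction u (circleMap x₀ r θ) ^ 2) ψ a b ∧
      GLTangential.IsPhaseOn (fun t => g (c t)) γ t₀ t₁ ∧
      (∀ t ∈ Icc t₀ t₁, |χ t - 2 * γ t| ≤ Real.pi / 3) ∧
      Complex.exp (χ t₀ * Complex.I) = GLTangential.direction u (c t₀) ^ 2 ∧
      Complex.exp (χ t₁ * Complex.I) = GLTangential.direction u (c t₁) ^ 2 ∧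
      (ψ b - ψ a) + (χ t₁ - χ t₀) = 2 * Real.pi * D

theorem exp_sq_phase (x : ℝ) :
    Complex.exp (x * Complex.I) ^ 2 = Complex.exp ((2 * x : ℝ) * Complex.I) := by
  rw [← Complex.exp_nat_mul]
  congr 1
  push_cast
  ring

/-- Comparison of the extension phase `χ` with the phase of `u` at an endpoint of the arc. -/
theorem chi_sub_two_gamma_eq {χ γ' φ γ : ℝ} {m : ℤ}
    (hχ : Complex.exp (χ * Complex.I) = Complex.exp ((2 * φ : ℝ) * Complex.I))
    (hγ : Complex.exp (γ' * Complex.I) = Complex.exp (γ * Complex.I))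
    (hnear : |χ - 2 * γ'| ≤ Real.pi / 3) (hm : |φ - γ - Real.pi * m| ≤ Real.pi / 4) :
    χ - 2 * γ' = 2 * (φ - γ - Real.pi * m) := by
  obtain ⟨n, hn⟩ := exists_int_of_exp_eq hχ
  obtain ⟨j, hj⟩ := exists_int_of_exp_eq hγ
  have e : χ - 2 * γ' = 2 * (φ - γ - Real.pi * m) + 2 * Real.pi * ((m + n - 2 * j : ℤ) : ℝ) := by
    rw [hn, hj]; push_cast; ring
  have := eq_zero_of_phase_gap hnear hm e
  rw [e, this]
  simp

/-- At the endpoints of each arc the phase of u differs from that of g by πm₁ or πm₂, up to π times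
the bounds P₁, P₂. The integers do not depend on ρ, their difference is D, and the sector bound is
used with l = D. The bounds P₁, P₂ are left free so that strong anchoring can take them to be zero.
-/
theorem GLTangential.IsH1.boundary_lower_bound {α : ℝ≥0} {Ω : Set ℂ} {L : ℝ} {c : ℝ → ℂ}
    (h : GLTangential.IsC3Domain α Ω L c) {g u p q : ℂ → ℂ} (hu : GLTangential.IsH1 Ω u p q)
    (huc : ContinuousOn u (closure Ω)) {τ β r₀ δ M : ℝ} {T₁ T₂ a b : ℝ → ℝ}
    (hchart : IsBoundaryChart Ω c τ β r₀ δ M T₁ T₂ a b) (hM : 0 < M) (hMr : 4 * M * r₀ ≤ 1 / 4)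
    {γ : ℝ → ℝ} {N : ℝ} (hN : 0 < N) (hγ : Continuous γ)
    (hγg : ∀ t, g (c t) = Complex.exp (γ t * Complex.I))
    (hγl : ∀ s t, |γ t - γ s| ≤ N * |t - s|) {r R : ℝ} (hr : 0 < r) (hrR : r < R) (hR : R ≤ r₀)
    (hbound : ∀ x ∈ GLTangential.annulus Ω (c τ) r R, 1 / 2 ≤ ‖u x‖ ∧ ‖u x‖ ≤ 1)
    (hperp : ∀ x ∈ GLTangential.annulusGamma Ω (c τ) r R, |GLTangential.perp g u x| ≤ 1 / 4)
    {C : ℝ} (hC : ∫ x in shell Ω (c τ) r R, (1 - ‖u x‖ ^ 2) / ‖x - c τ‖ ^ 2 ≤ C)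
    {P₁ P₂ : ℝ → ℝ} (hP₁ : ContinuousOn P₁ (Icc r R)) (hP₂ : ContinuousOn P₂ (Icc r R))
    (hPP₁ : ∀ ρ ∈ Icc r R, c (τ + T₁ ρ) ∈ GLTangential.annulusGamma Ω (c τ) r R →
      |GLTangential.perp g u (c (τ + T₁ ρ))| ≤ P₁ ρ)
    (hPP₂ : ∀ ρ ∈ Icc r R, c (τ - T₂ ρ) ∈ GLTangential.annulusGamma Ω (c τ) r R →
      |GLTangential.perp g u (c (τ - T₂ ρ))| ≤ P₂ ρ) {Q : ℝ}
    (hQ : ∫ ρ in r..R, ρ⁻¹ * (P₁ ρ + P₂ ρ) ≤ Q) {D : ℤ}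
    (hD : IsChartIndex c g u (c τ) r (τ - T₂ r) (τ + T₁ r) D) :
    Real.pi * (D : ℝ) ^ 2 * Real.log (R / r) -
      (4 * C + (8 * N + 8 * M) * r₀ + 2 * Real.pi * Q) * (D : ℝ) ^ 2 ≤
      ∫ x in GLTangential.annulus Ω (c τ) r R, GLTangential.gradSq p q x := by
  have hpi := Real.pi_pos
  have hpi3 := Real.pi_gt_three
  set cl : ℝ → ℝ := fun ρ => max r (min ρ R) with hcl
  have hclc : Continuous cl := by fun_prop
  have hclm : ∀ ρ, cl ρ ∈ Icc r R := fun ρ =>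
    ⟨le_max_left _ _, max_le hrR.le (min_le_right _ _)⟩
  have hclid : ∀ ρ ∈ Icc r R, cl ρ = ρ := fun ρ hρ => by
    simp only [hcl]; rw [min_eq_left hρ.2, max_eq_right hρ.1]
  have hIoc : ∀ {ρ}, ρ ∈ Icc r R → ρ ∈ Ioc 0 r₀ := fun hρ =>
    ⟨hr.trans_le hρ.1, hρ.2.trans hR⟩
  have hIcc : ∀ {ρ}, ρ ∈ Icc r R → ρ ∈ Icc 0 r₀ := fun hρ => Ioc_subset_Icc_self (hIoc hρ)
  set A : ℝ → ℝ := fun ρ => a (cl ρ) with hA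
  set B : ℝ → ℝ := fun ρ => b (cl ρ) with hB
  have hAc : Continuous A := hchart.continuousOn_left.comp_continuous hclc fun ρ => hIoc (hclm ρ)
  have hBc : Continuous B := hchart.continuousOn_right.comp_continuous hclc fun ρ => hIoc (hclm ρ)
  have hMρ : ∀ ρ ∈ Ioc 0 r₀, 4 * M * ρ ≤ 1 / 4 := fun ρ hρ =>
    (mul_le_mul_of_nonneg_left hρ.2 (by positivity)).trans hMr
  have hAid : ∀ ρ ∈ Icc r R, A ρ = a ρ := fun ρ hρ => by simp only [hA, hclid ρ hρ]
  have hBid : ∀ ρ ∈ Icc r R, B ρ = b ρ := fun ρ hρ => by simp only [hB, hclid ρ hρ]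
  have hab : ∀ ρ ∈ Icc r R, -Real.pi ≤ A ρ ∧ A ρ < B ρ ∧ B ρ ≤ Real.pi := fun ρ hρ => by
    have h1 := abs_le.mp ((hchart.abs_left_le ρ (hIoc hρ)).trans (hMρ ρ (hIoc hρ)))
    have h2 := abs_le.mp ((hchart.abs_right_le ρ (hIoc hρ)).trans (hMρ ρ (hIoc hρ)))
    rw [hAid ρ hρ, hBid ρ hρ]
    exact ⟨by linarith, by linarith, by linarith⟩
  have harc : ∀ ρ ∈ Ioo r R, ∀ θ ∈ Ioo (A ρ) (B ρ), polarPoint (c τ) β (ρ, θ) ∈ Ω :=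
    fun ρ hρ θ hθ => by
      have hρ' := Ioo_subset_Icc_self hρ
      rw [hAid ρ hρ', hBid ρ hρ'] at hθ
      exact hchart.arc_subset ρ (hIoc hρ') θ hθ
  have hbound' : ∀ x ∈ shell Ω (c τ) r R, 1 / 2 ≤ ‖u x‖ ∧ ‖u x‖ ≤ 1 := fun x hx =>
    hbound x (shell_subset_annulus Ω _ r R hx)
  obtain ⟨φ, hφ, hphase, hineq⟩ := hu.sector_lower_bound h.isOpen huc hr hrR hbound'
    hAc hBc hab harc (integrableOn_shell_div h.isOpen h.bounded huc hr)
  have hclos : ∀ z ∈ polarRegion r R A B, polarPoint (c τ) β z ∈ closure (shell Ω (c τ) r R) :=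
    fun z hz => polarPoint_mem_closure_shell hr hrR hAc hBc (fun ρ hρ => (hab ρ hρ).2.1) harc hz
  have hlow : ∀ z ∈ polarRegion r R A B, 1 / 2 ≤ ‖u (polarPoint (c τ) β z)‖ := fun z hz =>
    half_le_norm_on_closure huc inter_subset_left (fun x hx => (hbound' x hx).1) _ (hclos z hz)
  have hmemA : ∀ ρ ∈ Icc r R, (ρ, A ρ) ∈ polarRegion r R A B := fun ρ hρ =>
    ⟨hρ, le_rfl, (hab ρ hρ).2.1.le⟩
  have hmemB : ∀ ρ ∈ Icc r R, (ρ, B ρ) ∈ polarRegion r R A B := fun ρ hρ =>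
    ⟨hρ, (hab ρ hρ).2.1.le, le_rfl⟩
  have hcA : ∀ ρ ∈ Icc r R, polarPoint (c τ) β (ρ, A ρ) = c (τ + T₁ ρ) := fun ρ hρ => by
    rw [hAid ρ hρ]; exact (hchart.curve_left ρ (hIoc hρ)).symm
  have hcB : ∀ ρ ∈ Icc r R, polarPoint (c τ) β (ρ, B ρ) = c (τ - T₂ ρ) := fun ρ hρ => by
    rw [hBid ρ hρ]; exact (hchart.curve_right ρ (hIoc hρ)).symm
  have hfr : ∀ t, c t ∈ frontier Ω := fun t => h.range_eq ▸ mem_range_self t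
  have hgA : ∀ ρ ∈ Icc r R, c (τ + T₁ ρ) ∈ GLTangential.annulusGamma Ω (c τ) r R := fun ρ hρ =>
    ⟨closure_mono (shell_subset_annulus Ω _ r R) (hcA ρ hρ ▸ hclos _ (hmemA ρ hρ)), hfr _⟩
  have hgB : ∀ ρ ∈ Icc r R, c (τ - T₂ ρ) ∈ GLTangential.annulusGamma Ω (c τ) r R := fun ρ hρ =>
    ⟨closure_mono (shell_subset_annulus Ω _ r R) (hcB ρ hρ ▸ hclos _ (hmemB ρ hρ)), hfr _⟩
  have hsin : ∀ z ∈ polarRegion r R A B, ∀ t, polarPoint (c τ) β z = c t →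
      |Real.sin (φ z - γ t)| ≤ 2 * |GLTangential.perp g u (c t)| := fun z hz t ht => by
    have h1 := hphase z hz
    have h2 := hlow z hz
    rw [ht] at h1 h2
    rw [perp_eq_norm_mul_sin h1 (hγg t), abs_mul, abs_norm]
    nlinarith [abs_nonneg (Real.sin (φ z - γ t))]
  have hnear : ∀ x P : ℝ, |Real.sin x| ≤ 2 * P → P ≤ 1 / 4 →
      ∃ m : ℤ, |x - Real.pi * m| ≤ Real.pi / 4 := fun x P hx hP => by
    obtain ⟨m, hm⟩ := exists_int_abs_sub_pi_mul_le x
    exact ⟨m, (abs_le_of_abs_le_pi_div_two m hm hx).trans (by nlinarith)⟩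
  have hT₁c : ContinuousOn T₁ (Icc r R) := hchart.radial₁.continuousOn.mono fun ρ hρ => hIcc hρ
  have hT₂c : ContinuousOn T₂ (Icc r R) := hchart.radial₂.continuousOn.mono fun ρ hρ => hIcc hρ
  have hf₁c : ContinuousOn (fun ρ => φ (ρ, A ρ) - γ (τ + T₁ ρ)) (Icc r R) :=
    (Continuous.continuousOn (by fun_prop)).sub
      (hγ.comp_continuousOn (continuousOn_const.add hT₁c))
  have hf₂c : ContinuousOn (fun ρ => φ (ρ, B ρ) - γ (τ - T₂ ρ)) (Icc r R) :=
    (Continuous.continuousOn (by fun_prop)).sub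
      (hγ.comp_continuousOn (continuousOn_const.sub hT₂c))
  obtain ⟨m₁, hm₁⟩ := exists_int_near_of_continuousOn hf₁c hrR.le fun ρ hρ =>
    hnear _ _ (hsin _ (hmemA ρ hρ) _ (hcA ρ hρ)) (hperp _ (hgA ρ hρ))
  obtain ⟨m₂, hm₂⟩ := exists_int_near_of_continuousOn hf₂c hrR.le fun ρ hρ =>
    hnear _ _ (hsin _ (hmemB ρ hρ) _ (hcB ρ hρ)) (hperp _ (hgB ρ hρ))
  have hy₁ : ∀ ρ ∈ Icc r R, |φ (ρ, A ρ) - γ (τ + T₁ ρ) - Real.pi * m₁| ≤ Real.pi * P₁ ρ :=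
    fun ρ hρ => abs_le_of_abs_le_pi_div_two m₁ ((hm₁ ρ hρ).trans (by linarith))
      ((hsin _ (hmemA ρ hρ) _ (hcA ρ hρ)).trans (by linarith [hPP₁ ρ hρ (hgA ρ hρ)]))
  have hy₂ : ∀ ρ ∈ Icc r R, |φ (ρ, B ρ) - γ (τ - T₂ ρ) - Real.pi * m₂| ≤ Real.pi * P₂ ρ :=
    fun ρ hρ => abs_le_of_abs_le_pi_div_two m₂ ((hm₂ ρ hρ).trans (by linarith))
      ((hsin _ (hmemB ρ hρ) _ (hcB ρ hρ)).trans (by linarith [hPP₂ ρ hρ (hgB ρ hρ)]))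
  have hrm : r ∈ Icc r R := ⟨le_rfl, hrR.le⟩
  -- At ρ = r, `chi_sub_two_gamma_eq` computes the extension phase at both endpoints. In the sum
  -- defining the index the phases of u and of g then cancel, leaving 2π(m₂ − m₁).
  have hmD : (m₂ : ℝ) - m₁ = D := by
    obtain ⟨a', b', hab', hba', hb't, ha't, ψ, χ, γ', ⟨hψc, hψ⟩, ⟨hγ'c, hγ'⟩, hχγ, hχ₀, hχ₁,
      hsum⟩ := hD
    have hT₁0 := (hchart.radial₁.mem r (hIcc hrm)).1
    have hT₂0 := (hchart.radial₂.mem r (hIcc hrm)).1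
    have ht01 : τ - T₂ r ≤ τ + T₁ r := by linarith
    have hdirA : GLTangential.direction u (c (τ + T₁ r)) =
        Complex.exp (φ (r, A r) * Complex.I) := by
      have := direction_eq_exp (hlow _ (hmemA r hrm)) (hphase _ (hmemA r hrm))
      rwa [hcA r hrm] at this
    have hdirB : GLTangential.direction u (c (τ - T₂ r)) =
        Complex.exp (φ (r, B r) * Complex.I) := by
      have := direction_eq_exp (hlow _ (hmemB r hrm)) (hphase _ (hmemB r hrm))
      rwa [hcB r hrm] at this
    rw [hdirA, exp_sq_phase] at hχ₁
    rw [hdirB, exp_sq_phase] at hχ₀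
    have hγγ : ∀ t ∈ Icc (τ - T₂ r) (τ + T₁ r),
        Complex.exp (γ' t * Complex.I) = Complex.exp (γ t * Complex.I) := fun t ht => by
      rw [← hγ' t ht]; exact hγg t
    have k₁ := chi_sub_two_gamma_eq hχ₁ (hγγ _ ⟨ht01, le_rfl⟩) (hχγ _ ⟨ht01, le_rfl⟩) (hm₁ r hrm)
    have k₀ := chi_sub_two_gamma_eq hχ₀ (hγγ _ ⟨le_rfl, ht01⟩) (hχγ _ ⟨le_rfl, ht01⟩) (hm₂ r hrm)
    have kγ := phase_increment_unique ht01 hγ'c hγ.continuousOn hγγ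
    rw [← hcA r hrm] at ha't
    rw [← hcB r hrm] at hb't
    obtain ⟨i, hi⟩ := exists_int_of_circleMap_eq hr ha't
    obtain ⟨j, hj⟩ := exists_int_of_circleMap_eq hr hb't
    simp only at hi hj
    have hab1 := hab r hrm
    -- The angular interval of the index and that of the chart agree up to multiples of 2π at each
    -- end; both lengths lie strictly between 0 and 2π, so the multiple is the same.
    have hij : j = i := by
      have h1 : |((j - i : ℤ) : ℝ)| < 1 := by
        push_cast
        rw [abs_lt]
        have h2 := abs_le.mp ((hchart.abs_left_le r (hIoc hrm)).trans (hMρ r (hIoc hrm)))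
        have h3 := abs_le.mp ((hchart.abs_right_le r (hIoc hrm)).trans (hMρ r (hIoc hrm)))
        rw [← hAid r hrm] at h2
        rw [← hBid r hrm] at h3
        constructor <;> nlinarith [h2.1, h2.2, h3.1, h3.2]
      have := Int.abs_lt_one_iff.mp (by exact_mod_cast h1 : |j - i| < 1)
      omega
    subst hij
    have kψ := phase_increment_unique (φ := ψ)
      (ψ := fun θ => 2 * φ (r, θ - β - j * (2 * Real.pi))) hab'.le hψc
      (Continuous.continuousOn (by fun_prop)) (fun θ hθ => by
        have hθm : (r, θ - β - j * (2 * Real.pi)) ∈ polarRegion r R A B :=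
          ⟨hrm, by simp only; linarith [hθ.1], by simp only; linarith [hθ.2]⟩
        have h1 := direction_eq_exp (hlow _ hθm) (hphase _ hθm)
        have h2 : polarPoint (c τ) β (r, θ - β - j * (2 * Real.pi)) = circleMap (c τ) r θ := by
          have := (periodic_circleMap (c τ) r).sub_int_mul_eq (x := θ) j
          rw [← this]
          simp only [polarPoint]
          congr 1
          ring
        rw [h2] at h1
        rw [← hψ θ hθ]; simp only [h1, exp_sq_phase])
    simp only [hi, hj] at kψ
    rw [show B r + β + j * (2 * Real.pi) - β - j * (2 * Real.pi) = B r by ring,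
      show A r + β + j * (2 * Real.pi) - β - j * (2 * Real.pi) = A r by ring, ← hi, ← hj] at kψ
    have hfin : 2 * Real.pi * ((m₂ : ℝ) - m₁ - D) = 0 := by
      linarith
    rcases mul_eq_zero.mp hfin with h1 | h1 <;> linarith
  have key := hineq D
  -- Integrality of D: errors linear in |D| become multiples of D².
  have hD2 : |(D : ℝ)| ≤ (D : ℝ) ^ 2 := by
    rw [← sq_abs]
    rcases eq_or_ne D 0 with rfl | hD0
    · simp
    · have : (1 : ℝ) ≤ |(D : ℝ)| := by exact_mod_cast Int.one_le_abs hD0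
      nlinarith
  have hinv : ContinuousOn (fun ρ : ℝ => ρ⁻¹) (Icc r R) :=
    continuousOn_inv₀.mono fun ρ hρ => (hr.trans_le hρ.1).ne'
  have hii : ∀ {f : ℝ → ℝ}, ContinuousOn f (Icc r R) → IntervalIntegrable f volume r R :=
    fun hf => (by rwa [uIcc_of_le hrR.le] : ContinuousOn _ (uIcc r R)).intervalIntegrable
  have i1 : IntervalIntegrable (fun ρ => Real.pi * (D : ℝ) ^ 2 * ρ⁻¹) volume r R :=
    hii (continuousOn_const.mul hinv)
  have i2 : IntervalIntegrable (fun ρ => 2 * Real.pi * (ρ⁻¹ * (P₁ ρ + P₂ ρ))) volume r R :=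
    hii (continuousOn_const.mul (hinv.mul (hP₁.add hP₂)))
  have i3 : IntervalIntegrable (fun _ : ℝ => 8 * N + 8 * M) volume r R := intervalIntegrable_const
  have i4 : IntervalIntegrable (fun ρ => ρ⁻¹ * (2 * (D : ℝ) * (φ (ρ, B ρ) - φ (ρ, A ρ)) -
      (D : ℝ) ^ 2 * (B ρ - A ρ))) volume r R :=
    hii (hinv.mul (Continuous.continuousOn (by fun_prop)))
  have hmono := intervalIntegral.integral_mono_on hrR.le
    (i1.sub ((i2.add i3).const_mul ((D : ℝ) ^ 2))) i4 fun ρ hρ => by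
    have hρ0 : 0 < ρ := hr.trans_le hρ.1
    have h1 := abs_le.mp (hy₁ ρ hρ)
    have h2 := abs_le.mp (hy₂ ρ hρ)
    -- The parameters of the two endpoints are at most T₁ ρ + T₂ ρ ≤ 4ρ apart, so the phase of g
    -- changes by O(ρ), which the factor ρ⁻¹ turns into a bounded term.
    have h3 : |γ (τ - T₂ ρ) - γ (τ + T₁ ρ)| ≤ 4 * N * ρ := by
      refine (hγl _ _).trans ?_
      have e1 := hchart.radial₁.le_two_mul ρ (hIcc hρ)
      have e2 := hchart.radial₂.le_two_mul ρ (hIcc hρ)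
      have e3 := (hchart.radial₁.mem ρ (hIcc hρ)).1
      have e4 := (hchart.radial₂.mem ρ (hIcc hρ)).1
      have e5 : |τ - T₂ ρ - (τ + T₁ ρ)| ≤ 4 * ρ := by
        rw [abs_le]; constructor <;> linarith
      have := mul_le_mul_of_nonneg_left e5 hN.le
      linarith
    have h4 := abs_le.mp h3
    set Δ := φ (ρ, B ρ) - φ (ρ, A ρ) with hΔ
    have h5 : |Δ - Real.pi * D| ≤ Real.pi * (P₁ ρ + P₂ ρ) + 4 * N * ρ := by
      rw [← hmD, abs_le]
      constructor <;> linarith [h1.1, h1.2, h2.1, h2.2, h4.1, h4.2]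
    have h6 : 2 * (D : ℝ) * Δ ≥ 2 * Real.pi * (D : ℝ) ^ 2 -
        2 * (D : ℝ) ^ 2 * (Real.pi * (P₁ ρ + P₂ ρ) + 4 * N * ρ) := by
      have h7 : |(D : ℝ) * (Δ - Real.pi * D)| ≤
          (D : ℝ) ^ 2 * (Real.pi * (P₁ ρ + P₂ ρ) + 4 * N * ρ) := by
        rw [abs_mul]
        exact mul_le_mul hD2 h5 (abs_nonneg _) (sq_nonneg _)
      have := (abs_le.mp h7).1
      linarith
    have h8 : B ρ - A ρ ≤ Real.pi + 8 * M * ρ := by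
      have e1 := abs_le.mp (hchart.abs_left_le ρ (hIoc hρ))
      have e2 := abs_le.mp (hchart.abs_right_le ρ (hIoc hρ))
      rw [hAid ρ hρ, hBid ρ hρ]
      linarith [e1.1, e2.2]
    have h9 := mul_le_mul_of_nonneg_left h8 (sq_nonneg (D : ℝ))
    have h10 : Real.pi * (D : ℝ) ^ 2 - (D : ℝ) ^ 2 *
        (2 * Real.pi * (P₁ ρ + P₂ ρ) + (8 * N + 8 * M) * ρ) ≤
        2 * (D : ℝ) * Δ - (D : ℝ) ^ 2 * (B ρ - A ρ) := by linarith
    have h11 := mul_le_mul_of_nonneg_left h10 (inv_pos.mpr hρ0).le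
    refine le_trans (le_of_eq ?_) h11
    field_simp
  have e1 := intervalIntegral.integral_sub i1 ((i2.add i3).const_mul ((D : ℝ) ^ 2))
  rw [e1, intervalIntegral.integral_const_mul, intervalIntegral.integral_const_mul,
    intervalIntegral.integral_add i2 i3, intervalIntegral.integral_const_mul,
    intervalIntegral.integral_const, integral_inv_of_pos hr (hr.trans hrR), smul_eq_mul] at hmono
  have f1 := mul_le_mul_of_nonneg_left hC (show 0 ≤ 4 * (D : ℝ) ^ 2 by positivity)
  have f2 := mul_le_mul_of_nonneg_left hQ (show 0 ≤ 2 * Real.pi * (D : ℝ) ^ 2 by positivity)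
  have f3 : (D : ℝ) ^ 2 * ((R - r) * (8 * N + 8 * M)) ≤ (D : ℝ) ^ 2 * (r₀ * (8 * N + 8 * M)) := by
    have : R - r ≤ r₀ := by linarith
    gcongr
  have f4 := hu.setIntegral_shell_le (c τ) r R
  linarith

/-! ### Alignment of the boundary index with a chart -/

namespace GLTangential.IsC3Domain

variable {α : ℝ≥0} {Ω : Set ℂ} {L : ℝ} {c : ℝ → ℂ} {g u : ℂ → ℂ}

/-- The parameters t₀, t₁ of the index are determined only up to a period, so a translate τ of the
base parameter is chosen first. The endpoints lie at distance r from x₀, each is therefore one of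
the two crossings of the chart, and t₀ < t₁ fixes the order. -/
theorem exists_forall_isChartIndex (h : IsC3Domain α Ω L c) {r₀ δ : ℝ} (hδ : 0 < δ)
    (hδL : 4 * δ < L) (hsep : ∀ τ t, ‖c t - c τ‖ ≤ r₀ → ∃ k : ℤ, |t - τ - k * L| < δ)
    {x₀ : ℂ} (hx₀ : x₀ ∈ frontier Ω) {r : ℝ} (hr : 0 < r) (hrr : r ≤ r₀) {D : ℤ}
    (hD : IsBoundaryIndex Ω c g u x₀ r D) :
    ∃ τ, c τ = x₀ ∧ ∀ (β M : ℝ) (T₁ T₂ a b : ℝ → ℝ), IsBoundaryChart Ω c τ β r₀ δ M T₁ T₂ a b →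
      IsChartIndex c g u (c τ) r (τ - T₂ r) (τ + T₁ r) D := by
  obtain ⟨a, b, t₀, t₁, hab, hba, ht, -, harc, hb, ha, ψ, χ, γ, hψ, hγ, -, hχγ, hχ₀, hχ₁, hsum⟩ :=
    hD
  obtain ⟨τ₀, rfl⟩ : x₀ ∈ range c := h.range_eq ▸ hx₀
  have hin : ∀ t ∈ Icc t₀ t₁, ‖c t - c τ₀‖ ≤ r := fun t ht => by
    have h1 : c t ∈ arcGamma Ω (c τ₀) r := harc ▸ mem_image_of_mem c ht
    have h2 : c t ∈ closedBall (c τ₀) r :=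
      closure_ball_subset_closedBall (closure_mono inter_subset_left h1.1)
    rwa [mem_closedBall, dist_eq_norm] at h2
  obtain ⟨k, hk⟩ := hsep τ₀ t₀ ((hin t₀ ⟨le_rfl, ht.le⟩).trans hrr)
  -- To leave the window on the right, [t₀, t₁] would have to contain the offset exactly δ, which is
  -- not within δ of any multiple of L because 4δ < L.
  have hclose : ∀ t ∈ Icc t₀ t₁, |t - τ₀ - k * L| < δ := fun t htt => by
    by_contra! hcon
    have hk' := abs_lt.mp hk
    have ht1 : τ₀ + k * L + δ ≤ t := by
      rcases le_abs'.mp hcon with h1 | h1 <;> linarith [htt.1]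
    obtain ⟨m, hm⟩ := hsep τ₀ (τ₀ + k * L + δ)
      ((hin _ ⟨by linarith, ht1.trans htt.2⟩).trans hrr)
    have hm' := abs_lt.mp hm
    have e : τ₀ + k * L + δ - τ₀ - m * L = δ + ((k - m : ℤ) : ℝ) * L := by push_cast; ring
    rw [e] at hm'
    rcases lt_trichotomy (k - m) 0 with h1 | h1 | h1
    · have h2 : ((k - m : ℤ) : ℝ) ≤ -1 := by exact_mod_cast (by omega : k - m ≤ -1)
      nlinarith [h.length_pos]
    · rw [h1] at hm'; norm_num at hm'
    · have h2 : (1 : ℝ) ≤ ((k - m : ℤ) : ℝ) := by exact_mod_cast h1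
      nlinarith [h.length_pos]
  refine ⟨τ₀ + k * L, h.curve_add_int_mul τ₀ k, fun β M T₁ T₂ a' b' hc => ?_⟩
  have hcτ := h.curve_add_int_mul τ₀ k
  have hsph : ∀ θ, ‖circleMap (c τ₀) r θ - c τ₀‖ = r := fun θ => by
    simp [circleMap, abs_of_pos hr]
  have hcase : ∀ t ∈ Icc t₀ t₁, ‖c t - c τ₀‖ = r →
      (τ₀ + k * L ≤ t ∧ t = τ₀ + k * L + T₁ r) ∨ (t ≤ τ₀ + k * L ∧ t = τ₀ + k * L - T₂ r) :=
    fun t htt htr => by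
    have hlt := abs_lt.mp (hclose t htt)
    rcases le_total (τ₀ + k * L) t with h1 | h1
    · left
      refine ⟨h1, ?_⟩
      have e : ‖c (τ₀ + k * L + (t - (τ₀ + k * L))) - c (τ₀ + k * L)‖ = r := by
        rw [add_sub_cancel, hcτ, htr]
      have := hc.radial₁.left_inv (t - (τ₀ + k * L)) ⟨by linarith, by linarith⟩ (by
        simp only [e]; exact hrr)
      simp only [e] at this
      linarith
    · right
      refine ⟨h1, ?_⟩
      have e : ‖c (τ₀ + k * L - (τ₀ + k * L - t)) - c (τ₀ + k * L)‖ = r := by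
        rw [sub_sub_cancel, hcτ, htr]
      have := hc.radial₂.left_inv (τ₀ + k * L - t) ⟨by linarith, by linarith⟩ (by
        simp only [e]; exact hrr)
      simp only [e] at this
      linarith
  have h0 := hcase t₀ ⟨le_rfl, ht.le⟩ (by rw [← hb, hsph])
  have h1 := hcase t₁ ⟨ht.le, le_rfl⟩ (by rw [← ha, hsph])
  have e0 : τ₀ + k * L - T₂ r = t₀ := by
    rcases h0 with h0 | h0 <;> rcases h1 with h1 | h1 <;> linarith [h0.1, h0.2, h1.1, h1.2]
  have e1 : τ₀ + k * L + T₁ r = t₁ := by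
    rcases h0 with h0 | h0 <;> rcases h1 with h1 | h1 <;> linarith [h0.1, h0.2, h1.1, h1.2]
  rw [e0, e1, hcτ]
  exact ⟨a, b, hab, hba, hb, ha, ψ, χ, γ, hψ, hγ, hχγ, hχ₀, hχ₁, hsum⟩

/-! ### The boundary penalty near a boundary point -/

theorem continuous_perp (h : IsC3Domain α Ω L c) (hg : IsBoundaryData α Ω c g)
    (huc : ContinuousOn u (closure Ω)) : Continuous fun t => perp g u (c t) := by
  have h1 : Continuous fun t => u (c t) := huc.comp_continuous h.continuous_curve fun t =>
    frontier_subset_closure (h.range_eq ▸ mem_range_self t)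
  exact h1.inner (continuous_const.mul hg.regular.1.continuous)

theorem bdryPenalty_nonneg (L : ℝ) (c : ℝ → ℂ) (S : Set ℂ) (g u : ℂ → ℂ) :
    0 ≤ bdryPenalty L c S g u := integral_nonneg fun _ => sq_nonneg _

/-- By periodicity the integration window can be centred at τ, so that arcs on both sides of c τ fit
into it. -/
theorem bdryPenalty_eq (h : IsC3Domain α Ω L c) {S : Set ℂ} (hS : MeasurableSet S) (τ : ℝ) :
    bdryPenalty L c S g u = ∫ t in (τ - L / 2)..(τ + L / 2),
      (c ⁻¹' S).indicator (fun t => perp g u (c t) ^ 2) t := by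
  have hm : MeasurableSet (c ⁻¹' S) := h.continuous_curve.measurable hS
  have hp : Function.Periodic ((c ⁻¹' S).indicator (fun t => perp g u (c t) ^ 2)) L := fun t => by
    have e : t + L ∈ c ⁻¹' S ↔ t ∈ c ⁻¹' S := by rw [mem_preimage, mem_preimage, h.periodic t]
    by_cases ht : t ∈ c ⁻¹' S
    · rw [indicator_of_mem ht, indicator_of_mem (e.mpr ht), h.periodic t]
    · rw [indicator_of_notMem ht, indicator_of_notMem (mt e.mp ht)]
  have e := hp.intervalIntegral_add_eq 0 (τ - L / 2)
  rw [zero_add, show τ - L / 2 + L = τ + L / 2 by ring] at e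
  rw [← e, bdryPenalty, intervalIntegral.integral_of_le h.length_pos.le,
    ← integral_Ico_eq_integral_Ioc, setIntegral_indicator hm]

theorem integral_indicator_le_bdryPenalty (h : IsC3Domain α Ω L c) (hg : IsBoundaryData α Ω c g)
    (huc : ContinuousOn u (closure Ω)) {S : Set ℂ} (hS : MeasurableSet S) {τ x y : ℝ}
    (hx : τ - L / 2 ≤ x) (hxy : x ≤ y) (hy : y ≤ τ + L / 2) :
    ∫ t in x..y, (c ⁻¹' S).indicator (fun t => perp g u (c t) ^ 2) t ≤
      bdryPenalty L c S g u := by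
  rw [h.bdryPenalty_eq hS τ]
  refine intervalIntegral.integral_mono_interval hx hxy hy
    (Filter.Eventually.of_forall fun t => indicator_nonneg (fun _ _ => sq_nonneg _) t) ?_
  have hi : IntervalIntegrable (fun t => perp g u (c t) ^ 2) volume (τ - L / 2) (τ + L / 2) :=
    ((h.continuous_perp hg huc).pow 2).intervalIntegrable _ _
  rw [intervalIntegrable_iff] at hi ⊢
  exact hi.indicator (h.continuous_curve.measurable hS)

theorem integral_indicator_add_le (h : IsC3Domain α Ω L c) (hg : IsBoundaryData α Ω c g)
    (huc : ContinuousOn u (closure Ω)) {S : Set ℂ} (hS : MeasurableSet S) {τ x y : ℝ}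
    (hx : 0 ≤ x) (hxy : x ≤ y) (hy : y ≤ L / 2) :
    ∫ t in Icc x y, (c ⁻¹' S).indicator (fun t => perp g u (c t) ^ 2) (τ + t) ≤
      bdryPenalty L c S g u := by
  rw [integral_Icc_eq_integral_Ioc, ← intervalIntegral.integral_of_le hxy,
    intervalIntegral.integral_comp_add_left]
  exact h.integral_indicator_le_bdryPenalty hg huc hS (τ := τ) (by linarith [h.length_pos])
    (by linarith) (by linarith)

theorem integral_indicator_sub_le (h : IsC3Domain α Ω L c) (hg : IsBoundaryData α Ω c g)
    (huc : ContinuousOn u (closure Ω)) {S : Set ℂ} (hS : MeasurableSet S) {τ x y : ℝ}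
    (hx : 0 ≤ x) (hxy : x ≤ y) (hy : y ≤ L / 2) :
    ∫ t in Icc x y, (c ⁻¹' S).indicator (fun t => perp g u (c t) ^ 2) (τ - t) ≤
      bdryPenalty L c S g u := by
  rw [integral_Icc_eq_integral_Ioc, ← intervalIntegral.integral_of_le hxy,
    intervalIntegral.integral_comp_sub_left]
  exact h.integral_indicator_le_bdryPenalty hg huc hS (τ := τ) (by linarith)
    (by linarith) (by linarith [h.length_pos])

theorem mem_arcGamma_of_norm_lt (h : IsC3Domain α Ω L c) {x₀ : ℂ} {ρ t : ℝ}
    (ht : ‖c t - x₀‖ < ρ) : c t ∈ arcGamma Ω x₀ ρ := by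
  have hf : c t ∈ frontier Ω := h.range_eq ▸ mem_range_self t
  refine ⟨isOpen_ball.inter_closure ⟨?_, frontier_subset_closure hf⟩, hf⟩
  rwa [mem_ball, dist_eq_norm]

theorem measurableSet_arcGamma (x₀ : ℂ) (ρ : ℝ) : MeasurableSet (arcGamma Ω x₀ ρ) :=
  isClosed_closure.measurableSet.inter isClosed_frontier.measurableSet

end GLTangential.IsC3Domain

/-! ### Radially weighted integrals along a boundary branch -/

theorem integral_inv_sq_weights_le {r R σ η : ℝ} (hr : 0 < r) (hrR : r ≤ R) (hσ : 0 < σ)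
    (hσr : σ ≤ r) (hη : 0 < η) :
    ∫ ρ in r..R, (σ / ρ ^ 2 + 4 * η / (ρ + η) ^ 2) ≤ 5 := by
  have hpos : ∀ ρ ∈ uIcc r R, 0 < ρ := fun ρ hρ => by
    rw [uIcc_of_le hrR] at hρ; exact hr.trans_le hρ.1
  have hd : ∀ ρ ∈ uIcc r R, HasDerivAt (fun ρ => -(σ * ρ⁻¹) - 4 * η * (ρ + η)⁻¹)
      (σ / ρ ^ 2 + 4 * η / (ρ + η) ^ 2) ρ := fun ρ hρ => by
    have h0 := hpos ρ hρ
    have h1 := ((hasDerivAt_inv h0.ne').const_mul σ).neg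
    have h2 := (((hasDerivAt_id' ρ).add_const η).inv (by positivity)).const_mul (4 * η)
    refine (h1.sub h2).congr_deriv ?_
    field_simp
    ring
  have hi : IntervalIntegrable (fun ρ => σ / ρ ^ 2 + 4 * η / (ρ + η) ^ 2) volume r R := by
    refine ContinuousOn.intervalIntegrable (ContinuousOn.add ?_ ?_)
    · exact continuousOn_const.div (by fun_prop) fun ρ hρ => (pow_pos (hpos ρ hρ) 2).ne'
    · exact continuousOn_const.div (by fun_prop) fun ρ hρ =>
        (pow_pos (add_pos (hpos ρ hρ) hη) 2).ne'
  rw [intervalIntegral.integral_eq_sub_of_hasDerivAt hd hi]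
  have h1 : σ * r⁻¹ ≤ 1 := by rw [← div_eq_mul_inv]; exact (div_le_one hr).mpr hσr
  have h2 : 4 * η * (r + η)⁻¹ ≤ 4 := by
    rw [← div_eq_mul_inv]; exact (div_le_iff₀ (by positivity)).mpr (by nlinarith)
  have hR := hr.trans_le hrR
  have h3 : 0 ≤ σ * R⁻¹ := by positivity
  have h4 : 0 ≤ 4 * η * (R + η)⁻¹ := by positivity
  linarith

/-- The arithmetic-geometric mean inequality with weight σ for ρ < η and weight η beyond. For ρ ≥ η
one has η/ρ² ≤ 4η/(ρ + η)²; the shifted weight has bounded total mass on all radii, so no splitting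
of the integral is needed. -/
theorem inv_mul_abs_le_weights {ρ v σ η : ℝ} (hρ : 0 < ρ) (hσ : 0 < σ) (hη : 0 < η) :
    ρ⁻¹ * |v| ≤ ((Iio η).indicator (fun _ => v ^ 2 / σ) ρ + v ^ 2 / η +
      (σ / ρ ^ 2 + 4 * η / (ρ + η) ^ 2)) / 2 := by
  have amgm : ∀ κ : ℝ, 0 < κ → ρ⁻¹ * |v| ≤ (v ^ 2 / κ + κ / ρ ^ 2) / 2 := fun κ hκ => by
    have h1 : 0 ≤ (|v| - κ * ρ⁻¹) ^ 2 / κ := by positivity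
    have e : (|v| - κ * ρ⁻¹) ^ 2 / κ = v ^ 2 / κ + κ / ρ ^ 2 - 2 * (ρ⁻¹ * |v|) := by
      rw [← sq_abs v]; field_simp; ring
    linarith
  have p1 : 0 ≤ v ^ 2 / η := by positivity
  have p2 : 0 ≤ σ / ρ ^ 2 := by positivity
  have p3 : 0 ≤ 4 * η / (ρ + η) ^ 2 := by positivity
  by_cases hlt : ρ < η
  · rw [indicator_of_mem (mem_Iio.mpr hlt)]
    linarith [amgm σ hσ]
  · rw [indicator_of_notMem (by simpa using hlt)]
    push Not at hlt
    have h1 : η / ρ ^ 2 ≤ 4 * η / (ρ + η) ^ 2 := by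
      rw [div_le_div_iff₀ (by positivity) (by positivity)]
      have : (ρ + η) ^ 2 ≤ 4 * ρ ^ 2 := by nlinarith
      nlinarith
    linarith [amgm η hη]

/-- The one-dimensional counterpart of `integral_shell_defect_le`: the squared terms are passed from
the radius to arc length by `integral_le`, and the weights contribute at most 5. -/
theorem IsRadialInverse.integral_inv_mul_abs_le {f T : ℝ → ℝ} {r₀ δ : ℝ}
    (hT : IsRadialInverse f T r₀ δ) (hf : Continuous f) {v : ℝ → ℝ} (hv : Continuous v)
    {r R σ η A B : ℝ} (hr : 0 < r) (hrR : r ≤ R) (hR : R ≤ r₀) (hσ : 0 < σ) (hσr : σ ≤ r)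
    (hη : 0 < η)
    (hA : ∫ t in Icc (T r) (T R), {t | f t < η}.indicator (fun t => v t ^ 2) t ≤ A)
    (hB : ∫ t in Icc (T r) (T R), v t ^ 2 ≤ B) :
    ∫ ρ in r..R, ρ⁻¹ * |v (T ρ)| ≤ (A / σ + B / η + 5) / 2 := by
  have hpos : ∀ ρ ∈ Icc r R, 0 < ρ := fun ρ hρ => hr.trans_le hρ.1
  have hsub : Icc r R ⊆ Icc 0 r₀ := Icc_subset_Icc hr.le hR
  have hvT : ContinuousOn (fun ρ => v (T ρ)) (Icc r R) :=
    hv.comp_continuousOn (hT.continuousOn.mono hsub)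
  set G : ℝ → ℝ := fun ρ => (Iio η).indicator (fun _ => v (T ρ) ^ 2 / σ) ρ + v (T ρ) ^ 2 / η
    with hG
  have hG0 : ∀ ρ, 0 ≤ G ρ := fun ρ =>
    add_nonneg (indicator_nonneg (fun _ _ => by positivity) ρ) (by positivity)
  have hGi : IntegrableOn G (Icc r R) := by
    have h1 : IntegrableOn (fun ρ => v (T ρ) ^ 2 / σ) (Icc r R) :=
      ((hvT.pow 2).div_const σ).integrableOn_compact isCompact_Icc
    have h2 : IntegrableOn (fun ρ => v (T ρ) ^ 2 / η) (Icc r R) :=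
      ((hvT.pow 2).div_const η).integrableOn_compact isCompact_Icc
    exact (Integrable.indicator h1 measurableSet_Iio).add h2
  have hW : IntegrableOn (fun ρ => σ / ρ ^ 2 + 4 * η / (ρ + η) ^ 2) (Icc r R) := by
    refine ContinuousOn.integrableOn_compact isCompact_Icc (ContinuousOn.add ?_ ?_)
    · exact continuousOn_const.div (by fun_prop) fun ρ hρ => (pow_pos (hpos ρ hρ) 2).ne'
    · exact continuousOn_const.div (by fun_prop) fun ρ hρ =>
        (pow_pos (add_pos (hpos ρ hρ) hη) 2).ne'
  -- Every t here equals T ρ for some ρ by the intermediate value theorem, so T (f t) = t and the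
  -- integrand becomes a function of arc length.
  have hGf : ∀ t ∈ Icc (T r) (T R), G (f t) =
      {t | f t < η}.indicator (fun t => v t ^ 2) t / σ + v t ^ 2 / η := fun t ht => by
    have hRm : R ∈ Icc 0 r₀ := ⟨hr.le.trans hrR, hR⟩
    have hrm : r ∈ Icc 0 r₀ := ⟨hr.le, hrR.trans hR⟩
    obtain ⟨ρ, hρ, rfl⟩ : t ∈ T '' Icc r R :=
      intermediate_value_Icc hrR (hT.continuousOn.mono hsub) ht
    simp only [hG, hT.right_inv ρ (hsub hρ), indicator, mem_Iio, mem_ofPred_eq]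
    split_ifs <;> simp
  have hmeas : MeasurableSet {t | f t < η} := (isOpen_lt hf continuous_const).measurableSet
  have hvi : IntegrableOn (fun t => v t ^ 2) (Icc (T r) (T R)) :=
    (hv.pow 2).continuousOn.integrableOn_compact isCompact_Icc
  have hvind : IntegrableOn ({t | f t < η}.indicator (fun t => v t ^ 2)) (Icc (T r) (T R)) :=
    Integrable.indicator hvi hmeas
  have hGfi : IntegrableOn (fun t => G (f t)) (Icc (T r) (T R)) :=
    IntegrableOn.congr_fun ((hvind.div_const σ).add (hvi.div_const η))
      (fun t ht => (hGf t ht).symm) measurableSet_Icc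
  have hGle : ∫ ρ in Icc r R, G ρ ≤ A / σ + B / η := by
    refine (hT.integral_le r R hr hrR hR G hG0 hGfi).trans ?_
    rw [setIntegral_congr_fun measurableSet_Icc hGf, integral_add (hvind.div_const σ)
      (hvi.div_const η), integral_div, integral_div]
    gcongr
  have hWle := integral_inv_sq_weights_le hr hrR hσ hσr hη
  rw [intervalIntegral.integral_of_le hrR, ← integral_Icc_eq_integral_Ioc] at hWle ⊢
  have hle : ∫ ρ in Icc r R, ρ⁻¹ * |v (T ρ)| ≤
      ∫ ρ in Icc r R, (G ρ + (σ / ρ ^ 2 + 4 * η / (ρ + η) ^ 2)) / 2 := by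
    refine setIntegral_mono_on ?_ ((hGi.add hW).div_const 2) measurableSet_Icc fun ρ hρ =>
      inv_mul_abs_le_weights (hpos ρ hρ) hσ hη
    exact ContinuousOn.integrableOn_compact isCompact_Icc
      ((continuousOn_id.inv₀ fun ρ hρ => (hpos ρ hρ).ne').mul hvT.abs)
  refine hle.trans ?_
  rw [integral_div, integral_add hGi hW]
  linarith

namespace GLTangential

variable {α : ℝ≥0} {Ω : Set ℂ} {L : ℝ} {c : ℝ → ℂ} {g u p q : ℂ → ℂ}

/-! ### Energy bounds -/

theorem potential_nonneg (S : Set ℂ) (u : ℂ → ℂ) : 0 ≤ potential S u :=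
  integral_nonneg fun _ => sq_nonneg _

theorem energy_nonneg {ε : ℝ} : 0 ≤ energy Ω ε u p q :=
  mul_nonneg (by norm_num) (integral_nonneg fun x =>
    add_nonneg (gradSq_nonneg p q x) (by positivity))

theorem IsH1.potential_le_energy (hu : IsH1 Ω u p q) (hΩ : Bornology.IsBounded Ω)
    (huc : ContinuousOn u (closure Ω)) {ε : ℝ} (hε : 0 < ε) :
    potential Ω u ≤ 4 * ε ^ 2 * energy Ω ε u p q := by
  have hi : IntegrableOn (fun x => (1 - ‖u x‖ ^ 2) ^ 2) Ω :=
    integrableOn_of_continuousOn_closure hΩ (by fun_prop)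
  have h0 : 0 ≤ ∫ x in Ω, gradSq p q x := integral_nonneg fun x => gradSq_nonneg p q x
  rw [energy, integral_add hu.integrableOn_gradSq (hi.const_mul _), integral_const_mul,
    ← potential]
  have e : 4 * ε ^ 2 * (1 / 2 * ((∫ x in Ω, gradSq p q x) +
      1 / (2 * ε ^ 2) * potential Ω u)) =
      2 * ε ^ 2 * (∫ x in Ω, gradSq p q x) + potential Ω u := by
    field_simp
    ring
  rw [e]
  have : 0 ≤ 2 * ε ^ 2 * ∫ x in Ω, gradSq p q x := by positivity
  linarith

theorem energy_le_weakEnergy {s ε : ℝ} (hε : 0 < ε) :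
    energy Ω ε u p q ≤ weakEnergy Ω L c g s ε u p q := by
  have h1 := Real.rpow_pos_of_pos hε s
  have h2 : 0 ≤ 1 / (2 * ε ^ s) * bdryPenalty L c (frontier Ω) g u :=
    mul_nonneg (by positivity) (IsC3Domain.bdryPenalty_nonneg _ _ _ _ _)
  unfold weakEnergy
  linarith

theorem bdryPenalty_le_weakEnergy {s ε : ℝ} (hε : 0 < ε) :
    bdryPenalty L c (frontier Ω) g u ≤ 2 * ε ^ s * weakEnergy Ω L c g s ε u p q := by
  have h1 := Real.rpow_pos_of_pos hε s
  have h2 : 0 ≤ 2 * ε ^ s * energy Ω ε u p q := mul_nonneg (by positivity) energy_nonneg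
  have e : 2 * ε ^ s * weakEnergy Ω L c g s ε u p q =
      2 * ε ^ s * energy Ω ε u p q + bdryPenalty L c (frontier Ω) g u := by
    unfold weakEnergy; field_simp
  linarith

/-- The weak anchoring term controls the tangential defect along both boundary arcs. -/
theorem IsC3Domain.integral_inv_mul_perp_le (h : IsC3Domain α Ω L c) (hg : IsBoundaryData α Ω c g)
    (huc : ContinuousOn u (closure Ω)) {τ β r₀ δ M : ℝ} {T₁ T₂ a b : ℝ → ℝ}
    (hchart : IsBoundaryChart Ω c τ β r₀ δ M T₁ T₂ a b) (hδL : 4 * δ < L)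
    {s γ ε r R K : ℝ} (hε : ε ∈ Ioo (0 : ℝ) 1) (hr : 0 < r) (hεr : ε ^ s ≤ r) (hrR : r ≤ R)
    (hR : R ≤ r₀) (hγ : γ < s) (hK : 0 ≤ K)
    (hglob : bdryPenalty L c (frontier Ω) g u ≤ 2 * ε ^ s * (K * |Real.log ε| + K))
    (hloc : 1 / ε ^ s * bdryPenalty L c (arcGamma Ω (c τ) (ε ^ γ)) g u ≤ K) :
    ∫ ρ in r..R, ρ⁻¹ * (|perp g u (c (τ + T₁ ρ))| + |perp g u (c (τ - T₂ ρ))|) ≤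
      K + 2 * K * (1 / (s - γ) + 1) + 5 := by
  have hc := h.continuous_curve
  have hv := h.continuous_perp hg huc
  have hσ := Real.rpow_pos_of_pos hε.1 s
  have hη := Real.rpow_pos_of_pos hε.1 γ
  have hsub : Icc r R ⊆ Icc 0 r₀ := Icc_subset_Icc hr.le hR
  have hrm := hsub (left_mem_Icc.mpr hrR)
  have hRm := hsub (right_mem_Icc.mpr hrR)
  have hS := IsC3Domain.measurableSet_arcGamma (Ω := Ω) (c τ) (ε ^ γ)
  have hF : MeasurableSet (frontier Ω) := isClosed_frontier.measurableSet
  have hall : ∀ t, t ∈ c ⁻¹' frontier Ω := fun t => h.range_eq ▸ mem_range_self t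
  have hA : bdryPenalty L c (arcGamma Ω (c τ) (ε ^ γ)) g u / ε ^ s ≤ K := by
    rwa [div_eq_mul_one_div, mul_comm]
  have hB : bdryPenalty L c (frontier Ω) g u / ε ^ γ ≤ 2 * K * (1 / (s - γ) + 1) := by
    have e : ε ^ s = ε ^ (s - γ) * ε ^ γ := by rw [← Real.rpow_add hε.1, sub_add_cancel]
    have h1 := rpow_mul_abs_log_le hε (sub_pos.mpr hγ)
    have h2 : ε ^ (s - γ) ≤ 1 := Real.rpow_le_one hε.1.le hε.2.le (sub_pos.mpr hγ).le
    rw [div_le_iff₀ hη]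
    refine hglob.trans ?_
    have h3 : 2 * ε ^ s * (K * |Real.log ε| + K) =
        2 * K * (ε ^ (s - γ) * |Real.log ε| + ε ^ (s - γ)) * ε ^ γ := by rw [e]; ring
    rw [h3]
    gcongr
  -- The sign σ = ±1 treats the forward and backward branches together. Radii below ε^γ are charged
  -- to the local penalty, all radii to the global one.
  have key : ∀ (σ : ℝ) (T : ℝ → ℝ), (σ = 1 ∨ σ = -1) →
      IsRadialInverse (fun t => ‖c (τ + σ * t) - c τ‖) T r₀ δ →
      ∫ ρ in r..R, ρ⁻¹ * |perp g u (c (τ + σ * T ρ))| ≤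
        (K + 2 * K * (1 / (s - γ) + 1) + 5) / 2 := fun σ T hσ1 hT => by
    have hTT : T r ≤ T R := hT.mono hrm hRm hrR
    have hT0 := (hT.mem r hrm).1
    have hTL : T R ≤ L / 2 := by linarith [(hT.mem R hRm).2, (hT.mem R hRm).1]
    have hpen : ∀ S, MeasurableSet S → ∫ t in Icc (T r) (T R),
        (c ⁻¹' S).indicator (fun t => perp g u (c t) ^ 2) (τ + σ * t) ≤
        bdryPenalty L c S g u := fun S hS => by
      rcases hσ1 with rfl | rfl
      · simpa only [one_mul] using h.integral_indicator_add_le hg huc hS hT0 hTT hTL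
      · simpa only [neg_one_mul, ← sub_eq_add_neg] using
          h.integral_indicator_sub_le hg huc hS hT0 hTT hTL
    have hvσ : Continuous fun t => perp g u (c (τ + σ * t)) :=
      hv.comp (f := fun t => τ + σ * t) (by fun_prop)
    have hfσ : Continuous fun t => ‖c (τ + σ * t) - c τ‖ := by fun_prop
    have hvi : IntegrableOn (fun t => perp g u (c (τ + σ * t)) ^ 2) (Icc (T r) (T R)) :=
      (hvσ.pow 2).continuousOn.integrableOn_compact isCompact_Icc
    refine (hT.integral_inv_mul_abs_le hfσ hvσ hr hrR hR hσ hεr hη (le_trans ?_ (hpen _ hS))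
      (le_trans (le_of_eq ?_) (hpen _ hF))).trans (by gcongr)
    · refine setIntegral_mono_on (Integrable.indicator hvi
        (isOpen_lt hfσ continuous_const).measurableSet) ?_ measurableSet_Icc fun t _ => ?_
      · have hm : MeasurableSet ((fun t => τ + σ * t) ⁻¹' (c ⁻¹' arcGamma Ω (c τ) (ε ^ γ))) :=
          (hc.comp (show Continuous fun t => τ + σ * t by fun_prop)).measurable hS
        exact Integrable.indicator hvi hm
      · by_cases ht : ‖c (τ + σ * t) - c τ‖ < ε ^ γ
        · rw [indicator_of_mem (by exact ht),
            indicator_of_mem (s := c ⁻¹' arcGamma Ω (c τ) (ε ^ γ)) (h.mem_arcGamma_of_norm_lt ht)]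
        · rw [indicator_of_notMem (by exact ht)]
          exact indicator_nonneg (fun _ _ => sq_nonneg _) _
    · simp only [indicator_of_mem (hall _)]
  have h₁ := key 1 T₁ (Or.inl rfl) (by simpa only [one_mul] using hchart.radial₁)
  have h₂ := key (-1) T₂ (Or.inr rfl) (by
    simpa only [neg_one_mul, ← sub_eq_add_neg] using hchart.radial₂)
  simp only [one_mul, neg_one_mul, ← sub_eq_add_neg] at h₁ h₂
  have hi : ∀ (T y : ℝ → ℝ), IsRadialInverse y T r₀ δ → ∀ v : ℝ → ℝ, Continuous v →
      IntervalIntegrable (fun ρ => ρ⁻¹ * |v (T ρ)|) volume r R := fun T y hT v hv => by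
    refine ContinuousOn.intervalIntegrable ?_
    rw [uIcc_of_le hrR]
    exact (continuousOn_id.inv₀ fun ρ hρ => (hr.trans_le hρ.1).ne').mul
      (hv.comp_continuousOn (hT.continuousOn.mono hsub)).abs
  have e := intervalIntegral.integral_add
    (hi T₁ _ hchart.radial₁ (fun t => perp g u (c (τ + t)))
      (hv.comp (f := fun t => τ + t) (by fun_prop)))
    (hi T₂ _ hchart.radial₂ (fun t => perp g u (c (τ - t)))
      (hv.comp (f := fun t => τ - t) (by fun_prop)))
  simp only [mul_add]
  linarith

end GLTangential

/-! ### Both anchoring cases and their constants -/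

theorem theorem5p2 (α : ℝ≥0) (hα₀ : 0 < α) (hα₁ : α < 1) (Ω : Set ℂ) (L : ℝ) (c : ℝ → ℂ)
    (hΩ : GLTangential.IsC3Domain α Ω L c) :
    ∃ r₀ : ℝ, 0 < r₀ ∧ ∀ g : ℂ → ℂ, GLTangential.IsBoundaryData α Ω c g →
      -- strong tangential case
      (∀ γ ∈ Ioo (3 / 4 : ℝ) 1, ∀ K : ℝ, ∃ C : ℝ, ∀ ε ∈ Ioo (0 : ℝ) 1, ∀ u p q : ℂ → ℂ,
        GLTangential.IsH1 Ω u p q → ContinuousOn u (closure Ω) →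
        ∀ x₀ ∈ closure Ω, ∀ r R : ℝ, ε ≤ r → r < R → R ≤ r₀ →
        (∀ x ∈ GLTangential.annulus Ω x₀ r R, 1 / 2 ≤ ‖u x‖ ∧ ‖u x‖ ≤ 1) →
        (∀ x ∈ GLTangential.annulusGamma Ω x₀ r R, GLTangential.perp g u x = 0) →
        GLTangential.energy Ω ε u p q ≤ K * |Real.log ε| + K →
        1 / ε ^ 2 * GLTangential.potential (GLTangential.omega Ω x₀ (ε ^ γ)) u ≤ K →
        (ball x₀ R ⊆ Ω → ∀ d : ℤ, d ≠ 0 → GLTangential.IsDegree u x₀ r d →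
          2 * Real.pi * (d : ℝ) ^ 2 * Real.log (R / r) - C * (d : ℝ) ^ 2 ≤
            ∫ x in GLTangential.annulus Ω x₀ r R, GLTangential.gradSq p q x) ∧
        (x₀ ∈ frontier Ω → ∀ D : ℤ, D ≠ 0 → GLTangential.IsBoundaryIndex Ω c g u x₀ r D →
          Real.pi * (D : ℝ) ^ 2 * Real.log (R / r) - C * (D : ℝ) ^ 2 ≤
            ∫ x in GLTangential.annulus Ω x₀ r R, GLTangential.gradSq p q x)) ∧
      -- weak tangential case
      (∀ s ∈ Ioc (0 : ℝ) 1, ∀ γ ∈ Ioo (3 / 4 * s) s, ∀ K : ℝ, ∃ C : ℝ, ∀ ε ∈ Ioo (0 : ℝ) 1,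
        ∀ u p q : ℂ → ℂ, GLTangential.IsH1 Ω u p q → ContinuousOn u (closure Ω) →
        ∀ x₀ ∈ closure Ω, ∀ r R : ℝ, r < R → R ≤ r₀ →
        (∀ x ∈ GLTangential.annulus Ω x₀ r R, 1 / 2 ≤ ‖u x‖ ∧ ‖u x‖ ≤ 1) →
        (∀ x ∈ GLTangential.annulusGamma Ω x₀ r R, |GLTangential.perp g u x| ≤ 1 / 4) →
        GLTangential.weakEnergy Ω L c g s ε u p q ≤ K * |Real.log ε| + K →
        1 / ε ^ 2 * GLTangential.potential (GLTangential.omega Ω x₀ (ε ^ γ)) u +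
          1 / ε ^ s * GLTangential.bdryPenalty L c (GLTangential.arcGamma Ω x₀ (ε ^ γ)) g u ≤ K →
        (ball x₀ R ⊆ Ω → ε ≤ r → ∀ d : ℤ, d ≠ 0 → GLTangential.IsDegree u x₀ r d →
          2 * Real.pi * (d : ℝ) ^ 2 * Real.log (R / r) - C * (d : ℝ) ^ 2 ≤
            ∫ x in GLTangential.annulus Ω x₀ r R, GLTangential.gradSq p q x) ∧
        (x₀ ∈ frontier Ω → ε ^ s ≤ r → ∀ D : ℤ, D ≠ 0 →
          GLTangential.IsBoundaryIndex Ω c g u x₀ r D →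
          Real.pi * (D : ℝ) ^ 2 * Real.log (R / r) - C * (D : ℝ) ^ 2 ≤
            ∫ x in GLTangential.annulus Ω x₀ r R, GLTangential.gradSq p q x)) := by
  obtain ⟨r₀, δ, M, hr₀, hδ, hM, hδL, hr₀δ, hMδ, hsep, hcharts⟩ := hΩ.exists_isBoundaryChart
  have hpi := Real.pi_pos
  have hMr : 4 * M * r₀ ≤ 1 / 4 := by nlinarith [mul_le_mul_of_nonneg_left hr₀δ hM.le]
  refine ⟨r₀, hr₀, fun g hg => ?_⟩
  obtain ⟨φ, N, hN, hφ, hφg, hφl⟩ := hg.exists_lipschitz_phase hΩ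
  have hNM : 0 ≤ (8 * N + 8 * M) * r₀ := by positivity
  refine ⟨fun γ hγ K => ⟨4 * (K / 2 + 2 * K * (1 / (2 - 2 * γ) + 1) + Real.pi) +
      (8 * N + 8 * M) * r₀, fun ε hε u p q hu huc x₀ _ r R hεr hrR hR hbound hperp hE hloc => ?_⟩,
    fun s hs γ hγ K => ⟨4 * (K / 2 + 2 * K * (1 / (2 - 2 * γ) + 1) + Real.pi) +
      (8 * N + 8 * M) * r₀ + 2 * Real.pi * (K + 2 * K * (1 / (s - γ) + 1) + 5),
      fun ε hε u p q hu huc x₀ _ r R hrR hR hbound hperp hE hloc => ?_⟩⟩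
  · have hr := hε.1.trans_le hεr
    have hpot : GLTangential.potential Ω u ≤ 4 * ε ^ 2 * (K * |Real.log ε| + K) :=
      (hu.potential_le_energy hΩ.bounded huc hε.1).trans
        (mul_le_mul_of_nonneg_left hE (by positivity))
    have hC := integral_shell_defect_le (R := R) hΩ.isOpen hΩ.bounded huc hε hεr hγ.2 hpot hloc
    refine ⟨fun hball d _ hd => ?_, fun hx₀ D _ hD => ?_⟩
    · have h1 := hu.interior_lower_bound hΩ.isOpen hΩ.bounded huc hr hrR hball hbound hC hd
      nlinarith [mul_nonneg hNM (sq_nonneg (d : ℝ))]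
    · obtain ⟨τ, rfl, hind⟩ :=
        hΩ.exists_forall_isChartIndex hδ hδL hsep hx₀ hr (hrR.le.trans hR) hD
      obtain ⟨β, T₁, T₂, a, b, hchart⟩ := hcharts τ
      have h1 := hu.boundary_lower_bound hΩ huc hchart hM hMr hN hφ hφg hφl hr hrR hR hbound
        (fun x hx => by rw [hperp x hx]; norm_num) hC (P₁ := fun _ => 0) (P₂ := fun _ => 0)
        -- Strong anchoring: the tangential defect vanishes on the boundary part of the annulus, so
        -- P₁, P₂ and Q are all zero.
        continuousOn_const continuousOn_const (fun ρ _ h => by rw [hperp _ h, abs_zero])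
        (fun ρ _ h => by rw [hperp _ h, abs_zero]) (Q := 0) (by simp)
        (hind β M T₁ T₂ a b hchart)
      linarith
  · have hεs := Real.rpow_pos_of_pos hε.1 s
    have hp1 : 0 ≤ 1 / ε ^ 2 *
        GLTangential.potential (GLTangential.omega Ω x₀ (ε ^ γ)) u :=
      mul_nonneg (by positivity) (GLTangential.potential_nonneg _ _)
    have hp2 : 0 ≤ 1 / ε ^ s *
        GLTangential.bdryPenalty L c (GLTangential.arcGamma Ω x₀ (ε ^ γ)) g u :=
      mul_nonneg (by positivity) (GLTangential.IsC3Domain.bdryPenalty_nonneg _ _ _ _ _)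
    -- Both local terms are nonnegative, so the local bound itself forces K ≥ 0.
    have hK : 0 ≤ K := by linarith
    have hsγ := sub_pos.mpr hγ.2
    have hQ0 : 0 ≤ 2 * Real.pi * (K + 2 * K * (1 / (s - γ) + 1) + 5) := by positivity
    have hpot : GLTangential.potential Ω u ≤ 4 * ε ^ 2 * (K * |Real.log ε| + K) :=
      (hu.potential_le_energy hΩ.bounded huc hε.1).trans
        (mul_le_mul_of_nonneg_left ((GLTangential.energy_le_weakEnergy hε.1).trans hE)
          (by positivity))
    have hglob : GLTangential.bdryPenalty L c (frontier Ω) g u ≤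
        2 * ε ^ s * (K * |Real.log ε| + K) :=
      (GLTangential.bdryPenalty_le_weakEnergy hε.1).trans
        (mul_le_mul_of_nonneg_left hE (by positivity))
    have hC := fun hεr : ε ≤ r => integral_shell_defect_le (R := R) hΩ.isOpen hΩ.bounded huc hε
      hεr (hγ.2.trans_le hs.2) hpot (by linarith)
    refine ⟨fun hball hεr d _ hd => ?_, fun hx₀ hεr D _ hD => ?_⟩
    · have h1 := hu.interior_lower_bound hΩ.isOpen hΩ.bounded huc (hε.1.trans_le hεr) hrR hball
        hbound (hC hεr) hd
      nlinarith [mul_nonneg (add_nonneg hNM hQ0) (sq_nonneg (d : ℝ))]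
    · have hr := hεs.trans_le hεr
      -- Since s ≤ 1, ε ≤ ε^s ≤ r, so the modulus-defect estimate also applies at the boundary.
      have hεr' : ε ≤ r := le_trans (by
        simpa using Real.rpow_le_rpow_of_exponent_ge hε.1 hε.2.le hs.2) hεr
      obtain ⟨τ, rfl, hind⟩ :=
        hΩ.exists_forall_isChartIndex hδ hδL hsep hx₀ hr (hrR.le.trans hR) hD
      obtain ⟨β, T₁, T₂, a, b, hchart⟩ := hcharts τ
      have hv := hΩ.continuous_perp hg huc
      have hsub : Icc r R ⊆ Icc 0 r₀ := Icc_subset_Icc hr.le hR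
      have hcT₁ : ContinuousOn (fun ρ => |GLTangential.perp g u (c (τ + T₁ ρ))|) (Icc r R) :=
        (hv.comp_continuousOn
          (continuousOn_const.add (hchart.radial₁.continuousOn.mono hsub))).abs
      have hcT₂ : ContinuousOn (fun ρ => |GLTangential.perp g u (c (τ - T₂ ρ))|) (Icc r R) :=
        (hv.comp_continuousOn
          (continuousOn_const.sub (hchart.radial₂.continuousOn.mono hsub))).abs
      exact hu.boundary_lower_bound hΩ huc hchart hM hMr hN hφ hφg hφl hr hrR hR hbound hperp
        (hC hεr') hcT₁ hcT₂ (fun _ _ _ => le_rfl) (fun _ _ _ => le_rfl)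
        (hΩ.integral_inv_mul_perp_le hg huc hchart hδL hε hr hεr hrR.le hR hγ.2 hK hglob
          (by linarith)) (hind β M T₁ T₂ a b hchart)
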